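/- Theorem 3.1. Let $n\ge 2$ and let $\Omega\subsetneq\mathbb R^n$ be a domain (a nonempty connected open set). Let $d(x)=\operatorname{dist}(x,\partial\Omega)$. Assume that: (a) $\Omega$ is uniformly Lipschitz, that is, there are $\varepsilon,L>0$, $M\in\mathbb N$ and a countable, locally finite family of open sets $U_i\subset\mathbb R^n$ such that: for every $x\in\partial\Omega$ the ball $B(x,\varepsilon)$ is contained in some $U_i$; no point of $\mathbb R^n$ lies in more than $M$ of the $U_i$; and for every $i$ there are Cartesian coordinates $(y',y_n)\in\mathbb R^{n-1}\times\mathbb R$ of $\mathbb R^n$ and a Lipschitz function $f:\mathbb R^{n-1}\to\mathbb R$ with Lipschitz constant at most $L$ such that $U_i\cap\Omega=U_i\cap\{(y',y_n): y_n>f(y')\}$; (b) $\Omega$ has finite inner radius, that is, $R_{in}:=\sup_{x\in\Omega}d(x)<\infty$; (c) $-\Delta d\ge 0$ in $\Omega$ in the sense of distributions, that is, $\int_\Omega d\,(-\Delta\varphi)\,dx\ge 0$ for all $\varphi\in C_0^\infty(\Omega)$ with $\varphi\ge 0$. Then there is a constant $c>0$ such that for all real-valued $u\in C_0^\infty(\Omega\times\mathbb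 R)$ (smooth functions with compact support in $\Omega\times\mathbb R$) $$\int_0^{+\infty}\!\int_\Omega|\nabla_{(x,y)}u(x,y)|^2\,dx\,dy\;\ge\;\frac2\pi\int_\Omega\frac{u^2(x,0)}{d(x)}\,dx+c\left(\int_0^{+\infty}\!\int_\Omega|u(x,y)|^{\frac{2(n+1)}{n-1}}\,dx\,dy\right)^{\frac{n-1}{n+1}}.$$ -/

import Mathlib

open MeasureTheory Set
open scoped ContDiff

/-- Euclidean space `ℝⁿ`. -/
abbrev Rn (n : ℕ) : Type := EuclideanSpace ℝ (Fin n)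

/-- A domain of `ℝⁿ`: a nonempty, open and connected set. -/
structure IsDomainSet {n : ℕ} (Ω : Set (Rn n)) : Prop where
  isOpen : IsOpen Ω
  isConnected : IsConnected Ω

/-- The distance `d(x) = dist(x, ∂Ω)` to the boundary of `Ω`. -/
noncomputable def bdryDist {n : ℕ} (Ω : Set (Rn n)) (x : Rn n) : ℝ :=
  Metric.infDist x (frontier Ω)

/-- `R_in = sup_{x ∈ Ω} d(x)` is finite. -/
def FiniteInnerRadius {n : ℕ} (Ω : Set (Rn n)) : Prop :=
  BddAbove (bdryDist Ω '' Ω)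

/-- The classes `C_0^∞(U)`: real-valued smooth functions on the whole space whose support is a
compact subset of `U`. -/
structure IsTestFunction {E : Type*} [NormedAddCommGroup E] [NormedSpace ℝ E]
    (U : Set E) (φ : E → ℝ) : Prop where
  smooth : ContDiff ℝ ∞ φ
  hasCompactSupport : HasCompactSupport φ
  tsupport_subset : tsupport φ ⊆ U

/-- `-Δ d ≥ 0` in `Ω` in the sense of distributions:
`∫_Ω d (-Δ φ) dx ≥ 0` for every nonnegative test function `φ ∈ C_0^∞(Ω)`. -/
def WeaklyMeanConvex {n : ℕ} (Ω : Set (Rn n)) : Prop :=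
  ∀ φ : Rn n → ℝ, IsTestFunction Ω φ → (∀ x, 0 ≤ φ x) →
    0 ≤ ∫ x in Ω, bdryDist Ω x * (-(Laplacian.laplacian φ x))

/-- Let `ν` be a unit vector and use the Cartesian coordinates `(y', y_n)` of `ℝⁿ` in which
`y_n = ⟪ν, x⟫` and `y'` is the orthogonal projection of `x` to the hyperplane `ν^⊥`. This is the
open region `{y_n > f(y')}` above the graph of `f : ν^⊥ → ℝ`. -/
def epigraphAlong {n : ℕ} (ν : Rn n) (f : (Submodule.span ℝ {ν})ᗮ → ℝ) : Set (Rn n) :=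
  {x | f ((Submodule.span ℝ {ν})ᗮ.orthogonalProjectionOnto x) < inner ℝ ν x}

/-- `Ω` has a uniformly Lipschitz boundary (Stein's condition): there are `ε, L > 0`, `M ∈ ℕ` and a
countable, locally finite family of open sets `U i` (some of which may be empty) such that every
ball `B(x, ε)` about a boundary point lies in some `U i`, no point lies in more than `M` of the
`U i`, and in each `U i` the set `Ω` is, in suitable Cartesian coordinates, the region above the
graph of a Lipschitz function with Lipschitz constant at most `L`. -/
def UniformlyLipschitz {n : ℕ} (Ω : Set (Rn n)) : Prop :=
  ∃ (ε : ℝ) (L : NNReal) (M : ℕ) (U : ℕ → Set (Rn n)), 0 < ε ∧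
    (∀ i, IsOpen (U i)) ∧
    LocallyFinite U ∧
    (∀ x ∈ frontier Ω, ∃ i, Metric.ball x ε ⊆ U i) ∧
    (∀ x, {i | x ∈ U i}.encard ≤ (M : ℕ∞)) ∧
    (∀ i, ∃ (ν : Rn n) (f : (Submodule.span ℝ {ν})ᗮ → ℝ), ‖ν‖ = 1 ∧ LipschitzWith L f ∧
      U i ∩ Ω = U i ∩ epigraphAlong ν f)

/-- `|∇_{(x,y)} u(x,y)|² = |∇_x u(x,y)|² + (∂_y u(x,y))²`, with Euclidean norms. -/
noncomputable def gradSq {n : ℕ} (u : Rn n × ℝ → ℝ) (x : Rn n) (y : ℝ) : ℝ :=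
  ‖gradient (fun z : Rn n => u (z, y)) x‖ ^ 2 + (deriv (fun t : ℝ => u (x, t)) y) ^ 2

/-! ### Geometry of the distance to the boundary. -/

section BoundaryDistance

variable {n : ℕ} {Ω : Set (Rn n)}

/-! Put `s = d(x)`, `r = √(s² + y²)`, and let `θ = arctan(s / y)` be the polar angle, so that `θ =
π/2` on `{y = 0}` and `θ → 0` at `∂Ω` for `y > 0`. It is harmonic in `(s, y)` and increasing in `s`
for `y > 0`. Since `|∇d| = 1` almost everywhere and `-Δd ≥ 0`, the function `θ(d(x), y)` is weakly
superharmonic in `Ω × (0, ∞)`, and `-∂_yθ / θ` equals exactly `2 / (π d)` at `y = 0`. Substituting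
`u = θ v` therefore bounds the energy of `u` below by the trace term plus `∫ θ²|∇v|²`. It remains to
control the critical norm by what is left over.

Ground state: `groundState_le` keeps half of `∫ θ²|∇v|²` and also `(1/8) ∫ η v²` with `η = y / (R +
y)³` and `d ≤ R`. The second term comes from perturbing the test function against which `-Δd ≥ 0` is
used, and completing a square (`groundState_pointwise`). It controls `u` away from `{y = 0}`; this
is one use of the finite inner radius.

Hardy: the error `u ∇θ / θ` between `∇u` and `θ∇v` has size `|u| / (rθ)`.
`UniformlyLipschitz.exists_integral_hardyWeight_le` bounds `∫ |u|^p / (rθ)` by `J + N`, with `J = ∫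
|u|^(p-1) θ|∇v|` and `N = ∫ |u|^p`. One integrates by parts vertically, and horizontally along the
graph directions, in which `d` grows at a definite rate near a Lipschitz boundary. For `p = 2` on a
short length scale, absorption then gives the `L²` bound `UniformlyLipschitz.exists_integral_sq_le`.

Sobolev: the `L¹` Gagliardo–Nirenberg–Sobolev inequality on the half-space
(`exists_halfSpace_sobolev`), applied to `|u|^p` with `p = 2n/(n-1)`, bounds `X = ∫
|u|^(2(n+1)/(n-1))` by a multiple of `(J + N)^((n+1)/n)`. By Cauchy–Schwarz `J²` and `N²` are at
most `X` times `∫ θ²|∇v|²` and `∫ u²`. Cancelling one power of `X` gives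
`UniformlyLipschitz.exists_rpow_integral_le`. -/

theorem bdryDist_lipschitz (Ω : Set (Rn n)) : LipschitzWith 1 (bdryDist Ω) :=
  Metric.lipschitz_infDist_pt _

theorem IsDomainSet.frontier_nonempty (hΩ : IsDomainSet Ω) (hne : Ω ≠ univ) :
    (frontier Ω).Nonempty :=
  nonempty_frontier_iff.2 ⟨hΩ.isConnected.nonempty, hne⟩

theorem bdryDist_pos (hΩ : IsOpen Ω) (hne : (frontier Ω).Nonempty) {x : Rn n} (hx : x ∈ Ω) :
    0 < bdryDist Ω x := by
  rw [bdryDist, ← isClosed_frontier.notMem_iff_infDist_pos hne, hΩ.frontier_eq]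
  exact fun h => h.2 hx

/-- The ball is connected and misses `∂Ω`, so it lies entirely in the interior of `Ω` or entirely in
the exterior, and its centre decides which. -/
theorem ball_bdryDist_subset {x : Rn n} (hx : x ∈ Ω) : Metric.ball x (bdryDist Ω x) ⊆ Ω := by
  have h : Disjoint (Metric.ball x (bdryDist Ω x)) (frontier Ω) := Metric.disjoint_ball_infDist
  rcases (Metric.ball x (bdryDist Ω x)).eq_empty_or_nonempty with he | ⟨y, hy⟩
  · simp [he]
  refine ((convex_ball x _).isPreconnected.subset_left_of_subset_union isOpen_interior
    isClosed_closure.isOpen_compl (disjoint_compl_right_iff_subset.2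
      (interior_subset.trans subset_closure)) (fun z hz => ?_) ?_).trans interior_subset
  · by_contra hz'
    rw [mem_union, mem_compl_iff, not_or, not_not] at hz'
    exact disjoint_left.1 h hz ⟨hz'.2, hz'.1⟩
  · have hx' := Metric.mem_ball_self (x := x) (dist_nonneg.trans_lt hy)
    refine ⟨x, hx', by_contra fun hxi => disjoint_left.1 h hx' ⟨subset_closure hx, hxi⟩⟩

theorem le_bdryDist_of_ball_subset (hΩ : IsOpen Ω) (hne : (frontier Ω).Nonempty) {x : Rn n} {r : ℝ}
    (h : Metric.ball x r ⊆ Ω) : r ≤ bdryDist Ω x := by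
  refine (Metric.le_infDist hne).2 fun y hy => ?_
  by_contra! hlt
  rw [hΩ.frontier_eq] at hy
  exact hy.2 (h (by rwa [Metric.mem_ball, dist_comm]))

/-- Eikonal equation for the distance to the boundary. -/
theorem norm_gradient_bdryDist (hΩ : IsOpen Ω) (hne : (frontier Ω).Nonempty) {x : Rn n}
    (hx : x ∈ Ω) (hd : DifferentiableAt ℝ (bdryDist Ω) x) : ‖gradient (bdryDist Ω) x‖ = 1 := by
  have hpos := bdryDist_pos hΩ hne hx
  refine le_antisymm ?_ ?_
  · rw [gradient, LinearIsometryEquiv.norm_map]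
    simpa using norm_fderiv_le_of_lipschitz ℝ (bdryDist_lipschitz Ω) (x₀ := x)
  obtain ⟨z, hz, hzd⟩ := isClosed_frontier.exists_infDist_eq_dist hne x
  change bdryDist Ω x = dist x z at hzd
  have hline : HasDerivAt (fun t : ℝ => bdryDist Ω (x + t • (z - x)))
      (fderiv ℝ (bdryDist Ω) x (z - x)) 0 := by
    simpa [HasLineDerivAt] using hd.hasFDerivAt.hasLineDerivAt (z - x)
  -- On the segment from `x` to a nearest boundary point `z`, the bound by the distance to `z` and
  -- the 1-Lipschitz bound from `x` coincide, so `d` is affine there; its slope forces `|∇d| ≥ 1`.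
  have heq : ∀ t ∈ Icc (0 : ℝ) 1, bdryDist Ω (x + t • (z - x)) = bdryDist Ω x - t * bdryDist Ω x := by
    intro t ht
    have h1 : bdryDist Ω (x + t • (z - x)) ≤ dist (x + t • (z - x)) z :=
      Metric.infDist_le_dist_of_mem hz
    have h2 : dist (x + t • (z - x)) z = (1 - t) * dist x z := by
      rw [dist_eq_norm, dist_eq_norm, show x + t • (z - x) - z = (1 - t) • (x - z) by module,
        norm_smul, Real.norm_of_nonneg (by linarith [ht.2])]
    have h3 : bdryDist Ω x ≤ bdryDist Ω (x + t • (z - x)) + dist x (x + t • (z - x)) :=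
      Metric.infDist_le_infDist_add_dist
    have h4 : dist x (x + t • (z - x)) = t * dist x z := by
      rw [dist_eq_norm, dist_eq_norm, show x - (x + t • (z - x)) = t • (x - z) by module,
        norm_smul, Real.norm_of_nonneg ht.1]
    rw [← hzd] at h2 h4
    linarith
  have hline2 : HasDerivWithinAt (fun t : ℝ => bdryDist Ω (x + t • (z - x)))
      (-bdryDist Ω x) (Icc 0 1) 0 := by
    have : HasDerivWithinAt (fun t : ℝ => bdryDist Ω x - t * bdryDist Ω x)
      (-bdryDist Ω x) (Icc 0 1) 0 := by
      simpa using (((hasDerivAt_id (0 : ℝ)).mul_const (bdryDist Ω x)).const_sub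
        (bdryDist Ω x)).hasDerivWithinAt
    exact this.congr heq (by simp)
  have heq2 : fderiv ℝ (bdryDist Ω) x (z - x) = -bdryDist Ω x :=
    (uniqueDiffOn_Icc_zero_one 0 (by simp)).eq_deriv _ hline.hasDerivWithinAt hline2
  have h5 : bdryDist Ω x ≤ ‖gradient (bdryDist Ω) x‖ * bdryDist Ω x := by
    calc bdryDist Ω x = |fderiv ℝ (bdryDist Ω) x (z - x)| := by
          rw [heq2, abs_neg, abs_of_pos hpos]
      _ ≤ ‖fderiv ℝ (bdryDist Ω) x‖ * ‖z - x‖ := (fderiv ℝ (bdryDist Ω) x).le_opNorm _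
      _ = _ := by rw [gradient, LinearIsometryEquiv.norm_map, hzd, dist_eq_norm', ]
  nlinarith

/-- Epigraphs of Lipschitz functions contain a cone with axis `ν`. -/
theorem epigraphAlong_cone {ν : Rn n} (hν : ‖ν‖ = 1) {L : NNReal}
    {f : (Submodule.span ℝ {ν})ᗮ → ℝ} (hf : LipschitzWith L f) {z h : Rn n} {t : ℝ}
    (hz : z ∈ epigraphAlong ν f) (hh : ‖h‖ * (1 + L) ≤ t) : z + t • ν + h ∈ epigraphAlong ν f := by
  simp only [epigraphAlong, mem_ofPred_eq] at hz ⊢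
  set P := (Submodule.span ℝ {ν})ᗮ.orthogonalProjectionOnto
  have hPν : P ν = 0 := by
    rw [Submodule.orthogonalProjectionOnto_eq_zero_iff, Submodule.orthogonal_orthogonal]
    exact Submodule.mem_span_singleton_self ν
  have hP : P (z + t • ν + h) = P z + P h := by
    rw [map_add, map_add, map_smul, hPν, smul_zero, add_zero]
  have h1 : f (P z + P h) ≤ f (P z) + L * ‖h‖ := by
    have h2 := hf.dist_le_mul (P z + P h) (P z)
    rw [Real.dist_eq, dist_eq_norm, add_sub_cancel_left] at h2
    have h3 : ‖P h‖ ≤ ‖h‖ := Submodule.norm_orthogonalProjectionOnto_apply_le _ _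
    have h4 : (L : ℝ) * ‖P h‖ ≤ L * ‖h‖ := by gcongr
    linarith [le_abs_self (f (P z + P h) - f (P z))]
  have h5 : inner ℝ ν (z + t • ν + h) = inner ℝ ν z + t + inner ℝ ν h := by
    rw [inner_add_right, inner_add_right, inner_smul_right, real_inner_self_eq_norm_sq, hν]; ring
  have h6 : -‖h‖ ≤ inner ℝ ν h := by
    have := abs_real_inner_le_norm ν h
    rw [hν, one_mul] at this
    exact neg_le_of_abs_le this
  rw [hP, h5]
  linarith

/-- Near the boundary, the distance to it grows linearly in the direction of the graph. -/
theorem bdryDist_add_smul_le (hΩ : IsOpen Ω) (hne : (frontier Ω).Nonempty) {ν : Rn n}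
    (hν : ‖ν‖ = 1) {L : NNReal} {f : (Submodule.span ℝ {ν})ᗮ → ℝ} (hf : LipschitzWith L f)
    {U : Set (Rn n)} (hU : U ∩ Ω = U ∩ epigraphAlong ν f) {x : Rn n} (hx : x ∈ Ω) {ρ : ℝ}
    (hball : Metric.ball x ρ ⊆ U) (hd : bdryDist Ω x ≤ ρ / 4) {t : ℝ} (ht : 0 ≤ t)
    (htρ : t ≤ ρ / 4) :
    bdryDist Ω x + (1 + L : ℝ)⁻¹ * t ≤ bdryDist Ω (x + t • ν) := by
  have hpos := bdryDist_pos hΩ hne hx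
  have hc : (1 + L : ℝ)⁻¹ ≤ 1 := inv_le_one_of_one_le₀ (by linarith [L.2])
  have hL : (0 : ℝ) < 1 + L := by linarith [L.2]
  have hct : (1 + L : ℝ)⁻¹ * t ≤ t := mul_le_of_le_one_left ht hc
  have hct0 : 0 ≤ (1 + L : ℝ)⁻¹ * t := by positivity
  refine le_bdryDist_of_ball_subset hΩ hne fun y hy => ?_
  set s := bdryDist Ω x
  rw [Metric.mem_ball, dist_eq_norm] at hy
  have hyU : y ∈ U := by
    refine hball ?_
    rw [Metric.mem_ball, dist_eq_norm]
    calc ‖y - x‖ = ‖(y - (x + t • ν)) + t • ν‖ := by congr 1; module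
      _ ≤ ‖y - (x + t • ν)‖ + ‖t • ν‖ := norm_add_le _ _
      _ < ρ := by rw [norm_smul, hν, Real.norm_of_nonneg ht]; linarith
  suffices hye : y ∈ epigraphAlong ν f from ((hU ▸ ⟨hyU, hye⟩ : y ∈ U ∩ Ω)).2
  set w := y - (x + t • ν)
  set q := s + (1 + L : ℝ)⁻¹ * t
  have hq : 0 < q := by positivity
  -- Split the offset `w` of `y` from `x + tν`: the part `(s/q) w` stays in the ball `B(x, s) ⊆ Ω`,
  -- while the rest has length at most `t / (1 + L)` and is absorbed by the cone.
  have hz : x + (s / q) • w ∈ epigraphAlong ν f := by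
    have hn : ‖(s / q) • w‖ < s := by
      rw [norm_smul, Real.norm_of_nonneg (by positivity)]
      calc s / q * ‖w‖ < s / q * q := by gcongr
        _ = s := by field_simp
    have hmem : x + (s / q) • w ∈ Metric.ball x s := by simpa [Metric.mem_ball, dist_eq_norm] using hn
    have h1 : x + (s / q) • w ∈ Ω := ball_bdryDist_subset hx hmem
    have h2 : x + (s / q) • w ∈ U := hball (Metric.ball_subset_ball (by linarith) hmem)
    exact (hU ▸ ⟨h2, h1⟩ : x + (s / q) • w ∈ U ∩ epigraphAlong ν f).2
  have := epigraphAlong_cone hν hf hz (h := (1 - s / q) • w) (t := t) ?_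
  · convert this using 1
    simp only [w]; module
  · have h1 : 1 - s / q = ((1 + L : ℝ)⁻¹ * t) / q := by
      rw [eq_div_iff hq.ne', sub_mul, div_mul_cancel₀ _ hq.ne']; simp [q]
    rw [norm_smul, h1, Real.norm_of_nonneg (by positivity)]
    calc (1 + L : ℝ)⁻¹ * t / q * ‖w‖ * (1 + L)
        ≤ (1 + L : ℝ)⁻¹ * t / q * q * (1 + L) := by gcongr
      _ = t := by rw [div_mul_cancel₀ _ hq.ne', mul_right_comm, inv_mul_cancel₀ hL.ne', one_mul]

/-- Lower bound for the derivative of the boundary distance in the direction of the graph; far from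
the boundary it is trivial. -/
theorem le_inner_gradient_bdryDist (hΩ : IsOpen Ω) (hne : (frontier Ω).Nonempty) {ν : Rn n}
    (hν : ‖ν‖ = 1) {L : NNReal} {f : (Submodule.span ℝ {ν})ᗮ → ℝ} (hf : LipschitzWith L f)
    {U : Set (Rn n)} (hU : U ∩ Ω = U ∩ epigraphAlong ν f) {x : Rn n} (hx : x ∈ Ω) {ρ : ℝ}
    (hρ : 0 < ρ) (hball : Metric.ball x ρ ⊆ U) (hd : DifferentiableAt ℝ (bdryDist Ω) x) :
    (1 + L : ℝ)⁻¹ - 8 / ρ * bdryDist Ω x ≤ inner ℝ (gradient (bdryDist Ω) x) ν := by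
  have hc : (1 + L : ℝ)⁻¹ ≤ 1 := inv_le_one_of_one_le₀ (by linarith [L.2])
  -- Once `d > ρ/4`, the constant 8 makes the left side at most `-1`, and Cauchy–Schwarz for two
  -- unit vectors suffices.
  by_cases hcase : bdryDist Ω x ≤ ρ / 4
  · have h1 : HasLineDerivAt ℝ (bdryDist Ω) (fderiv ℝ (bdryDist Ω) x ν) x ν :=
      hd.hasFDerivAt.hasLineDerivAt ν
    have h2 := h1.tendsto_slope_zero_right
    have h3 : (1 + L : ℝ)⁻¹ ≤ fderiv ℝ (bdryDist Ω) x ν := by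
      refine ge_of_tendsto h2 ?_
      filter_upwards [Ioo_mem_nhdsGT (show (0 : ℝ) < ρ / 4 by positivity)] with t ht
      have := bdryDist_add_smul_le hΩ hne hν hf hU hx hball hcase ht.1.le ht.2.le
      rw [smul_eq_mul, ← div_eq_inv_mul, le_div_iff₀ ht.1]
      linarith
    rw [gradient, InnerProductSpace.toDual_symm_apply]
    have := (bdryDist_pos hΩ hne hx).le
    have : 0 ≤ 8 / ρ * bdryDist Ω x := by positivity
    linarith
  · have h1 : |inner ℝ (gradient (bdryDist Ω) x) ν| ≤ 1 := by
      simpa [norm_gradient_bdryDist hΩ hne hx hd, hν] using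
        abs_real_inner_le_norm (gradient (bdryDist Ω) x) ν
    have h2 : 2 ≤ 8 / ρ * bdryDist Ω x := by
      push Not at hcase
      rw [div_mul_eq_mul_div, le_div_iff₀ hρ]; linarith
    linarith [neg_le_of_abs_le h1]

end BoundaryDistance

/-! ### Calculus of the polar angle. -/

section PolarAngle

/-- The polar angle of the point `(y, s)`, measured from the `y`-axis; it equals `arctan (s / y)`
when `s, y > 0`. -/
noncomputable def polarAngle (s y : ℝ) : ℝ := Real.pi / 2 - Real.arctan (y / s)

theorem polarAngle_zero (s : ℝ) : polarAngle s 0 = Real.pi / 2 := by simp [polarAngle]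

theorem polarAngle_pos (s y : ℝ) : 0 < polarAngle s y :=
  sub_pos.2 (Real.arctan_lt_pi_div_two _)

theorem polarAngle_le {s y : ℝ} (hs : 0 < s) (hy : 0 ≤ y) : polarAngle s y ≤ Real.pi / 2 := by
  have := Real.arctan_nonneg.2 (div_nonneg hy hs.le)
  unfold polarAngle; linarith

theorem polarAngle_le_two {s y : ℝ} (hs : 0 < s) (hy : 0 ≤ y) : polarAngle s y ≤ 2 := by
  linarith [polarAngle_le hs hy, Real.pi_le_four]

theorem polarAngle_le_div {s y : ℝ} (hs : 0 < s) (hy : 0 < y) : polarAngle s y ≤ s / y := by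
  rw [polarAngle, ← Real.arctan_inv_of_pos (div_pos hy hs), inv_div]
  have h0 : 0 < s / y := div_pos hs hy
  calc Real.arctan (s / y) ≤ Real.tan (Real.arctan (s / y)) :=
        Real.le_tan (Real.arctan_nonneg.2 h0.le) (Real.arctan_lt_pi_div_two _)
    _ = s / y := Real.tan_arctan _

/-- The left side is `sin θ`, so this is `sin θ ≤ θ`. -/
theorem div_sqrt_le_polarAngle {s : ℝ} (hs : 0 < s) (y : ℝ) :
    s / √(s ^ 2 + y ^ 2) ≤ polarAngle s y := by
  have h1 : Real.sin (polarAngle s y) ≤ polarAngle s y := Real.sin_le (polarAngle_pos s y).le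
  rw [polarAngle, Real.sin_pi_div_two_sub, Real.cos_arctan] at h1
  refine le_trans (le_of_eq ?_) h1
  have h2 : √(1 + (y / s) ^ 2) = √(s ^ 2 + y ^ 2) / s := by
    rw [show 1 + (y / s) ^ 2 = (s ^ 2 + y ^ 2) / s ^ 2 by field_simp, Real.sqrt_div (by positivity),
      Real.sqrt_sq hs.le]
  rw [h2, one_div_div]

theorem le_sqrt_mul_polarAngle {s : ℝ} (hs : 0 < s) (y : ℝ) :
    s ≤ √(s ^ 2 + y ^ 2) * polarAngle s y := by
  have h := div_sqrt_le_polarAngle hs y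
  rwa [div_le_iff₀' (by positivity)] at h

theorem hasDerivAt_polarAngle_left {s : ℝ} (hs : 0 < s) (y : ℝ) :
    HasDerivAt (fun s => polarAngle s y) (y / (s ^ 2 + y ^ 2)) s := by
  have h1 : HasDerivAt (fun s : ℝ => y / s) (-y / s ^ 2) s := by
    simpa [div_eq_mul_inv] using (hasDerivAt_inv hs.ne').const_mul y
  have h2 := (h1.arctan).const_sub (Real.pi / 2)
  refine h2.congr_deriv ?_
  field_simp

theorem hasDerivAt_polarAngle_right {s : ℝ} (hs : 0 < s) (y : ℝ) :
    HasDerivAt (fun y => polarAngle s y) (-s / (s ^ 2 + y ^ 2)) y := by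
  have h2 := (((hasDerivAt_id y).div_const s).arctan).const_sub (Real.pi / 2)
  refine h2.congr_deriv ?_
  simp only [id]
  field_simp

theorem continuous_polarAngle_right (s : ℝ) : Continuous (polarAngle s) := by
  unfold polarAngle; fun_prop

/-- `y ∂_s θ / θ` normalised: `y / ((s² + y²) θ)`. -/
noncomputable def angleRatioY (s y : ℝ) : ℝ := y / ((s ^ 2 + y ^ 2) * polarAngle s y)

/-- `-∂_y θ / θ = s / ((s² + y²) θ)`. -/
noncomputable def angleRatioS (s y : ℝ) : ℝ := s / ((s ^ 2 + y ^ 2) * polarAngle s y)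

theorem angleRatioY_nonneg (s : ℝ) {y : ℝ} (hy : 0 ≤ y) : 0 ≤ angleRatioY s y := by
  have := polarAngle_pos s y
  unfold angleRatioY; positivity

theorem angleRatioS_nonneg {s : ℝ} (hs : 0 ≤ s) (y : ℝ) : 0 ≤ angleRatioS s y := by
  have := polarAngle_pos s y
  unfold angleRatioS; positivity

theorem angleRatioS_zero (s : ℝ) : angleRatioS s 0 = 2 / Real.pi / s := by
  rw [angleRatioS, polarAngle_zero]
  by_cases hs : s = 0
  · simp [hs]
  · field_simp; ring

theorem angleRatioS_mul_le {s : ℝ} (hs : 0 < s) (y : ℝ) :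
    angleRatioS s y * √(s ^ 2 + y ^ 2) ≤ 1 := by
  have hθ := polarAngle_pos s y
  have h := le_sqrt_mul_polarAngle hs y
  have h0 : (0 : ℝ) < s ^ 2 + y ^ 2 := by positivity
  have hr : √(s ^ 2 + y ^ 2) ^ 2 = s ^ 2 + y ^ 2 := Real.sq_sqrt h0.le
  rw [angleRatioS, div_mul_eq_mul_div, div_le_one (by positivity)]
  calc s * √(s ^ 2 + y ^ 2) ≤ √(s ^ 2 + y ^ 2) * polarAngle s y * √(s ^ 2 + y ^ 2) := by gcongr
    _ = (s ^ 2 + y ^ 2) * polarAngle s y := by rw [mul_right_comm, ← sq, hr]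

theorem angleRatioS_le {s : ℝ} (hs : 0 < s) (y : ℝ) : angleRatioS s y ≤ 1 / s := by
  have h := angleRatioS_mul_le hs y
  have h1 : s ≤ √(s ^ 2 + y ^ 2) := Real.le_sqrt_of_sq_le (by nlinarith [sq_nonneg y])
  rw [le_div_iff₀ hs]
  exact (mul_le_mul_of_nonneg_left h1 (angleRatioS_nonneg hs.le y)).trans h

theorem angleRatioY_mul_le {s : ℝ} (hs : 0 < s) (y : ℝ) : angleRatioY s y * s ≤ 1 := by
  have h := angleRatioS_mul_le hs y
  have h1 : y ≤ √(s ^ 2 + y ^ 2) := Real.le_sqrt_of_sq_le (by nlinarith [sq_nonneg s])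
  calc angleRatioY s y * s = angleRatioS s y * y := by unfold angleRatioS angleRatioY; ring
    _ ≤ _ := (mul_le_mul_of_nonneg_left h1 (angleRatioS_nonneg hs.le y)).trans h

theorem angleRatioY_le {s : ℝ} (hs : 0 < s) (y : ℝ) : angleRatioY s y ≤ 1 / s := by
  rw [le_div_iff₀ hs]; exact angleRatioY_mul_le hs y

/-- The first term is `θ_ss / θ`. As `θ` is harmonic in `(s, y)`, the same term is `-θ_yy / θ` in
`hasDerivAt_angleRatioS`; this is what makes the two integrations by parts cancel in the ground
state identity. -/
theorem hasDerivAt_angleRatioY {s : ℝ} (hs : 0 < s) (y : ℝ) :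
    HasDerivAt (fun s => angleRatioY s y)
      (-2 * angleRatioY s y * angleRatioS s y * polarAngle s y - angleRatioY s y ^ 2) s := by
  have hθ := polarAngle_pos s y
  have h1 : HasDerivAt (fun s : ℝ => s ^ 2 + y ^ 2) (2 * s) s := by
    simpa using (hasDerivAt_pow 2 s).add_const (y ^ 2)
  have h := (h1.mul (hasDerivAt_polarAngle_left hs y)).inv
    (show (s ^ 2 + y ^ 2) * polarAngle s y ≠ 0 by positivity) |>.const_mul y
  refine (h.congr_deriv ?_)
  unfold angleRatioY angleRatioS
  simp only [Pi.mul_apply]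
  field_simp
  ring

theorem hasDerivAt_angleRatioS {s : ℝ} (hs : 0 < s) (y : ℝ) :
    HasDerivAt (fun y => angleRatioS s y)
      (-2 * angleRatioY s y * angleRatioS s y * polarAngle s y + angleRatioS s y ^ 2) y := by
  have hθ := polarAngle_pos s y
  have h1 : HasDerivAt (fun y : ℝ => s ^ 2 + y ^ 2) (2 * y) y := by
    simpa using (hasDerivAt_pow 2 y).const_add (s ^ 2)
  have h := (h1.mul (hasDerivAt_polarAngle_right hs y)).inv
    (show (s ^ 2 + y ^ 2) * polarAngle s y ≠ 0 by positivity) |>.const_mul s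
  refine (h.congr_deriv ?_)
  unfold angleRatioY angleRatioS
  simp only [Pi.mul_apply]
  field_simp
  ring

theorem hasDerivAt_div_polarAngle_sq {s : ℝ} (hs : 0 < s) (y : ℝ) :
    HasDerivAt (fun s => s / polarAngle s y ^ 2)
      (1 / polarAngle s y ^ 2 - 2 * (s / polarAngle s y ^ 2) * angleRatioY s y) s := by
  have hθ := polarAngle_pos s y
  have h := (hasDerivAt_id s).mul (((hasDerivAt_polarAngle_left hs y).pow 2).inv
    (show polarAngle s y ^ 2 ≠ 0 by positivity))
  refine h.congr_deriv ?_
  unfold angleRatioY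
  simp only [Pi.pow_apply, Pi.inv_apply, id]
  field_simp
  ring

/-- The Hardy weight `1 / (r θ)` is dominated by its radial and angular parts. -/
theorem hardyWeight_le {s y : ℝ} (hs : 0 < s) (hy : 0 ≤ y) :
    1 / (√(s ^ 2 + y ^ 2) * polarAngle s y) ≤
      2 * (s ^ 2 / √(s ^ 2 + y ^ 2) ^ 3 + angleRatioY s y) := by
  have hθ := polarAngle_pos s y
  have h := le_sqrt_mul_polarAngle hs y
  have h0 : (0 : ℝ) < s ^ 2 + y ^ 2 := by positivity
  have hr : √(s ^ 2 + y ^ 2) ^ 2 = s ^ 2 + y ^ 2 := Real.sq_sqrt h0.le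
  have hr0 : 0 < √(s ^ 2 + y ^ 2) := Real.sqrt_pos.2 h0
  rw [angleRatioY]
  set r := √(s ^ 2 + y ^ 2)
  set θ := polarAngle s y
  have hyr : y ≤ r := Real.le_sqrt_of_sq_le (by nlinarith [sq_nonneg s])
  have hsr : s ≤ r := Real.le_sqrt_of_sq_le (by nlinarith [sq_nonneg y])
  -- The claim with denominators cleared. Multiplied by `r²`, it follows from `s ≤ rθ`, from `s, y ≤
  -- r`, and from `r⁴ ≤ 2(s⁴ + y⁴)`.
  have key : r ^ 2 ≤ 2 * (s ^ 2 * θ + y * r) := by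
    have e1 : s ^ 3 ≤ s ^ 2 * (r * θ) := by nlinarith [sq_nonneg s]
    have e2 : s ^ 4 + y ^ 4 ≤ r * (s ^ 3) + y * r ^ 3 := by
      have : s ^ 4 ≤ r * s ^ 3 := by
        rw [pow_succ s 3]; nlinarith [pow_pos hs 3]
      have : y ^ 4 ≤ y * r ^ 3 := by
        rw [show y ^ 4 = y * y ^ 3 by ring]; gcongr
      linarith
    have e3 : r ^ 4 ≤ 2 * (s ^ 4 + y ^ 4) := by
      rw [show r ^ 4 = (r ^ 2) ^ 2 by ring, hr]; nlinarith [sq_nonneg (s ^ 2 - y ^ 2)]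
    have e4 : r ^ 2 * r ^ 2 ≤ (2 * (s ^ 2 * θ + y * r)) * r ^ 2 := by nlinarith
    exact le_of_mul_le_mul_right e4 (by positivity)
  rw [div_le_iff₀ (by positivity), ← hr]
  have : 2 * (s ^ 2 / r ^ 3 + y / (r ^ 2 * θ)) * (r * θ) = 2 * (s ^ 2 * θ + y * r) / r ^ 2 := by
    field_simp
  rw [this, le_div_iff₀ (by positivity), one_mul]
  exact key

end PolarAngle

/-! ### Extending weak superharmonicity to Lipschitz test functions. -/

/-- A real Lipschitz function on a finite-dimensional space, convolved with a smooth bump. -/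
theorem LipschitzWith.hasFDerivAt_convolution_normed {E : Type*} [NormedAddCommGroup E]
    [InnerProductSpace ℝ E] [FiniteDimensional ℝ E] [MeasurableSpace E] [BorelSpace E]
    {K : NNReal} {ψ : E → ℝ} (hψ : LipschitzWith K ψ) (φ : ContDiffBump (0 : E)) (x : E) :
    HasFDerivAt (fun x => ∫ t, φ.normed volume t • ψ (x - t))
      (∫ t, φ.normed volume t • fderiv ℝ ψ (x - t)) x := by
  refine (hasFDerivAt_integral_of_dominated_loc_of_lip' (s := univ)
    (bound := fun t => φ.normed volume t * K) Filter.univ_mem ?_ ?_ ?_ ?_ ?_ ?_).2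
  · intro x _
    exact ((φ.continuous_normed).smul
      (hψ.continuous.comp (continuous_const.sub continuous_id))).aestronglyMeasurable
  · exact ((φ.continuous_normed).smul
      (hψ.continuous.comp (continuous_const.sub continuous_id))).integrable_of_hasCompactSupport
      (φ.hasCompactSupport_normed.smul_right)
  · exact φ.continuous_normed.aestronglyMeasurable.smul
      ((measurable_fderiv ℝ ψ).comp (measurable_const.sub measurable_id)).aestronglyMeasurable
  · refine Filter.Eventually.of_forall fun t z _ => ?_
    rw [← smul_sub, norm_smul, Real.norm_of_nonneg (φ.nonneg_normed t), mul_assoc]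
    refine mul_le_mul_of_nonneg_left ?_ (φ.nonneg_normed t)
    simpa using hψ.norm_sub_le (z - t) (x - t)
  · exact φ.integrable_normed.mul_const _
  · have h : ∀ᵐ t ∂(volume : Measure E), DifferentiableAt ℝ ψ (x - t) :=
      (Measure.measurePreserving_sub_left volume x).quasiMeasurePreserving.ae hψ.ae_differentiableAt
    filter_upwards [h] with t ht
    exact ((hasFDerivAt_comp_sub t).2 ht.hasFDerivAt).fun_const_smul _

/-- Integration by parts of a Lipschitz function against the Laplacian of a test function. -/
theorem LipschitzWith.integral_mul_neg_laplacian {n : ℕ} {K : NNReal} {d : Rn n → ℝ}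
    (hd : LipschitzWith K d) {φ : Rn n → ℝ} (hφ : ContDiff ℝ ∞ φ) (hc : HasCompactSupport φ) :
    ∫ x, d x * (-(Laplacian.laplacian φ x)) = ∫ x, fderiv ℝ φ x (gradient d x) := by
  let b := EuclideanSpace.basisFun (Fin n) ℝ
  have hφ1 : ∀ i, ContDiff ℝ ∞ (fun x => fderiv ℝ φ x (b i)) := fun i =>
    (hφ.fderiv_right (m := ∞) (by simp)).clm_apply contDiff_const
  have hc1 : ∀ i, HasCompactSupport (fun x => fderiv ℝ φ x (b i)) := fun i =>
    hc.fderiv_apply ℝ (b i)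
  have hlip : ∀ i, ∃ D, LipschitzWith D (fun x => fderiv ℝ φ x (b i)) := fun i =>
    ContDiff.lipschitzWith_of_hasCompactSupport (hc1 i) (hφ1 i) (by simp)
  have key : ∀ i, ∫ x, lineDeriv ℝ d x (b i) * fderiv ℝ φ x (b i) =
      ∫ x, d x * (-(fderiv ℝ (fun x => fderiv ℝ φ x (b i)) x (b i))) := by
    intro i
    obtain ⟨D, hD⟩ := hlip i
    rw [hd.integral_lineDeriv_mul_eq hD (hc1 i)]
    refine integral_congr_ae (Filter.Eventually.of_forall fun x => ?_)
    have := ((hφ1 i).differentiable (by simp) x).lineDeriv_eq_fderiv (v := -(b i))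
    simp only [this, map_neg]
    ring
  have hlap : ∀ x, Laplacian.laplacian φ x =
      ∑ i, fderiv ℝ (fun x => fderiv ℝ φ x (b i)) x (b i) := by
    intro x
    rw [InnerProductSpace.laplacian_eq_iteratedFDeriv_orthonormalBasis φ b]
    refine Finset.sum_congr rfl fun i _ => ?_
    rw [iteratedFDeriv_two_apply]
    have hdiff : DifferentiableAt ℝ (fderiv ℝ φ) x :=
      (hφ.fderiv_right (m := ∞) (by simp)).differentiable (by simp) x
    rw [fderiv_clm_apply hdiff (differentiableAt_const _)]
    simp
  have hint : ∀ i, Integrable (fun x => d x * (-(fderiv ℝ (fun x => fderiv ℝ φ x (b i)) x (b i)))) := by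
    intro i
    refine Continuous.integrable_of_hasCompactSupport ?_ ?_
    · exact hd.continuous.mul (((hφ1 i).continuous_fderiv_apply (by simp)).comp
        (continuous_id.prodMk continuous_const)).neg
    · exact ((hc1 i).fderiv_apply ℝ (b i)).neg.mul_left
  have hint2 : ∀ i, Integrable (fun x => lineDeriv ℝ d x (b i) * fderiv ℝ φ x (b i)) := by
    intro i
    refine Integrable.bdd_mul (c := K * ‖b i‖)
      ((hφ1 i).continuous.integrable_of_hasCompactSupport (hc1 i)) ?_ ?_
    · exact (measurable_lineDeriv hd.continuous).aestronglyMeasurable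
    · exact Filter.Eventually.of_forall fun x => norm_lineDeriv_le_of_lipschitz ℝ hd
  calc ∫ x, d x * (-(Laplacian.laplacian φ x))
      = ∫ x, ∑ i, d x * (-(fderiv ℝ (fun x => fderiv ℝ φ x (b i)) x (b i))) := by
        refine integral_congr_ae (Filter.Eventually.of_forall fun x => ?_)
        simp only [hlap, ← Finset.mul_sum, Finset.sum_neg_distrib]
    _ = ∑ i, ∫ x, lineDeriv ℝ d x (b i) * fderiv ℝ φ x (b i) := by
        rw [integral_finsetSum _ fun i _ => hint i]
        exact Finset.sum_congr rfl fun i _ => (key i).symm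
    _ = ∫ x, ∑ i, lineDeriv ℝ d x (b i) * fderiv ℝ φ x (b i) := by
        rw [integral_finsetSum _ fun i _ => hint2 i]
    _ = ∫ x, fderiv ℝ φ x (gradient d x) := by
        refine integral_congr_ae ?_
        filter_upwards [hd.ae_differentiableAt] with x hx
        conv_rhs => rw [← b.sum_repr (gradient d x), map_sum]
        refine Finset.sum_congr rfl fun i _ => ?_
        rw [hx.lineDeriv_eq_fderiv, map_smul, smul_eq_mul, b.repr_apply_apply, real_inner_comm,
          gradient, InnerProductSpace.toDual_symm_apply]

theorem LipschitzWith.norm_gradient_le {n : ℕ} {K : NNReal} {d : Rn n → ℝ}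
    (hd : LipschitzWith K d) (x : Rn n) : ‖gradient d x‖ ≤ K := by
  rw [gradient, LinearIsometryEquiv.norm_map]
  exact norm_fderiv_le_of_lipschitz ℝ hd

theorem measurable_gradient' {n : ℕ} (d : Rn n → ℝ) : Measurable (gradient d) :=
  (InnerProductSpace.toDual ℝ (Rn n)).symm.continuous.measurable.comp (measurable_fderiv ℝ d)
open Filter Topology Convolution in
/-- Weak superharmonicity, tested against Lipschitz functions. -/
theorem WeaklyMeanConvex.integral_fderiv_gradient_nonneg {n : ℕ} {Ω : Set (Rn n)}
    (hconv : WeaklyMeanConvex Ω) (hΩ : IsOpen Ω) {K : NNReal} {ψ : Rn n → ℝ}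
    (hψ : LipschitzWith K ψ) (hc : HasCompactSupport ψ) (hsub : tsupport ψ ⊆ Ω)
    (h0 : ∀ x, 0 ≤ ψ x) :
    0 ≤ ∫ x in Ω, fderiv ℝ ψ x (gradient (bdryDist Ω) x) := by
  have hd : LipschitzWith 1 (bdryDist Ω) := Metric.lipschitz_infDist_pt _
  obtain ⟨δ, hδ, hδΩ⟩ := IsCompact.exists_cthickening_subset_open hc hΩ hsub
  -- Mollification radii at most `δ` keep all supports in one compact subset of `Ω`.
  let r : ℕ → ℝ := fun k => δ / (k + 1)
  have hr : ∀ k, 0 < r k := fun k => by positivity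
  have hrδ : ∀ k, r k ≤ δ := fun k => div_le_self hδ.le (by linarith [Nat.cast_nonneg (α := ℝ) k])
  let φ : ℕ → ContDiffBump (0 : Rn n) := fun k =>
    ⟨r k / 2, r k, half_pos (hr k), half_lt_self (hr k)⟩
  let Ψ : ℕ → Rn n → ℝ := fun k x => ∫ t, (φ k).normed volume t • ψ (x - t)
  have hΨd : ∀ k x, HasFDerivAt (Ψ k) (∫ t, (φ k).normed volume t • fderiv ℝ ψ (x - t)) x :=
    fun k x => hψ.hasFDerivAt_convolution_normed (φ k) x
  have hΨconv : ∀ k, Ψ k = (φ k).normed volume ⋆[ContinuousLinearMap.lsmul ℝ ℝ, volume] ψ := by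
    intro k; ext x; simp [Ψ, convolution]
  have hΨ0 : ∀ k x, x ∉ Metric.cthickening δ (tsupport ψ) → Ψ k x = 0 := by
    intro k x hx
    refine integral_eq_zero_of_ae (Eventually.of_forall fun t => ?_)
    by_cases ht : t ∈ Metric.ball (0 : Rn n) (r k)
    · have : ψ (x - t) = 0 := by
        by_contra hne
        refine hx (Metric.mem_cthickening_of_dist_le _ (x - t) _ _
          (subset_tsupport _ hne) ?_)
        rw [mem_ball_zero_iff] at ht
        simpa [dist_eq_norm] using (ht.le.trans (hrδ k))
      simp [this]
    · have : (φ k).normed volume t = 0 := by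
        have := (φ k).support_normed_eq (μ := volume)
        by_contra hne
        exact ht (this ▸ hne)
      simp [this]
  have hcomp : IsCompact (Metric.cthickening δ (tsupport ψ)) := IsCompact.cthickening hc
  have hΨts : ∀ k, tsupport (Ψ k) ⊆ Metric.cthickening δ (tsupport ψ) := fun k =>
    closure_minimal (fun x hx => by_contra fun h => hx (hΨ0 k x h)) Metric.isClosed_cthickening
  have hΨtest : ∀ k, IsTestFunction Ω (Ψ k) := by
    intro k
    refine ⟨?_, hcomp.of_isClosed_subset (isClosed_tsupport _) (hΨts k), (hΨts k).trans hδΩ⟩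
    rw [hΨconv]
    exact (φ k).hasCompactSupport_normed.contDiff_convolution_left _ (φ k).contDiff_normed
      hψ.continuous.locallyIntegrable
  have hnn : ∀ k, 0 ≤ ∫ x, fderiv ℝ (Ψ k) x (gradient (bdryDist Ω) x) := by
    intro k
    rw [← hd.integral_mul_neg_laplacian (hΨtest k).smooth (hΨtest k).hasCompactSupport]
    have h1 := hconv (Ψ k) (hΨtest k) fun x =>
      integral_nonneg fun t => mul_nonneg ((φ k).nonneg_normed t) (h0 _)
    rwa [setIntegral_eq_integral_of_forall_compl_eq_zero] at h1
    intro x hx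
    have : x ∉ tsupport (Ψ k) := fun h => hx (hδΩ (hΨts k h))
    have h2 : Laplacian.laplacian (Ψ k) x = 0 := by
      have h3 : Ψ k =ᶠ[𝓝 x] fun _ => (0 : ℝ) := notMem_tsupport_iff_eventuallyEq.1 this
      rw [(InnerProductSpace.laplacian_congr_nhds h3).eq_of_nhds]
      simp
    simp [h2]
  have hfd : ∀ k x, ‖fderiv ℝ (Ψ k) x‖ ≤ K := by
    intro k x
    rw [(hΨd k x).fderiv]
    calc ‖∫ t, (φ k).normed volume t • fderiv ℝ ψ (x - t)‖
        ≤ ∫ t, (φ k).normed volume t * K := by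
          refine norm_integral_le_of_norm_le ((φ k).integrable_normed.mul_const _)
            (Eventually.of_forall fun t => ?_)
          rw [norm_smul, Real.norm_of_nonneg ((φ k).nonneg_normed t)]
          exact mul_le_mul_of_nonneg_left (norm_fderiv_le_of_lipschitz ℝ hψ)
            ((φ k).nonneg_normed t)
      _ = K := by rw [integral_mul_const, (φ k).integral_normed, one_mul]
  have hloc : LocallyIntegrable (fderiv ℝ ψ) (volume : Measure (Rn n)) := by
    refine (locallyIntegrable_const (K : ℝ)).mono
      (measurable_fderiv ℝ ψ).aestronglyMeasurable (Eventually.of_forall fun x => ?_)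
    simpa using norm_fderiv_le_of_lipschitz ℝ hψ
  -- The gradient of `ψ` is only bounded and measurable, so the mollified gradients converge almost
  -- everywhere, by Lebesgue differentiation; the fixed ratio 2 of the bump radii is needed for
  -- this.
  have hae := ContDiffBump.ae_convolution_tendsto_right_of_locallyIntegrable (μ := volume)
    (φ := φ) (l := atTop) (K := 2) (g := fderiv ℝ ψ) ?_ ?_ hloc
  rotate_left
  · have : Tendsto (fun k : ℕ => δ / ((k : ℝ) + 1)) atTop (𝓝 0) :=
      tendsto_const_nhds.div_atTop (tendsto_natCast_atTop_atTop.atTop_add tendsto_const_nhds)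
    exact this
  · exact Eventually.of_forall fun k => by change r k ≤ 2 * (r k / 2); linarith
  have hlim : Tendsto (fun k => ∫ x, fderiv ℝ (Ψ k) x (gradient (bdryDist Ω) x)) atTop
      (𝓝 (∫ x, fderiv ℝ ψ x (gradient (bdryDist Ω) x))) := by
    refine tendsto_integral_of_dominated_convergence
      ((Metric.cthickening δ (tsupport ψ)).indicator fun _ => (K : ℝ)) ?_ ?_ ?_ ?_
    · intro k
      have h1 : Measurable (fun x => fderiv ℝ (Ψ k) x (gradient (bdryDist Ω) x)) :=
        (isBoundedBilinearMap_apply.continuous (𝕜 := ℝ)).measurable.comp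
          ((measurable_fderiv ℝ (Ψ k)).prodMk (measurable_gradient' _))
      exact h1.aestronglyMeasurable
    · exact (integrable_indicator_iff hcomp.measurableSet).2
        (integrableOn_const hcomp.measure_lt_top.ne)
    · refine fun k => Eventually.of_forall fun x => ?_
      by_cases hx : x ∈ Metric.cthickening δ (tsupport ψ)
      · rw [indicator_of_mem hx]
        calc _ ≤ ‖fderiv ℝ (Ψ k) x‖ * ‖gradient (bdryDist Ω) x‖ := ContinuousLinearMap.le_opNorm _ _
          _ ≤ K * 1 := mul_le_mul (hfd k x) (hd.norm_gradient_le x) (norm_nonneg _) K.2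
          _ = K := mul_one _
      · have : fderiv ℝ (Ψ k) x = 0 := by
          have := notMem_tsupport_iff_eventuallyEq.1 (fun h => hx (hΨts k h))
          rw [this.fderiv_eq]; simp
        simp [this, hx]
    · filter_upwards [hae] with x hx
      have h2 : Tendsto (fun k => fderiv ℝ (Ψ k) x) atTop (𝓝 (fderiv ℝ ψ x)) := by
        refine hx.congr fun k => ?_
        rw [(hΨd k x).fderiv]; simp [convolution]
      exact ((ContinuousLinearMap.apply ℝ ℝ (gradient (bdryDist Ω) x)).continuous.tendsto _).comp h2
  have := ge_of_tendsto' hlim hnn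
  rwa [setIntegral_eq_integral_of_forall_compl_eq_zero]
  intro x hx
  have : x ∉ tsupport ψ := fun h => hx (hsub h)
  rw [(notMem_tsupport_iff_eventuallyEq.1 this).fderiv_eq]; simp

/-! ### The ground state substitution, and integrability of the expressions it produces. -/

section Setup

variable {n : ℕ} {Ω : Set (Rn n)} {u : Rn n × ℝ → ℝ}

/-- The gradient of `u` in the first variable. -/
noncomputable def xGrad (u : Rn n × ℝ → ℝ) (z : Rn n × ℝ) : Rn n :=
  gradient (fun x => u (x, z.2)) z.1

/-- The partial derivative of `u` in the last variable. -/
noncomputable def yDeriv (u : Rn n × ℝ → ℝ) (z : Rn n × ℝ) : ℝ :=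
  deriv (fun t => u (z.1, t)) z.2

theorem hasFDerivAt_slice_fst {u : Rn n × ℝ → ℝ} (hu : Differentiable ℝ u) (z : Rn n × ℝ) :
    HasFDerivAt (fun x => u (x, z.2))
      ((fderiv ℝ u z).comp (ContinuousLinearMap.inl ℝ (Rn n) ℝ)) z.1 :=
  (hu z).hasFDerivAt.comp z.1 (hasFDerivAt_prodMk_left z.1 z.2)

theorem hasDerivAt_slice_snd {u : Rn n × ℝ → ℝ} (hu : Differentiable ℝ u) (z : Rn n × ℝ) :
    HasDerivAt (fun t => u (z.1, t)) (fderiv ℝ u z (0, 1)) z.2 := by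
  have h := ((hu z).hasFDerivAt.comp z.2 (hasFDerivAt_prodMk_right z.1 z.2)).hasDerivAt
  exact h.congr_deriv (by simp)

theorem xGrad_eq (hu : Differentiable ℝ u) (z : Rn n × ℝ) :
    xGrad u z = (InnerProductSpace.toDual ℝ (Rn n)).symm
      ((fderiv ℝ u z).comp (ContinuousLinearMap.inl ℝ (Rn n) ℝ)) := by
  rw [xGrad, gradient, (hasFDerivAt_slice_fst hu z).fderiv]

theorem yDeriv_eq (hu : Differentiable ℝ u) (z : Rn n × ℝ) : yDeriv u z = fderiv ℝ u z (0, 1) :=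
  (hasDerivAt_slice_snd hu z).deriv

theorem hasDerivAt_yDeriv (hu : Differentiable ℝ u) (x : Rn n) (y : ℝ) :
    HasDerivAt (fun t => u (x, t)) (yDeriv u (x, y)) y := by
  rw [yDeriv_eq hu]; exact hasDerivAt_slice_snd hu (x, y)

theorem hasFDerivAt_xGrad (hu : Differentiable ℝ u) (x : Rn n) (y : ℝ) :
    HasFDerivAt (fun x => u (x, y)) (innerSL ℝ (xGrad u (x, y))) x := by
  have := hasFDerivAt_slice_fst hu (x, y)
  rw [xGrad_eq hu]
  refine this.congr_fderiv ?_
  ext v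
  rw [innerSL_apply_apply, InnerProductSpace.toDual_symm_apply]

theorem continuous_xGrad (hu : ContDiff ℝ ∞ u) : Continuous (xGrad u) := by
  have : xGrad u = fun z => (InnerProductSpace.toDual ℝ (Rn n)).symm
      ((fderiv ℝ u z).comp (ContinuousLinearMap.inl ℝ (Rn n) ℝ)) :=
    funext (xGrad_eq (hu.differentiable (by simp)))
  rw [this]
  exact (LinearIsometryEquiv.continuous _).comp
    ((hu.continuous_fderiv (by simp)).clm_comp continuous_const)

theorem continuous_yDeriv (hu : ContDiff ℝ ∞ u) : Continuous (yDeriv u) := by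
  rw [show yDeriv u = fun z => fderiv ℝ u z (0, 1) from
    funext (yDeriv_eq (hu.differentiable (by simp)))]
  exact (hu.continuous_fderiv (by simp)).clm_apply continuous_const

theorem xGrad_eq_zero (hu : Differentiable ℝ u) {z : Rn n × ℝ} (hz : z ∉ tsupport u) :
    xGrad u z = 0 := by
  rw [xGrad_eq hu, (notMem_tsupport_iff_eventuallyEq.1 hz).fderiv_eq]
  simp

theorem yDeriv_eq_zero (hu : Differentiable ℝ u) {z : Rn n × ℝ} (hz : z ∉ tsupport u) :
    yDeriv u z = 0 := by
  rw [yDeriv_eq hu, (notMem_tsupport_iff_eventuallyEq.1 hz).fderiv_eq]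
  simp

variable (Ω) in
/-- The polar angle of `(y, d(x))`. -/
noncomputable def angle (z : Rn n × ℝ) : ℝ := polarAngle (bdryDist Ω z.1) z.2

variable (Ω) in
/-- `y / (r² θ)` in terms of `(x, y)`. -/
noncomputable def wY (z : Rn n × ℝ) : ℝ := angleRatioY (bdryDist Ω z.1) z.2

variable (Ω) in
/-- `d / (r² θ)` in terms of `(x, y)`. -/
noncomputable def wS (z : Rn n × ℝ) : ℝ := angleRatioS (bdryDist Ω z.1) z.2

@[fun_prop] theorem continuous_bdryDist : Continuous (bdryDist Ω) := (bdryDist_lipschitz Ω).continuous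

@[fun_prop] theorem measurable_bdryDist : Measurable (bdryDist Ω) := continuous_bdryDist.measurable

@[fun_prop] theorem measurable_angle : Measurable (angle Ω) :=
  by unfold angle polarAngle; fun_prop

@[fun_prop] theorem measurable_wY : Measurable (wY Ω) := by
  change Measurable fun z : Rn n × ℝ => z.2 / ((bdryDist Ω z.1 ^ 2 + z.2 ^ 2) * angle Ω z)
  fun_prop

@[fun_prop] theorem measurable_wS : Measurable (wS Ω) := by
  change Measurable fun z : Rn n × ℝ => bdryDist Ω z.1 / ((bdryDist Ω z.1 ^ 2 + z.2 ^ 2) * angle Ω z)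
  fun_prop

@[fun_prop] theorem measurable_gradient_bdryDist : Measurable (gradient (bdryDist Ω)) :=
  measurable_gradient' _

variable (Ω u) in
/-- Horizontal part of `θ ∇(u / θ)`. -/
noncomputable def groundX (z : Rn n × ℝ) : Rn n :=
  xGrad u z - (u z * wY Ω z) • gradient (bdryDist Ω) z.1

variable (Ω u) in
/-- Vertical part of `θ ∇(u / θ)`. -/
noncomputable def groundY (z : Rn n × ℝ) : ℝ := yDeriv u z + u z * wS Ω z

variable (Ω u) in
/-- The energy density `θ² |∇(u / θ)|²` of the ground state representation. -/
noncomputable def groundEnergy (z : Rn n × ℝ) : ℝ := ‖groundX Ω u z‖ ^ 2 + groundY Ω u z ^ 2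

variable (Ω) in
/-- Lebesgue measure on `Ω × (0, ∞)`. -/
noncomputable def cylMeasure : Measure (Rn n × ℝ) :=
  (volume.restrict Ω).prod (volume.restrict (Ioi (0 : ℝ)))

theorem cylMeasure_eq : cylMeasure Ω = volume.restrict (Ω ×ˢ Ioi (0 : ℝ)) := by
  rw [cylMeasure, Measure.prod_restrict]; rfl

variable (u) in
/-- Measurable functions that are bounded on the part of the support of `u` in `{y > 0}`. -/
def Tame (f : Rn n × ℝ → ℝ) : Prop :=
  Measurable f ∧ ∃ C, ∀ z ∈ tsupport u, 0 < z.2 → |f z| ≤ C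

theorem Tame.mul {f g : Rn n × ℝ → ℝ} (hf : Tame u f) (hg : Tame u g) :
    Tame u (fun z => f z * g z) := by
  obtain ⟨hf, C, hC⟩ := hf
  obtain ⟨hg, D, hD⟩ := hg
  refine ⟨hf.mul hg, C * D, fun z hz hy => ?_⟩
  rw [abs_mul]
  exact mul_le_mul (hC z hz hy) (hD z hz hy) (abs_nonneg _) ((abs_nonneg _).trans (hC z hz hy))

theorem Tame.add {f g : Rn n × ℝ → ℝ} (hf : Tame u f) (hg : Tame u g) :
    Tame u (fun z => f z + g z) := by
  obtain ⟨hf, C, hC⟩ := hf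
  obtain ⟨hg, D, hD⟩ := hg
  exact ⟨hf.add hg, C + D, fun z hz hy =>
    (abs_add_le _ _).trans (add_le_add (hC z hz hy) (hD z hz hy))⟩

theorem Tame.neg {f : Rn n × ℝ → ℝ} (hf : Tame u f) : Tame u (fun z => -f z) := by
  obtain ⟨hf, C, hC⟩ := hf
  exact ⟨hf.neg, C, fun z hz hy => by rw [abs_neg]; exact hC z hz hy⟩

theorem Tame.sub {f g : Rn n × ℝ → ℝ} (hf : Tame u f) (hg : Tame u g) :
    Tame u (fun z => f z - g z) := by
  simpa only [sub_eq_add_neg] using hf.add hg.neg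

theorem Tame.const (c : ℝ) : Tame u (fun _ => c) := ⟨measurable_const, |c|, fun _ _ _ => le_rfl⟩

theorem Tame.pow {f : Rn n × ℝ → ℝ} (hf : Tame u f) (k : ℕ) : Tame u (fun z => f z ^ k) := by
  obtain ⟨hf, C, hC⟩ := hf
  exact ⟨hf.pow_const k, C ^ k, fun z hz hy => by
    rw [abs_pow]; exact pow_le_pow_left₀ (abs_nonneg _) (hC z hz hy) k⟩

theorem Tame.abs {f : Rn n × ℝ → ℝ} (hf : Tame u f) : Tame u (fun z => |f z|) := by
  obtain ⟨hf, C, hC⟩ := hf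
  exact ⟨hf.abs, C, fun z hz hy => by rw [abs_abs]; exact hC z hz hy⟩

theorem Tame.rpow {f : Rn n × ℝ → ℝ} (hf : Tame u f) {p : ℝ} (hp : 0 ≤ p) :
    Tame u (fun z => |f z| ^ p) := by
  obtain ⟨hf, C, hC⟩ := hf
  refine ⟨hf.abs.pow_const p, C ^ p, fun z hz hy => ?_⟩
  rw [abs_of_nonneg (by positivity)]
  exact Real.rpow_le_rpow (abs_nonneg _) (hC z hz hy) hp

theorem Tame.sqrt {f : Rn n × ℝ → ℝ} (hf : Tame u f) : Tame u (fun z => √(f z)) := by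
  obtain ⟨hf, C, hC⟩ := hf
  refine ⟨hf.sqrt, √C, fun z hz hy => ?_⟩
  rw [abs_of_nonneg (Real.sqrt_nonneg _)]
  exact Real.sqrt_le_sqrt ((le_abs_self _).trans (hC z hz hy))

theorem Tame.of_abs_le {f g : Rn n × ℝ → ℝ} (hg : Tame u g) (hf : Measurable f)
    (h : ∀ z ∈ tsupport u, 0 < z.2 → |f z| ≤ |g z|) : Tame u f := by
  obtain ⟨-, C, hC⟩ := hg
  exact ⟨hf, C, fun z hz hy => (h z hz hy).trans (hC z hz hy)⟩

theorem Tame.of_continuous (hc : HasCompactSupport u) {f : Rn n × ℝ → ℝ} (hf : Continuous f) :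
    Tame u f := by
  obtain ⟨C, hC⟩ := IsCompact.exists_bound_of_continuousOn hc hf.continuousOn
  exact ⟨hf.measurable, C, fun z hz _ => hC z hz⟩

/-- `cylMeasure Ω` lives on `{y > 0}`, so a bound on that part of the compact support is enough.
Integrability of the long expressions below then reduces to closure of `Tame` under arithmetic. -/
theorem Tame.integrable {f : Rn n × ℝ → ℝ} (hf : Tame u f) (hc : HasCompactSupport u)
    (h0 : ∀ z ∉ tsupport u, f z = 0) : Integrable f (cylMeasure Ω) := by
  obtain ⟨hf, C, hC⟩ := hf
  have hK : IsCompact (tsupport u) := hc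
  rw [cylMeasure_eq]
  have hint : Integrable ((tsupport u).indicator fun _ => C) (volume.restrict (Ω ×ˢ Ioi (0 : ℝ))) :=
    (integrable_indicator_iff hK.measurableSet).2
      (integrableOn_const ((Measure.restrict_apply_le _ _).trans_lt hK.measure_lt_top).ne)
  refine hint.mono' hf.aestronglyMeasurable ?_
  have hae : ∀ᵐ z ∂(volume.restrict (Ω ×ˢ Ioi (0 : ℝ))), z.2 ∈ Ioi (0 : ℝ) := by
    refine ae_mono (Measure.restrict_mono (s' := Prod.snd ⁻¹' Ioi (0 : ℝ))
      (fun z hz => hz.2) le_rfl) ?_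
    exact ae_restrict_mem (measurableSet_Ioi.preimage measurable_snd)
  filter_upwards [hae] with z hy
  by_cases hz : z ∈ tsupport u
  · simpa [hz] using hC z hz hy
  · simp [hz, h0 z hz]

variable (hΩ : IsOpen Ω) (hne : (frontier Ω).Nonempty) (hu : IsTestFunction (Ω ×ˢ (univ : Set ℝ)) u)

include hu

theorem IsTestFunction.mem_of_tsupport {z : Rn n × ℝ} (hz : z ∈ tsupport u) : z.1 ∈ Ω :=
  (hu.tsupport_subset hz).1

theorem IsTestFunction.differentiable : Differentiable ℝ u := hu.smooth.differentiable (by simp)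

theorem IsTestFunction.measurable : Measurable u := hu.smooth.continuous.measurable

theorem IsTestFunction.tame : Tame u u := Tame.of_continuous hu.hasCompactSupport hu.smooth.continuous

include hΩ hne

/-- By compactness the support stays away from `∂Ω`, so all singular weights are bounded on it and
no approximation near the boundary is needed. -/
theorem exists_pos_le_bdryDist : ∃ δ > 0, ∀ z ∈ tsupport u, δ ≤ bdryDist Ω z.1 := by
  have hK : IsCompact (tsupport u) := hu.hasCompactSupport
  rcases (tsupport u).eq_empty_or_nonempty with he | hn
  · exact ⟨1, one_pos, by simp [he]⟩
  obtain ⟨z, hz, hmin⟩ := hK.exists_isMinOn hn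
    (continuous_bdryDist.comp continuous_fst).continuousOn (f := fun z : Rn n × ℝ => bdryDist Ω z.1)
  exact ⟨_, bdryDist_pos hΩ hne (hu.mem_of_tsupport hz), fun w hw => hmin hw⟩

theorem tame_inv_bdryDist : Tame u (fun z => 1 / bdryDist Ω z.1) := by
  obtain ⟨δ, hδ, h⟩ := exists_pos_le_bdryDist hΩ hne hu
  refine ⟨by fun_prop, 1 / δ, fun z hz _ => ?_⟩
  have h1 := h z hz
  rw [abs_of_nonneg (one_div_nonneg.2 (hδ.le.trans h1))]
  exact one_div_le_one_div_of_le hδ h1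

theorem tame_wY : Tame u (wY Ω) := by
  refine (tame_inv_bdryDist hΩ hne hu).of_abs_le measurable_wY fun z hz hy => ?_
  have hd := bdryDist_pos hΩ hne (hu.mem_of_tsupport hz)
  rw [wY, abs_of_nonneg (angleRatioY_nonneg _ hy.le), abs_of_nonneg (by positivity)]
  exact angleRatioY_le hd _

theorem tame_wS : Tame u (wS Ω) := by
  refine (tame_inv_bdryDist hΩ hne hu).of_abs_le measurable_wS fun z hz hy => ?_
  have hd := bdryDist_pos hΩ hne (hu.mem_of_tsupport hz)
  rw [wS, abs_of_nonneg (angleRatioS_nonneg hd.le _), abs_of_nonneg (by positivity)]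
  exact angleRatioS_le hd _

omit hΩ hne in
theorem tame_xGrad : Tame u (fun z => ‖xGrad u z‖) :=
  Tame.of_continuous hu.hasCompactSupport (continuous_xGrad hu.smooth).norm

omit hΩ hne in
theorem tame_yDeriv : Tame u (yDeriv u) :=
  Tame.of_continuous hu.hasCompactSupport (continuous_yDeriv hu.smooth)

omit hΩ hne in
theorem tame_bdryDist : Tame u (fun z => bdryDist Ω z.1) :=
  Tame.of_continuous hu.hasCompactSupport (by fun_prop)

omit hΩ hne in
theorem tame_snd : Tame u (fun z => z.2) :=
  Tame.of_continuous hu.hasCompactSupport continuous_snd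

omit hΩ hne in
theorem measurable_groundX : Measurable (groundX Ω u) := by
  have h1 := hu.measurable
  have h2 := (continuous_xGrad hu.smooth).measurable
  unfold groundX
  fun_prop

theorem tame_groundX : Tame u (fun z => ‖groundX Ω u z‖) := by
  refine ((tame_xGrad hu).add (hu.tame.abs.mul (tame_wY hΩ hne hu).abs)).of_abs_le
    (measurable_groundX hu).norm fun z hz hy => ?_
  rw [abs_norm, abs_of_nonneg (by positivity)]
  refine (norm_sub_le _ _).trans ?_
  rw [norm_smul, norm_mul, Real.norm_eq_abs, Real.norm_eq_abs]
  have := (bdryDist_lipschitz Ω).norm_gradient_le z.1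
  have h1 : |u z| * |wY Ω z| * ‖gradient (bdryDist Ω) z.1‖ ≤ |u z| * |wY Ω z| * 1 := by
    gcongr; simpa using this
  linarith

theorem tame_groundY : Tame u (groundY Ω u) :=
  (tame_yDeriv hu).add (hu.tame.mul (tame_wS hΩ hne hu))

theorem tame_groundEnergy : Tame u (groundEnergy Ω u) :=
  ((tame_groundX hΩ hne hu).pow 2).add ((tame_groundY hΩ hne hu).pow 2)

theorem tame_inv_angle : Tame u (fun z => 1 / angle Ω z) := by
  have h : Tame u (fun z => 1 / bdryDist Ω z.1 * √(bdryDist Ω z.1 ^ 2 + z.2 ^ 2)) :=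
    (tame_inv_bdryDist hΩ hne hu).mul (((tame_bdryDist hu).pow 2).add ((tame_snd hu).pow 2)).sqrt
  refine h.of_abs_le (by fun_prop) fun z hz hy => ?_
  have hd := bdryDist_pos hΩ hne (hu.mem_of_tsupport hz)
  have hθ := polarAngle_pos (bdryDist Ω z.1) z.2
  rw [angle, abs_of_nonneg (one_div_nonneg.2 hθ.le), abs_of_nonneg (by positivity),
    div_le_iff₀ hθ, mul_assoc, one_div_mul_eq_div, one_le_div hd]
  exact le_sqrt_mul_polarAngle hd _

omit hΩ hne in
theorem groundX_eq_zero {z : Rn n × ℝ} (hz : z ∉ tsupport u) : groundX Ω u z = 0 := by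
  simp [groundX, xGrad_eq_zero hu.differentiable hz, image_eq_zero_of_notMem_tsupport hz]

omit hΩ hne in
theorem groundY_eq_zero {z : Rn n × ℝ} (hz : z ∉ tsupport u) : groundY Ω u z = 0 := by
  simp [groundY, yDeriv_eq_zero hu.differentiable hz, image_eq_zero_of_notMem_tsupport hz]

omit hΩ hne in
theorem groundEnergy_eq_zero {z : Rn n × ℝ} (hz : z ∉ tsupport u) : groundEnergy Ω u z = 0 := by
  simp [groundEnergy, groundX_eq_zero hu hz, groundY_eq_zero hu hz]

end Setup

theorem groundEnergy_nonneg {n : ℕ} {Ω : Set (Rn n)} {u : Rn n × ℝ → ℝ} (z : Rn n × ℝ) :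
    0 ≤ groundEnergy Ω u z := by unfold groundEnergy; positivity

/-! ### The trace Hardy inequality with a remainder. -/

section Energy

variable {n : ℕ} {Ω : Set (Rn n)} {u : Rn n × ℝ → ℝ}

theorem integral_Ioi_deriv_eq_neg {g g' : ℝ → ℝ} (hg : ∀ y ∈ Ici (0 : ℝ), HasDerivAt g (g' y) y)
    (hg' : ContinuousOn g' (Ici 0)) {Y : ℝ} (hY : ∀ y > Y, g y = 0 ∧ g' y = 0) :
    ∫ y in Ioi (0 : ℝ), g' y = -g 0 := by
  have hint : IntegrableOn g' (Ioi 0) := by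
    have h1 : IntegrableOn g' (Icc 0 Y) :=
      (hg'.mono Icc_subset_Ici_self).integrableOn_compact isCompact_Icc
    refine h1.of_forall_sdiff_eq_zero measurableSet_Ioi fun y hy => (hY y ?_).2
    by_contra! hle
    exact hy.2 ⟨(mem_Ioi.1 hy.1).le, hle⟩
  have hlim : Filter.Tendsto g Filter.atTop (nhds 0) := by
    refine tendsto_const_nhds.congr' ?_
    filter_upwards [Filter.eventually_gt_atTop Y] with y hy using (hY y hy).1.symm
  rw [integral_Ioi_of_hasDerivAt_of_tendsto' hg hint hlim, zero_sub]

/-- Weak superharmonicity of the boundary distance, tested with `w · m(d)`. -/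
theorem WeaklyMeanConvex.integral_comp_bdryDist_nonneg (hconv : WeaklyMeanConvex Ω) (hΩ : IsOpen Ω)
    (hne : (frontier Ω).Nonempty) {w : Rn n → ℝ} (hw : ContDiff ℝ 1 w) (hc : HasCompactSupport w)
    (hsub : tsupport w ⊆ Ω) (hw0 : ∀ x, 0 ≤ w x) {m m' : ℝ → ℝ}
    (hm : ∀ s > 0, HasDerivAt m (m' s) s) (hm' : ContinuousOn m' (Ioi 0))
    (hm0 : ∀ x ∈ Ω, 0 ≤ m (bdryDist Ω x)) :
    0 ≤ ∫ x in Ω, (m (bdryDist Ω x) * fderiv ℝ w x (gradient (bdryDist Ω) x) +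
      w x * m' (bdryDist Ω x)) := by
  have hK : IsCompact (tsupport w) := hc
  obtain ⟨a, ha, hab⟩ : ∃ a > 0, ∀ x ∈ tsupport w, a ≤ bdryDist Ω x := by
    rcases (tsupport w).eq_empty_or_nonempty with he | hn
    · exact ⟨1, one_pos, by simp [he]⟩
    obtain ⟨z, hz, hmin⟩ := hK.exists_isMinOn hn (continuous_bdryDist (Ω := Ω)).continuousOn
    exact ⟨_, bdryDist_pos hΩ hne (hsub hz), fun x hx => hmin hx⟩
  obtain ⟨b', hb'⟩ := hK.exists_bound_of_continuousOn (continuous_bdryDist (Ω := Ω)).continuousOn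
  set b := max a b'
  have hle : a ≤ b := le_max_left _ _
  have hdab : ∀ x ∈ tsupport w, bdryDist Ω x ∈ Icc a b := fun x hx =>
    ⟨hab x hx, ((le_abs_self _).trans (hb' x hx)).trans (le_max_right _ _)⟩
  have hsubI : Icc a b ⊆ Ioi 0 := fun s hs => ha.trans_le hs.1
  obtain ⟨C, hC⟩ := isCompact_Icc.exists_bound_of_continuousOn (hm'.mono hsubI)
  have hmlip : LipschitzOnWith (Real.toNNReal C) m (Icc a b) := by
    refine (convex_Icc a b).lipschitzOnWith_of_nnnorm_hasDerivWithin_le (f' := m')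
      (fun s hs => (hm s (hsubI hs)).hasDerivWithinAt) fun s hs => ?_
    rw [← NNReal.coe_le_coe, coe_nnnorm]
    exact (hC s hs).trans (Real.le_coe_toNNReal C)
  obtain ⟨B, hB⟩ := isCompact_Icc.exists_bound_of_continuousOn hmlip.continuousOn
  -- `m` is controlled only on compact subsets of `(0, ∞)`. Clamping `d` to `[a, b]` changes nothing
  -- on the support of `w` and makes the composition globally Lipschitz.
  let M : Rn n → ℝ := (Icc a b).domRestrict m ∘ projIcc a b hle ∘ bdryDist Ω
  have hMlip : LipschitzWith (Real.toNNReal C * (1 * 1)) M :=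
    hmlip.to_restrict.comp ((LipschitzWith.projIcc hle).comp (bdryDist_lipschitz Ω))
  have hMB : ∀ x, |M x| ≤ B := fun x => hB _ (projIcc a b hle (bdryDist Ω x)).2
  have hB0 : 0 ≤ B := (abs_nonneg _).trans (hMB 0)
  obtain ⟨D, hD⟩ := ContDiff.lipschitzWith_of_hasCompactSupport hc hw (by simp)
  obtain ⟨W, hW⟩ := hK.exists_bound_of_continuousOn hw.continuous.continuousOn
  have hW' : ∀ x, |w x| ≤ max W 0 := by
    intro x
    by_cases hx : x ∈ tsupport w
    · exact (hW x hx).trans (le_max_left _ _)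
    · simp [image_eq_zero_of_notMem_tsupport hx]
  have hψ : (fun x => w x * m (bdryDist Ω x)) = fun x => w x * M x := by
    ext x
    by_cases hx : x ∈ tsupport w
    · simp only [M, Function.comp, domRestrict_apply, projIcc_of_mem hle (hdab x hx)]
    · simp [image_eq_zero_of_notMem_tsupport hx]
  have hlip : LipschitzWith (Real.toNNReal (B * D + max W 0 * (Real.toNNReal C * (1 * 1) : NNReal)))
      (fun x => w x * m (bdryDist Ω x)) := by
    rw [hψ]
    refine LipschitzWith.of_dist_le' fun x y => ?_
    have h1 := hD.dist_le_mul x y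
    have h2 := hMlip.dist_le_mul x y
    rw [Real.dist_eq] at h1 h2 ⊢
    calc |w x * M x - w y * M y| = |M x * (w x - w y) + w y * (M x - M y)| := by congr 1; ring
      _ ≤ |M x| * |w x - w y| + |w y| * |M x - M y| := by
          rw [← abs_mul, ← abs_mul]; exact abs_add_le _ _
      _ ≤ B * (D * dist x y) + max W 0 * ((Real.toNNReal C * (1 * 1) : NNReal) * dist x y) := by
          gcongr
          · exact hMB x
          · exact hW' y
      _ = _ := by ring
  have hts : tsupport (fun x => w x * m (bdryDist Ω x)) ⊆ tsupport w := tsupport_mul_subset_left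
  have h0 : ∀ x, 0 ≤ w x * m (bdryDist Ω x) := by
    intro x
    by_cases hx : x ∈ tsupport w
    · exact mul_nonneg (hw0 x) (hm0 x (hsub hx))
    · simp [image_eq_zero_of_notMem_tsupport hx]
  refine (hconv.integral_fderiv_gradient_nonneg hΩ hlip hc.mul_right (hts.trans hsub) h0).trans_eq ?_
  refine integral_congr_ae ?_
  filter_upwards [ae_restrict_mem hΩ.measurableSet,
    ae_restrict_of_ae (bdryDist_lipschitz Ω).ae_differentiableAt] with x hx hdx
  have h1 : HasFDerivAt (fun x => m (bdryDist Ω x))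
      (m' (bdryDist Ω x) • fderiv ℝ (bdryDist Ω) x) x :=
    (hm _ (bdryDist_pos hΩ hne hx)).comp_hasFDerivAt x hdx.hasFDerivAt
  have h2 := ((hw.differentiable (by simp) x).hasFDerivAt.mul h1).fderiv
  -- By the eikonal equation, the chain-rule term of `m(d)` contributes just `w m'(d)`.
  have h3 : fderiv ℝ (bdryDist Ω) x (gradient (bdryDist Ω) x) = 1 := by
    rw [← InnerProductSpace.toDual_symm_apply (𝕜 := ℝ)]
    change inner ℝ (gradient (bdryDist Ω) x) (gradient (bdryDist Ω) x) = 1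
    rw [real_inner_self_eq_norm_sq, norm_gradient_bdryDist hΩ hne hx hdx, one_pow]
  have h4 : fderiv ℝ (fun x => w x * m (bdryDist Ω x)) x = w x • m' (bdryDist Ω x) • fderiv ℝ (bdryDist Ω) x +
      m (bdryDist Ω x) • fderiv ℝ w x := h2
  rw [h4]
  simp only [add_apply, smul_apply, smul_eq_mul, h3]
  ring

/-- The elementary bound `η d² ≤ θ²` for `η = y / (R + y)³`. -/
theorem decayWeight_mul_sq_le {s y R : ℝ} (hs : 0 < s) (hy : 0 < y) (hR : s ≤ R) :
    y / (R + y) ^ 3 * s ≤ polarAngle s y ^ 2 * angleRatioY s y ∧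
      y / (R + y) ^ 3 * (s / polarAngle s y) ^ 2 ≤ 1 := by
  have hθ := polarAngle_pos s y
  have h := le_sqrt_mul_polarAngle hs y
  have h0 : (0 : ℝ) < s ^ 2 + y ^ 2 := by positivity
  have hr : √(s ^ 2 + y ^ 2) ^ 2 = s ^ 2 + y ^ 2 := Real.sq_sqrt h0.le
  have hr0 : 0 < √(s ^ 2 + y ^ 2) := Real.sqrt_pos.2 h0
  have hrR : √(s ^ 2 + y ^ 2) ≤ R + y :=
    (Real.sqrt_le_left (by linarith)).2 (by nlinarith)
  rw [angleRatioY]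
  set r := √(s ^ 2 + y ^ 2)
  rw [← hr]
  set θ := polarAngle s y
  have hRy : 0 < R + y := by linarith
  constructor
  · calc y / (R + y) ^ 3 * s ≤ y / r ^ 3 * (r * θ) := by gcongr
      _ = θ ^ 2 * (y / (r ^ 2 * θ)) := by field_simp
  · have h1 : s / θ ≤ R + y := ((div_le_iff₀ hθ).2 h).trans hrR
    have h2 : y ≤ R + y := by linarith
    calc y / (R + y) ^ 3 * (s / θ) ^ 2 ≤ (R + y) / (R + y) ^ 3 * (R + y) ^ 2 := by gcongr
      _ = 1 := by field_simp

variable (hΩ : IsOpen Ω) (hne : (frontier Ω).Nonempty) (hu : IsTestFunction (Ω ×ˢ (univ : Set ℝ)) u)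

include hu

omit hΩ hne in
theorem exists_snd_bound : ∃ Y, ∀ x, ∀ y > Y, (x, y) ∉ tsupport u := by
  have hK : IsCompact (tsupport u) := hu.hasCompactSupport
  obtain ⟨Y, hY⟩ := hK.exists_bound_of_continuousOn (continuous_snd (X := Rn n) (Y := ℝ)).continuousOn
  exact ⟨Y, fun x y hy h => (((le_abs_self _).trans (hY _ h)).trans_lt hy).false⟩

/-- Vertical fundamental theorem of calculus producing the trace term. -/
theorem integral_vertical_trace {x : Rn n} (hx : 0 < bdryDist Ω x) :
    ∫ y in Ioi (0 : ℝ), (2 * u (x, y) * yDeriv u (x, y) * wS Ω (x, y) + u (x, y) ^ 2 *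
      (-2 * wY Ω (x, y) * wS Ω (x, y) * angle Ω (x, y) + wS Ω (x, y) ^ 2)) =
    -(2 / Real.pi * (u (x, 0) ^ 2 / bdryDist Ω x)) := by
  obtain ⟨Y, hY⟩ := exists_snd_bound hu
  set s := bdryDist Ω x
  have hcs : Continuous (angleRatioS s) :=
    continuous_iff_continuousAt.2 fun y => (hasDerivAt_angleRatioS hx y).continuousAt
  have hcy : Continuous (angleRatioY s) := by
    unfold angleRatioY
    refine continuous_id.div ?_ fun y => ?_
    · exact (by fun_prop : Continuous fun y : ℝ => s ^ 2 + y ^ 2).mul (continuous_polarAngle_right s)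
    · have := polarAngle_pos s y; positivity
  have hct := continuous_polarAngle_right s
  have hcu : Continuous fun y : ℝ => u (x, y) := hu.smooth.continuous.comp (by fun_prop)
  have hcd : Continuous fun y : ℝ => yDeriv u (x, y) :=
    (continuous_yDeriv hu.smooth).comp (by fun_prop)
  have := integral_Ioi_deriv_eq_neg (g := fun y => u (x, y) ^ 2 * angleRatioS s y)
    (g' := fun y => 2 * u (x, y) * yDeriv u (x, y) * wS Ω (x, y) + u (x, y) ^ 2 *
      (-2 * wY Ω (x, y) * wS Ω (x, y) * angle Ω (x, y) + wS Ω (x, y) ^ 2)) (Y := Y) ?_ ?_ ?_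
  · rw [this, angleRatioS_zero]
    ring
  · intro y _
    have h := ((hasDerivAt_yDeriv hu.differentiable x y).pow 2).mul (hasDerivAt_angleRatioS hx y)
    refine h.congr_deriv ?_
    simp only [Pi.pow_apply, wS, wY, angle]
    norm_num
    rfl
  · refine Continuous.continuousOn ?_
    exact (((continuous_const.mul hcu).mul hcd).mul hcs).add ((hcu.pow 2).mul
      ((((continuous_const.mul hcy).mul hcs).mul hct).add (hcs.pow 2)))
  · intro y hy
    simp [image_eq_zero_of_notMem_tsupport (hY x y hy)]

include hΩ hne

/-- Horizontal slice of the ground state representation. -/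
theorem integral_horizontal_nonneg (hconv : WeaklyMeanConvex Ω) {R : ℝ}
    (hR : ∀ x ∈ Ω, bdryDist Ω x ≤ R) {y : ℝ} (hy : 0 < y) :
    0 ≤ ∫ x in Ω, ((wY Ω (x, y) - 1 / 4 * (y / (R + y) ^ 3) * (bdryDist Ω x / angle Ω (x, y) ^ 2)) *
        (2 * u (x, y) * inner ℝ (xGrad u (x, y)) (gradient (bdryDist Ω) x)) +
      u (x, y) ^ 2 * ((-2 * wY Ω (x, y) * wS Ω (x, y) * angle Ω (x, y) - wY Ω (x, y) ^ 2) -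
        1 / 4 * (y / (R + y) ^ 3) * (1 / angle Ω (x, y) ^ 2 -
          2 * (bdryDist Ω x / angle Ω (x, y) ^ 2) * wY Ω (x, y)))) := by
  have hu1 : ContDiff ℝ ∞ (fun x => u (x, y)) := hu.smooth.comp (by fun_prop)
  have hcs : HasCompactSupport (fun x => u (x, y)) := by
    refine HasCompactSupport.intro (hu.hasCompactSupport.isCompact.image continuous_fst) ?_
    intro x hx
    by_contra h
    exact hx ⟨(x, y), subset_tsupport _ h, rfl⟩
  have hts : tsupport (fun x => u (x, y)) ⊆ Ω := by
    have : tsupport (fun x => u (x, y)) ⊆ (fun x => (x, y)) ⁻¹' tsupport u :=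
      closure_minimal (fun x hx => subset_tsupport _ hx)
        ((isClosed_tsupport u).preimage (by fun_prop))
    exact fun x hx => hu.mem_of_tsupport (this hx)
  have hts2 : tsupport (fun x => u (x, y) ^ 2) ⊆ tsupport (fun x => u (x, y)) :=
    closure_mono fun x hx h => hx (by simp only [h]; norm_num)
  have hcs2 : HasCompactSupport (fun x => u (x, y) ^ 2) :=
    hcs.of_isClosed_subset (isClosed_tsupport _) hts2
  -- The test function is `u² (θ_s/θ - η d / (4θ²))`. Its first part alone would give the ground
  -- state identity; the subtracted part produces the remainder, and is small enough to keep the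
  -- function nonnegative.
  have := hconv.integral_comp_bdryDist_nonneg hΩ hne (w := fun x => u (x, y) ^ 2)
    (m := fun s => angleRatioY s y - 1 / 4 * (y / (R + y) ^ 3) * (s / polarAngle s y ^ 2))
    (m' := fun s => (-2 * angleRatioY s y * angleRatioS s y * polarAngle s y - angleRatioY s y ^ 2) -
        1 / 4 * (y / (R + y) ^ 3) * (1 / polarAngle s y ^ 2 -
          2 * (s / polarAngle s y ^ 2) * angleRatioY s y))
    ((hu1.pow 2).of_le (by simp)) hcs2 (hts2.trans hts) (fun x => sq_nonneg _) ?_ ?_ ?_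
  · refine this.trans_eq (integral_congr_ae (Filter.Eventually.of_forall fun x => ?_))
    have hd : fderiv ℝ (fun x => u (x, y) ^ 2) x (gradient (bdryDist Ω) x) =
        2 * u (x, y) * inner ℝ (xGrad u (x, y)) (gradient (bdryDist Ω) x) := by
      rw [((hasFDerivAt_xGrad hu.differentiable x y).pow 2).fderiv]
      simp
    simp only [hd]
    rfl
  · intro s hs
    exact (hasDerivAt_angleRatioY hs y).sub ((hasDerivAt_div_polarAngle_sq hs y).const_mul _)
  · have h1 : ContinuousOn (fun s => polarAngle s y) (Ioi 0) := fun s hs =>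
      (hasDerivAt_polarAngle_left hs y).continuousAt.continuousWithinAt
    have h2 : ContinuousOn (fun s => angleRatioY s y) (Ioi 0) := fun s hs =>
      (hasDerivAt_angleRatioY hs y).continuousAt.continuousWithinAt
    have h3 : ContinuousOn (fun s => angleRatioS s y) (Ioi 0) := by
      refine continuousOn_id.div ((by fun_prop : ContinuousOn (fun s : ℝ => s ^ 2 + y ^ 2) _).mul h1) ?_
      intro s hs
      have := polarAngle_pos s y
      positivity
    have h4 : ∀ s ∈ Ioi (0 : ℝ), polarAngle s y ^ 2 ≠ 0 := fun s _ =>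
      (pow_pos (polarAngle_pos s y) 2).ne'
    have h5 : ContinuousOn (fun s => s / polarAngle s y ^ 2) (Ioi 0) :=
      continuousOn_id.div (h1.pow 2) h4
    have h6 : ContinuousOn (fun s => 1 / polarAngle s y ^ 2) (Ioi 0) :=
      continuousOn_const.div (h1.pow 2) h4
    fun_prop
  · intro x hx
    have hd := bdryDist_pos hΩ hne hx
    have hθ := polarAngle_pos (bdryDist Ω x) y
    have h1 := (decayWeight_mul_sq_le hd hy (hR x hx)).1
    have h2 : y / (R + y) ^ 3 * (bdryDist Ω x / polarAngle (bdryDist Ω x) y ^ 2) ≤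
        angleRatioY (bdryDist Ω x) y := by
      rw [← mul_div_assoc, div_le_iff₀ (by positivity)]; linarith
    have h3 := angleRatioY_nonneg (bdryDist Ω x) hy.le
    linarith

omit hne hu in
theorem ae_cylMeasure :
    ∀ᵐ z ∂(cylMeasure Ω), z.1 ∈ Ω ∧ 0 < z.2 ∧ DifferentiableAt ℝ (bdryDist Ω) z.1 := by
  have h1 : ∀ᵐ x ∂(volume.restrict Ω), x ∈ Ω ∧ DifferentiableAt ℝ (bdryDist Ω) x := by
    filter_upwards [ae_restrict_mem hΩ.measurableSet,
      ae_restrict_of_ae (bdryDist_lipschitz Ω).ae_differentiableAt] with x hx hdx using ⟨hx, hdx⟩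
  have h2 : ∀ᵐ y ∂(volume.restrict (Ioi (0 : ℝ))), y ∈ Ioi (0 : ℝ) :=
    ae_restrict_mem measurableSet_Ioi
  have h3 := (Measure.quasiMeasurePreserving_fst (μ := volume.restrict Ω)
    (ν := volume.restrict (Ioi (0 : ℝ)))).ae h1
  have h4 := (Measure.quasiMeasurePreserving_snd (μ := volume.restrict Ω)
    (ν := volume.restrict (Ioi (0 : ℝ)))).ae h2
  filter_upwards [h3, h4] with z hz hz' using ⟨hz.1, hz', hz.2⟩

omit hΩ hne in
theorem tame_decayWeight {R : ℝ} (hR0 : 0 < R) : Tame u (fun z => z.2 / (R + z.2) ^ 3) := by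
  refine ((tame_snd hu).mul (Tame.const (1 / R ^ 3))).of_abs_le (by fun_prop) fun z hz hy => ?_
  rw [abs_of_nonneg (by positivity), abs_of_nonneg (by positivity), div_eq_mul_one_div]
  gcongr
  linarith

theorem integrable_decayWeight {R : ℝ} (hR0 : 0 < R) :
    Integrable (fun z => z.2 / (R + z.2) ^ 3 * (u z / angle Ω z) ^ 2) (cylMeasure Ω) := by
  refine Tame.integrable (u := u) ?_ hu.hasCompactSupport fun z hz => by
    simp [image_eq_zero_of_notMem_tsupport hz]
  have h : Tame u (fun z => u z / angle Ω z) := by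
    simpa [div_eq_mul_inv] using hu.tame.mul (tame_inv_angle hΩ hne hu)
  exact (tame_decayWeight hu hR0).mul (h.pow 2)

omit hΩ hne hu in
-- Without the terms in `η` the right side minus the bracket tested against `-Δd` is exactly the
-- ground energy. With `q = v/θ`, `k = d/θ` and `G = g - vα`, the terms in `η` leave `(η/4)(2kqG +
-- q²)`. Completing the square in `kG + q/2` keeps `ηq²/8` at the cost of `ηk²G²/2`, and as `ηk² ≤
-- 1` this takes at most half of the energy.
theorem groundState_pointwise {X b v α σ θ g η d : ℝ} (hη0 : 0 ≤ η) (hk : η * (d / θ) ^ 2 ≤ 1)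
    (hCS : (g - v * α) ^ 2 ≤ X - 2 * (v * α) * g + (v * α) ^ 2) (hθ : θ ≠ 0) :
    1 / 2 * (X - 2 * (v * α) * g + (v * α) ^ 2 + (b + v * σ) ^ 2) + 1 / 8 * (η * (v / θ) ^ 2) +
      ((α - 1 / 4 * η * (d / θ ^ 2)) * (2 * v * g) + v ^ 2 * ((-2 * α * σ * θ - α ^ 2) -
        1 / 4 * η * (1 / θ ^ 2 - 2 * (d / θ ^ 2) * α))) ≤
    X + b ^ 2 + (2 * v * b * σ + v ^ 2 * (-2 * α * σ * θ + σ ^ 2)) := by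
  obtain ⟨q, rfl⟩ : ∃ q, v = q * θ := ⟨v / θ, by field_simp⟩
  obtain ⟨k, rfl⟩ : ∃ k, d = k * θ := ⟨d / θ, by field_simp⟩
  rw [mul_div_cancel_right₀ _ hθ] at hk ⊢
  have e1 : k * θ / θ ^ 2 = k / θ := by field_simp
  have e2 : (q * θ) ^ 2 * (1 / 4 * η * (1 / θ ^ 2 - 2 * (k / θ) * α)) =
      1 / 4 * η * (q ^ 2 - 2 * q ^ 2 * k * α * θ) := by field_simp
  have e3 : 1 / 4 * η * (k / θ) * (2 * (q * θ) * g) = 1 / 2 * η * k * q * g := by field_simp; ring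
  have h1 : η * k ^ 2 * (g - q * θ * α) ^ 2 ≤ (g - q * θ * α) ^ 2 :=
    mul_le_of_le_one_left (sq_nonneg _) hk
  have h2 : 0 ≤ η * (k * (g - q * θ * α) + q / 2) ^ 2 := mul_nonneg hη0 (sq_nonneg _)
  have h3 := sq_nonneg (b + q * θ * σ)
  rw [e1, sub_mul, mul_sub, e2, e3]
  nlinarith

/-- Improved trace Hardy inequality: ground state representation with remainder. -/
theorem groundState_le (hconv : WeaklyMeanConvex Ω) {R : ℝ}
    (hR0 : 0 < R) (hR : ∀ x ∈ Ω, bdryDist Ω x ≤ R) :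
    2 / Real.pi * (∫ x in Ω, u (x, 0) ^ 2 / bdryDist Ω x) +
      (1 / 2 * (∫ z, groundEnergy Ω u z ∂(cylMeasure Ω)) +
      1 / 8 * ∫ z, z.2 / (R + z.2) ^ 3 * (u z / angle Ω z) ^ 2 ∂(cylMeasure Ω)) ≤
    ∫ y in Ioi (0 : ℝ), ∫ x in Ω, gradSq u x y := by
  have hd := tame_bdryDist (Ω := Ω) hu
  have hα := tame_wY hΩ hne hu
  have hσ := tame_wS hΩ hne hu
  have hη := tame_decayWeight hu hR0
  have hi := tame_inv_angle hΩ hne hu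
  have hθ : Tame u (angle Ω) := by
    refine (Tame.const 2).of_abs_le measurable_angle fun z hz hy => ?_
    rw [angle, abs_of_nonneg (polarAngle_pos _ _).le, abs_of_pos two_pos]
    exact polarAngle_le_two (bdryDist_pos hΩ hne (hu.mem_of_tsupport hz)) hy.le
  have hg : Tame u (fun z => inner ℝ (xGrad u z) (gradient (bdryDist Ω) z.1)) := by
    refine (tame_xGrad hu).of_abs_le ((continuous_xGrad hu.smooth).measurable.inner
      (by fun_prop)) fun z _ _ => ?_
    rw [abs_norm]
    refine (abs_real_inner_le_norm _ _).trans (mul_le_of_le_one_right (norm_nonneg _) ?_)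
    simpa using (bdryDist_lipschitz Ω).norm_gradient_le z.1
  let V : Rn n × ℝ → ℝ := fun z => 2 * u z * yDeriv u z * wS Ω z + u z ^ 2 *
      (-2 * wY Ω z * wS Ω z * angle Ω z + wS Ω z ^ 2)
  let M : Rn n × ℝ → ℝ := fun z =>
      (wY Ω z - 1 / 4 * (z.2 / (R + z.2) ^ 3) * (bdryDist Ω z.1 / angle Ω z ^ 2)) *
        (2 * u z * inner ℝ (xGrad u z) (gradient (bdryDist Ω) z.1)) +
      u z ^ 2 * ((-2 * wY Ω z * wS Ω z * angle Ω z - wY Ω z ^ 2) -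
        1 / 4 * (z.2 / (R + z.2) ^ 3) * (1 / angle Ω z ^ 2 -
          2 * (bdryDist Ω z.1 / angle Ω z ^ 2) * wY Ω z))
  let S : Rn n × ℝ → ℝ := fun z => ‖xGrad u z‖ ^ 2 + yDeriv u z ^ 2
  have hz0 : ∀ z ∉ tsupport u, u z = 0 := fun z hz => image_eq_zero_of_notMem_tsupport hz
  have hVint : Integrable V (cylMeasure Ω) := by
    refine Tame.integrable (u := u) ?_ hu.hasCompactSupport fun z hz => by simp [V, hz0 z hz]
    exact ((((Tame.const 2).mul hu.tame).mul (tame_yDeriv hu)).mul hσ).add ((hu.tame.pow 2).mul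
      (((((Tame.const (-2)).mul hα).mul hσ).mul hθ).add (hσ.pow 2)))
  have hi2 : Tame u (fun z => 1 / angle Ω z ^ 2) := by simpa using hi.pow 2
  have hdi2 : Tame u (fun z => bdryDist Ω z.1 / angle Ω z ^ 2) := by
    simpa [div_eq_mul_inv] using hd.mul hi2
  have hMint : Integrable M (cylMeasure Ω) := by
    refine Tame.integrable (u := u) ?_ hu.hasCompactSupport fun z hz => by simp [M, hz0 z hz]
    exact ((hα.sub (((Tame.const (1 / 4)).mul hη).mul hdi2)).mul
      (((Tame.const 2).mul hu.tame).mul hg)).add ((hu.tame.pow 2).mul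
      ((((((Tame.const (-2)).mul hα).mul hσ).mul hθ).sub (hα.pow 2)).sub
        (((Tame.const (1 / 4)).mul hη).mul (hi2.sub (((Tame.const 2).mul hdi2).mul hα)))))
  have hSint : Integrable S (cylMeasure Ω) := by
    refine Tame.integrable (u := u) (((tame_xGrad hu).pow 2).add ((tame_yDeriv hu).pow 2))
      hu.hasCompactSupport fun z hz => ?_
    simp [S, xGrad_eq_zero hu.differentiable hz, yDeriv_eq_zero hu.differentiable hz]
  have hAint : Integrable (groundEnergy Ω u) (cylMeasure Ω) :=
    (tame_groundEnergy hΩ hne hu).integrable hu.hasCompactSupport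
      fun z hz => groundEnergy_eq_zero hu hz
  have hBint := integrable_decayWeight hΩ hne hu hR0
  have hV : ∫ z, V z ∂(cylMeasure Ω) =
      -(2 / Real.pi * (∫ x in Ω, u (x, 0) ^ 2 / bdryDist Ω x)) := by
    rw [cylMeasure, integral_prod _ hVint, ← integral_const_mul, ← integral_neg]
    refine setIntegral_congr_fun hΩ.measurableSet fun x hx => ?_
    exact integral_vertical_trace hu (bdryDist_pos hΩ hne hx)
  have hM : 0 ≤ ∫ z, M z ∂(cylMeasure Ω) := by
    rw [cylMeasure, integral_prod_symm _ hMint]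
    refine setIntegral_nonneg measurableSet_Ioi fun y hy => ?_
    exact integral_horizontal_nonneg hΩ hne hu hconv hR hy
  have hS : ∫ z, S z ∂(cylMeasure Ω) = ∫ y in Ioi (0 : ℝ), ∫ x in Ω, gradSq u x y := by
    rw [cylMeasure, integral_prod_symm _ hSint]
    rfl
  -- Here `V` integrates to minus the trace term and `M` has nonnegative integral, so integrating
  -- the pointwise inequality yields the claim.
  have hmono : ∫ z, (1 / 2 * groundEnergy Ω u z +
      1 / 8 * (z.2 / (R + z.2) ^ 3 * (u z / angle Ω z) ^ 2) + M z) ∂(cylMeasure Ω) ≤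
      ∫ z, (S z + V z) ∂(cylMeasure Ω) := by
    refine integral_mono_ae (((hAint.const_mul _).add (hBint.const_mul _)).add hMint)
      (hSint.add hVint) ?_
    filter_upwards [ae_cylMeasure hΩ] with z hz
    obtain ⟨hx, hy, hdiff⟩ := hz
    have hG := norm_gradient_bdryDist hΩ hne hx hdiff
    have hpos := bdryDist_pos hΩ hne hx
    have hk := (decayWeight_mul_sq_le hpos hy (hR z.1 hx)).2
    have hη0 : 0 ≤ z.2 / (R + z.2) ^ 3 := by positivity
    simp only [S, V, M, groundEnergy, groundY]
    have hP : ‖groundX Ω u z‖ ^ 2 = ‖xGrad u z‖ ^ 2 - 2 * (u z * wY Ω z) *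
        inner ℝ (xGrad u z) (gradient (bdryDist Ω) z.1) + (u z * wY Ω z) ^ 2 := by
      rw [groundX, norm_sub_sq_real, inner_smul_right, norm_smul, hG, mul_one, Real.norm_eq_abs,
        sq_abs]
      ring
    have hPG : inner ℝ (groundX Ω u z) (gradient (bdryDist Ω) z.1) =
        inner ℝ (xGrad u z) (gradient (bdryDist Ω) z.1) - u z * wY Ω z := by
      rw [groundX, inner_sub_left, inner_smul_left, real_inner_self_eq_norm_sq, hG]
      simp
    have hCS : (inner ℝ (xGrad u z) (gradient (bdryDist Ω) z.1) - u z * wY Ω z) ^ 2 ≤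
        ‖groundX Ω u z‖ ^ 2 := by
      have := abs_real_inner_le_norm (groundX Ω u z) (gradient (bdryDist Ω) z.1)
      rw [hG, mul_one, hPG] at this
      exact sq_le_sq.2 (by rwa [abs_norm])
    rw [hP] at hCS ⊢
    rw [← angle] at hk
    exact groundState_pointwise hη0 hk hCS (polarAngle_pos _ _).ne'
  have e1 : ∫ z, (S z + V z) ∂(cylMeasure Ω) = _ := integral_add hSint hVint
  have e2 : ∫ z, (1 / 2 * groundEnergy Ω u z +
      1 / 8 * (z.2 / (R + z.2) ^ 3 * (u z / angle Ω z) ^ 2) + M z) ∂(cylMeasure Ω) = _ :=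
    integral_add ((hAint.const_mul _).add (hBint.const_mul _)) hMint
  have e3 : ∫ z, (1 / 2 * groundEnergy Ω u z +
      1 / 8 * (z.2 / (R + z.2) ^ 3 * (u z / angle Ω z) ^ 2)) ∂(cylMeasure Ω) = _ :=
    integral_add (hAint.const_mul _) (hBint.const_mul _)
  rw [integral_const_mul, integral_const_mul] at e3
  rw [e1, e2] at hmono
  rw [e3, hV, hS] at hmono
  linarith

end Energy

/-! ### Localisation near the boundary. -/

section Cutoffs

variable {n : ℕ} {Ω : Set (Rn n)}

/-- Localisation near a uniformly Lipschitz boundary: cutoff functions with bounded overlap, each of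
them carrying a direction along which the distance to the boundary increases. -/
theorem UniformlyLipschitz.exists_cutoffs (hLip : UniformlyLipschitz Ω) (hΩ : IsOpen Ω)
    (hne : (frontier Ω).Nonempty) :
    ∃ (c ρ : ℝ) (K : NNReal) (M : ℕ) (U : ℕ → Set (Rn n)) (ν : ℕ → Rn n) (χ : ℕ → Rn n → ℝ),
      0 < c ∧ 0 < ρ ∧ LocallyFinite U ∧ (∀ x, {i | x ∈ U i}.encard ≤ (M : ℕ∞)) ∧
      (∀ i, ‖ν i‖ = 1) ∧ (∀ i, LipschitzWith K (χ i)) ∧ (∀ i x, 0 ≤ χ i x) ∧ (∀ i x, χ i x ≤ 1) ∧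
      (∀ i x, χ i x ≠ 0 → Metric.ball x ρ ⊆ U i) ∧
      (∀ x, bdryDist Ω x < ρ / 2 → ∃ i, χ i x = 1) ∧
      (∀ i, ∀ x ∈ Ω, Metric.ball x ρ ⊆ U i → DifferentiableAt ℝ (bdryDist Ω) x →
        c - 8 / ρ * bdryDist Ω x ≤ inner ℝ (gradient (bdryDist Ω) x) (ν i)) := by
  classical
  obtain ⟨ε, L, M, U, hε, -, hlf, hcov, hM, hgraph⟩ := hLip
  choose ν f hν hf hU using hgraph
  let T : ℕ → Set (Rn n) := fun i => {z | z ∈ frontier Ω ∧ Metric.ball z ε ⊆ U i}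
  -- Equal to 1 within `ε/4` of `T i` and to 0 beyond `ε/2`, so balls of radius `ρ = ε/2` about
  -- points where it is nonzero stay in `U i`. The empty case is separate because `Metric.infDist`
  -- to the empty set is 0, which would give the value 1.
  let χ : ℕ → Rn n → ℝ := fun i x =>
    if (T i).Nonempty then max 0 (min 1 (2 - 4 / ε * Metric.infDist x (T i))) else 0
  refine ⟨(1 + L : ℝ)⁻¹, ε / 2, Real.toNNReal (4 / ε), M, U, ν, χ, by positivity, by positivity, hlf,
    hM, hν, ?_, ?_, ?_, ?_, ?_, ?_⟩
  · intro i
    by_cases hT : (T i).Nonempty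
    · simp only [χ, hT, if_true]
      have h1 : LipschitzWith (Real.toNNReal (4 / ε))
          (fun x => 2 - 4 / ε * Metric.infDist x (T i)) := by
        refine LipschitzWith.of_dist_le' fun x y => ?_
        have := (Metric.lipschitz_infDist_pt (T i)).dist_le_mul x y
        rw [Real.dist_eq] at this ⊢
        rw [show 2 - 4 / ε * Metric.infDist x (T i) - (2 - 4 / ε * Metric.infDist y (T i)) =
          -(4 / ε * (Metric.infDist x (T i) - Metric.infDist y (T i))) by ring, abs_neg, abs_mul,
          abs_of_pos (by positivity : 0 < 4 / ε)]
        gcongr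
        simpa using this
      exact (h1.const_min 1).const_max 0
    · simp only [χ, hT, if_false]
      exact LipschitzWith.const' 0
  · intro i x
    simp only [χ]
    split_ifs
    · exact le_max_left _ _
    · exact le_rfl
  · intro i x
    simp only [χ]
    split_ifs
    · exact max_le zero_le_one (min_le_left _ _)
    · exact zero_le_one
  · intro i x hx
    have hT : (T i).Nonempty := by
      by_contra hT
      exact hx (by simp [χ, hT])
    have hlt : Metric.infDist x (T i) < ε / 2 := by
      by_contra! hle
      apply hx
      have h4 : 2 ≤ 4 / ε * Metric.infDist x (T i) := by
        rw [div_mul_eq_mul_div, le_div_iff₀ hε]; linarith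
      simp only [χ, hT, if_true]
      exact max_eq_left ((min_le_right _ _).trans (by linarith))
    obtain ⟨z, hz, hxz⟩ := (Metric.infDist_lt_iff hT).1 hlt
    refine subset_trans (fun w hw => ?_) hz.2
    rw [Metric.mem_ball] at hw ⊢
    linarith [dist_triangle w x z]
  · intro x hx
    obtain ⟨z, hz, hxz⟩ := isClosed_frontier.exists_infDist_eq_dist hne x
    obtain ⟨i, hi⟩ := hcov z hz
    have hzT : z ∈ T i := ⟨hz, hi⟩
    have h1 : Metric.infDist x (T i) ≤ bdryDist Ω x :=
      (Metric.infDist_le_dist_of_mem hzT).trans_eq hxz.symm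
    refine ⟨i, ?_⟩
    have hT : (T i).Nonempty := ⟨z, hzT⟩
    have h4 : 4 / ε * Metric.infDist x (T i) ≤ 1 := by
      rw [div_mul_eq_mul_div, div_le_iff₀ hε]; linarith
    simp only [χ, hT, if_true]
    rw [min_eq_left (by linarith), max_eq_right zero_le_one]
  · intro i x hx hball hd
    exact le_inner_gradient_bdryDist hΩ hne (hν i) (hf i) (hU i) hx (by positivity) hball hd

/-- Bounded overlap: at most `M` terms can be positive, so the constants below do not depend on how
many cutoffs meet the support of `u`. -/
theorem Finset.sum_le_mul_of_encard_le {X : Type*} {U : ℕ → Set X} {M : ℕ} {x : X}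
    (hM : {i | x ∈ U i}.encard ≤ (M : ℕ∞)) (s : Finset ℕ) {f : ℕ → ℝ} {k : ℝ} (hk : 0 ≤ k)
    (h1 : ∀ i, f i ≤ k) (h2 : ∀ i, x ∉ U i → f i ≤ 0) : ∑ i ∈ s, f i ≤ M * k := by
  classical
  have hcard : ((s.filter fun i => x ∈ U i).card : ℝ) ≤ M := by
    have : ((s.filter fun i => x ∈ U i).card : ℕ∞) ≤ M := by
      rw [← Set.encard_coe_eq_coe_finsetCard]
      exact (Set.encard_le_encard fun i hi => (Finset.mem_filter.1 hi).2).trans hM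
    exact_mod_cast this
  calc ∑ i ∈ s, f i ≤ ∑ i ∈ s, if x ∈ U i then k else 0 := by
        refine Finset.sum_le_sum fun i _ => ?_
        split_ifs with h
        · exact h1 i
        · exact h2 i h
    _ = (s.filter fun i => x ∈ U i).card * k := by
        rw [← Finset.sum_filter, Finset.sum_const, nsmul_eq_mul]
    _ ≤ M * k := by gcongr

end Cutoffs

/-! ### The two halves of the weighted Hardy inequality. -/

section Hardy

variable {n : ℕ} {Ω : Set (Rn n)} {u : Rn n × ℝ → ℝ}

theorem abs_rpow_sub_two_mul {p : ℝ} (hp : 1 < p) (a : ℝ) : |a| ^ (p - 2) * |a| = |a| ^ (p - 1) := by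
  rcases eq_or_ne a 0 with rfl | ha
  · rw [abs_zero, mul_zero, Real.zero_rpow (by linarith)]
  · rw [← Real.rpow_add_one (abs_ne_zero.2 ha)]; ring_nf

theorem abs_rpow_sub_two_mul_sq {p : ℝ} (hp : 1 < p) (a : ℝ) :
    |a| ^ (p - 2) * a * a = |a| ^ p := by
  rw [mul_assoc, ← abs_mul_abs_self a, ← mul_assoc, abs_rpow_sub_two_mul hp]
  rcases eq_or_ne a 0 with rfl | ha
  · rw [abs_zero, mul_zero, Real.zero_rpow (by linarith)]
  · rw [← Real.rpow_add_one (abs_ne_zero.2 ha)]; ring_nf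

theorem abs_groundY_le (z : Rn n × ℝ) : |groundY Ω u z| ≤ √(groundEnergy Ω u z) :=
  Real.abs_le_sqrt (by unfold groundEnergy; linarith [sq_nonneg ‖groundX Ω u z‖])

theorem norm_groundX_le (z : Rn n × ℝ) : ‖groundX Ω u z‖ ≤ √(groundEnergy Ω u z) :=
  Real.le_sqrt_of_sq_le (by unfold groundEnergy; linarith [sq_nonneg (groundY Ω u z)])

variable (hΩ : IsOpen Ω) (hne : (frontier Ω).Nonempty) (hu : IsTestFunction (Ω ×ˢ (univ : Set ℝ)) u)

include hu

omit hΩ hne in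
theorem integrable_rpow {p : ℝ} (hp : 0 < p) :
    Integrable (fun z => |u z| ^ p) (cylMeasure Ω) :=
  (hu.tame.rpow hp.le).integrable hu.hasCompactSupport fun z hz => by
    rw [image_eq_zero_of_notMem_tsupport hz, abs_zero, Real.zero_rpow hp.ne']

include hΩ hne

theorem integrable_rpow_mul_sqrt {p : ℝ} (hp : 1 < p) :
    Integrable (fun z => |u z| ^ (p - 1) * √(groundEnergy Ω u z)) (cylMeasure Ω) :=
  ((hu.tame.rpow (by linarith)).mul (tame_groundEnergy hΩ hne hu).sqrt).integrable
    hu.hasCompactSupport fun z hz => by rw [groundEnergy_eq_zero hu hz, Real.sqrt_zero, mul_zero]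

theorem integrable_wY_mul_rpow {p : ℝ} (hp : 0 < p) :
    Integrable (fun z => wY Ω z * |u z| ^ p) (cylMeasure Ω) :=
  ((tame_wY hΩ hne hu).mul (hu.tame.rpow hp.le)).integrable hu.hasCompactSupport fun z hz => by
    rw [image_eq_zero_of_notMem_tsupport hz, abs_zero, Real.zero_rpow hp.ne', mul_zero]

omit hΩ hne in
/-- Integration by parts in a vertical direction with a weight `b(x, y)` vanishing at `y = 0`. -/
theorem integral_vertical_eq_zero {p : ℝ} (hp : 2 ≤ p) {b b' : Rn n × ℝ → ℝ}
    (hb : ∀ x ∈ Ω, ∀ y ∈ Ici (0 : ℝ), HasDerivAt (fun y => b (x, y)) (b' (x, y)) y)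
    (hb' : ∀ x ∈ Ω, ContinuousOn (fun y => b' (x, y)) (Ici 0)) (hb0 : ∀ x ∈ Ω, b (x, 0) = 0)
    (htb : Tame u b) (htb' : Tame u b') :
    Integrable (fun z => b' z * |u z| ^ p + b z * (p * |u z| ^ (p - 2) * u z * yDeriv u z))
      (cylMeasure Ω) ∧
    ∫ z, (b' z * |u z| ^ p + b z * (p * |u z| ^ (p - 2) * u z * yDeriv u z)) ∂(cylMeasure Ω) = 0 := by
  have hp0 : 0 < p := by linarith
  have hint : Integrable
      (fun z => b' z * |u z| ^ p + b z * (p * |u z| ^ (p - 2) * u z * yDeriv u z)) (cylMeasure Ω) := by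
    refine Tame.integrable (u := u) ?_ hu.hasCompactSupport fun z hz => ?_
    · exact (htb'.mul (hu.tame.rpow hp0.le)).add (htb.mul ((((Tame.const p).mul
        (hu.tame.rpow (by linarith))).mul hu.tame).mul (tame_yDeriv hu)))
    · simp [image_eq_zero_of_notMem_tsupport hz, Real.zero_rpow hp0.ne']
  refine ⟨hint, ?_⟩
  rw [cylMeasure, integral_prod _ hint]
  refine setIntegral_eq_zero_of_forall_eq_zero fun x hx => ?_
  obtain ⟨Y, hY⟩ := exists_snd_bound hu
  have hcu : Continuous fun y : ℝ => u (x, y) := hu.smooth.continuous.comp (by fun_prop)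
  have hcd : Continuous fun y : ℝ => yDeriv u (x, y) :=
    (continuous_yDeriv hu.smooth).comp (by fun_prop)
  rw [integral_Ioi_deriv_eq_neg (g := fun y => b (x, y) * |u (x, y)| ^ p) (Y := Y)]
  · simp [hb0 x hx]
  · intro y hy
    have h := (hb x hx y hy).mul ((hasDerivAt_abs_rpow (u (x, y)) (p := p) (by linarith)).comp y
      (hasDerivAt_yDeriv hu.differentiable x y))
    exact h
  · have hbc : ContinuousOn (fun y => b (x, y)) (Ici 0) := fun y hy =>
      (hb x hx y hy).continuousAt.continuousWithinAt
    have h1 : Continuous fun y => |u (x, y)| ^ p := hcu.abs.rpow_const fun _ => Or.inr hp0.le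
    have h2 : Continuous fun y => |u (x, y)| ^ (p - 2) :=
      hcu.abs.rpow_const fun _ => Or.inr (by linarith)
    exact ((hb' x hx).mul h1.continuousOn).add (hbc.mul
      (((continuous_const.mul h2).mul hcu).mul hcd).continuousOn)
  · intro y hy
    simp [image_eq_zero_of_notMem_tsupport (hY x y hy), Real.zero_rpow hp0.ne']

omit hΩ hne hu in
-- The multiplier `y/r` vanishes at `y = 0`, is at most 1, and has the radial part of the Hardy
-- weight as its derivative.
theorem hasDerivAt_div_sqrt {s : ℝ} (hs : 0 < s) (y : ℝ) :
    HasDerivAt (fun y => y / √(s ^ 2 + y ^ 2)) (s ^ 2 / √(s ^ 2 + y ^ 2) ^ 3) y := by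
  have h0 : 0 < s ^ 2 + y ^ 2 := by positivity
  have h1 : HasDerivAt (fun y : ℝ => s ^ 2 + y ^ 2) (2 * y) y := by
    simpa using (hasDerivAt_pow 2 y).const_add (s ^ 2)
  have hr0 : 0 < √(s ^ 2 + y ^ 2) := Real.sqrt_pos.2 h0
  have hr : √(s ^ 2 + y ^ 2) ^ 2 = s ^ 2 + y ^ 2 := Real.sq_sqrt h0.le
  refine ((hasDerivAt_id y).div (h1.sqrt h0.ne') hr0.ne').congr_deriv ?_
  simp only [id]
  set r := √(s ^ 2 + y ^ 2)
  field_simp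
  rw [hr]; ring

/-- Vertical part of the weighted Hardy inequality. -/
theorem integral_radial_le {p : ℝ} (hp : 2 ≤ p) :
    Integrable (fun z => bdryDist Ω z.1 ^ 2 / √(bdryDist Ω z.1 ^ 2 + z.2 ^ 2) ^ 3 * |u z| ^ p)
      (cylMeasure Ω) ∧
    ∫ z, bdryDist Ω z.1 ^ 2 / √(bdryDist Ω z.1 ^ 2 + z.2 ^ 2) ^ 3 * |u z| ^ p ∂(cylMeasure Ω) ≤
      p * (∫ z, wY Ω z * |u z| ^ p ∂(cylMeasure Ω)) +
      p * ∫ z, |u z| ^ (p - 1) * √(groundEnergy Ω u z) ∂(cylMeasure Ω) := by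
  have hp1 : 1 < p := by linarith
  have hp0 : 0 < p := by linarith
  set b : Rn n × ℝ → ℝ := fun z => z.2 / √(bdryDist Ω z.1 ^ 2 + z.2 ^ 2)
  set b' : Rn n × ℝ → ℝ := fun z => bdryDist Ω z.1 ^ 2 / √(bdryDist Ω z.1 ^ 2 + z.2 ^ 2) ^ 3
  have hr : ∀ z : Rn n × ℝ, z.1 ∈ Ω → 0 < bdryDist Ω z.1 ∧
      0 < √(bdryDist Ω z.1 ^ 2 + z.2 ^ 2) ∧ bdryDist Ω z.1 ≤ √(bdryDist Ω z.1 ^ 2 + z.2 ^ 2) ∧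
      z.2 ≤ √(bdryDist Ω z.1 ^ 2 + z.2 ^ 2) := by
    intro z hz
    have hd := bdryDist_pos hΩ hne hz
    exact ⟨hd, Real.sqrt_pos.2 (by positivity), Real.le_sqrt_of_sq_le (by nlinarith [sq_nonneg z.2]),
      Real.le_sqrt_of_sq_le (by nlinarith)⟩
  have htb : Tame u b := by
    refine (Tame.const 1).of_abs_le (by fun_prop) fun z hz hy => ?_
    obtain ⟨hd, h0, h1, h2⟩ := hr z (hu.mem_of_tsupport hz)
    rw [abs_of_nonneg (by positivity), abs_one, div_le_one h0]
    exact h2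
  have htb' : Tame u b' := by
    refine (tame_inv_bdryDist hΩ hne hu).of_abs_le (by fun_prop) fun z hz hy => ?_
    obtain ⟨hd, h0, h1, h2⟩ := hr z (hu.mem_of_tsupport hz)
    rw [abs_of_nonneg (by positivity), abs_of_nonneg (by positivity),
      div_le_div_iff₀ (by positivity) hd, one_mul]
    calc bdryDist Ω z.1 ^ 2 * bdryDist Ω z.1 = bdryDist Ω z.1 ^ 3 := by ring
      _ ≤ _ := by gcongr
  have hbint : Integrable (fun z => b' z * |u z| ^ p) (cylMeasure Ω) :=
    (htb'.mul (hu.tame.rpow hp0.le)).integrable hu.hasCompactSupport fun z hz => by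
      rw [image_eq_zero_of_notMem_tsupport hz, abs_zero, Real.zero_rpow hp0.ne', mul_zero]
  refine ⟨hbint, ?_⟩
  have hcont : ∀ x ∈ Ω, ContinuousOn (fun y => b' (x, y)) (Ici 0) := by
    intro x hx
    have hd := bdryDist_pos hΩ hne hx
    have h1 : Continuous fun y : ℝ => √(bdryDist Ω x ^ 2 + y ^ 2) ^ 3 := by fun_prop
    have h2 := (continuous_const (y := bdryDist Ω x ^ 2)).div h1 fun y => by positivity
    exact h2.continuousOn
  obtain ⟨hint, h0⟩ := integral_vertical_eq_zero hu hp (b := b) (b' := b')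
    (fun x hx y _ => hasDerivAt_div_sqrt (bdryDist_pos hΩ hne hx) y) hcont
    (fun x _ => by simp [b]) htb htb'
  have hw := integrable_wY_mul_rpow hΩ hne hu hp0
  have hE := integrable_rpow_mul_sqrt hΩ hne hu hp1
  have hmono := integral_mono_ae hbint (hint.add ((hw.const_mul p).add (hE.const_mul p))) (by
    filter_upwards [ae_cylMeasure hΩ] with z hz
    obtain ⟨hd, hr0, h1, h2⟩ := hr z hz.1
    have hy : 0 < z.2 := hz.2.1
    have hb0 : 0 ≤ b z := by positivity
    have hb1 : b z ≤ 1 := (div_le_one hr0).2 h2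
    -- Replacing `∂_y u` by `groundY - u wS` costs `(y/r) wS = (d/r) wY`; this is why the horizontal
    -- weight appears on the right.
    have hbS : b z * wS Ω z ≤ wY Ω z := by
      have e : b z * wS Ω z = bdryDist Ω z.1 / √(bdryDist Ω z.1 ^ 2 + z.2 ^ 2) * wY Ω z := by
        simp only [b, wS, wY, angleRatioS, angleRatioY]; ring
      rw [e]
      exact mul_le_of_le_one_left (angleRatioY_nonneg _ hy.le) ((div_le_one hr0).2 h1)
    have hY : yDeriv u z = groundY Ω u z - u z * wS Ω z := by simp [groundY]
    have e1 := abs_rpow_sub_two_mul_sq hp1 (u z)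
    have e2 : -(|u z| ^ (p - 1) * √(groundEnergy Ω u z)) ≤
        b z * (|u z| ^ (p - 2) * u z * groundY Ω u z) := by
      refine neg_le_of_abs_le ?_
      rw [abs_mul, abs_mul, abs_mul, abs_of_nonneg hb0,
        abs_of_nonneg (by positivity : 0 ≤ |u z| ^ (p - 2)), abs_rpow_sub_two_mul hp1]
      refine (mul_le_of_le_one_left (by positivity) hb1).trans ?_
      gcongr
      exact abs_groundY_le z
    have e3 : b z * (p * |u z| ^ (p - 2) * u z * yDeriv u z) =
        p * (b z * (|u z| ^ (p - 2) * u z * groundY Ω u z)) - p * (b z * wS Ω z * |u z| ^ p) := by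
      rw [← e1, hY]; ring
    have e4 : b z * wS Ω z * |u z| ^ p ≤ wY Ω z * |u z| ^ p := by gcongr
    simp only [Pi.add_apply]
    rw [e3]
    nlinarith)
  have e1 : ∫ z, ((fun z => b' z * |u z| ^ p + b z * (p * |u z| ^ (p - 2) * u z * yDeriv u z)) +
    ((fun z => p * (wY Ω z * |u z| ^ p)) + fun z => p * (|u z| ^ (p - 1) * √(groundEnergy Ω u z)))) z
      ∂(cylMeasure Ω) = _ := integral_add hint ((hw.const_mul p).add (hE.const_mul p))
  have e2 : ∫ z, ((fun z => p * (wY Ω z * |u z| ^ p)) +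
    fun z => p * (|u z| ^ (p - 1) * √(groundEnergy Ω u z))) z
      ∂(cylMeasure Ω) = _ := integral_add (hw.const_mul p) (hE.const_mul p)
  rw [e1, e2, h0, zero_add, integral_const_mul, integral_const_mul] at hmono
  exact hmono

omit hΩ hne in
/-- Integration by parts in a horizontal direction against a Lipschitz cutoff. -/
theorem integral_horizontal_eq_zero {p : ℝ} (hp : 2 ≤ p) {χ : Rn n → ℝ} {K : NNReal}
    (hχ : LipschitzWith K χ) (ν : Rn n) :
    Integrable (fun z => lineDeriv ℝ χ z.1 ν * |u z| ^ p +
      χ z.1 * (p * |u z| ^ (p - 2) * u z * inner ℝ (xGrad u z) ν)) (cylMeasure Ω) ∧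
    ∫ z, (lineDeriv ℝ χ z.1 ν * |u z| ^ p +
      χ z.1 * (p * |u z| ^ (p - 2) * u z * inner ℝ (xGrad u z) ν)) ∂(cylMeasure Ω) = 0 := by
  have hp0 : 0 < p := by linarith
  have hxc := continuous_xGrad hu.smooth
  have htd : Tame u (fun z => lineDeriv ℝ χ z.1 ν) :=
    ⟨(measurable_lineDeriv hχ.continuous).comp measurable_fst, K * ‖ν‖,
      fun z _ _ => norm_lineDeriv_le_of_lipschitz ℝ hχ⟩
  have htχ : Tame u (fun z => χ z.1) :=
    Tame.of_continuous hu.hasCompactSupport (hχ.continuous.comp continuous_fst)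
  have htg : Tame u (fun z => inner ℝ (xGrad u z) ν) :=
    Tame.of_continuous hu.hasCompactSupport (hxc.inner continuous_const)
  have hint : Integrable (fun z => lineDeriv ℝ χ z.1 ν * |u z| ^ p +
      χ z.1 * (p * |u z| ^ (p - 2) * u z * inner ℝ (xGrad u z) ν)) (cylMeasure Ω) := by
    refine Tame.integrable (u := u) ?_ hu.hasCompactSupport fun z hz => ?_
    · exact (htd.mul (hu.tame.rpow hp0.le)).add (htχ.mul ((((Tame.const p).mul
        (hu.tame.rpow (by linarith))).mul hu.tame).mul htg))
    · simp [image_eq_zero_of_notMem_tsupport hz, Real.zero_rpow hp0.ne']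
  refine ⟨hint, ?_⟩
  rw [cylMeasure, integral_prod_symm _ hint]
  refine setIntegral_eq_zero_of_forall_eq_zero fun y _ => ?_
  rw [setIntegral_eq_integral_of_forall_compl_eq_zero]
  swap
  · intro x hx
    have : (x, y) ∉ tsupport u := fun h => hx (hu.mem_of_tsupport h)
    simp [image_eq_zero_of_notMem_tsupport this, Real.zero_rpow hp0.ne']
  have hu1 : ContDiff ℝ 1 (fun x => u (x, y)) := (hu.smooth.comp (by fun_prop)).of_le (by simp)
  have hcs : HasCompactSupport (fun x => |u (x, y)| ^ p) := by
    refine HasCompactSupport.intro (hu.hasCompactSupport.isCompact.image continuous_fst) ?_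
    intro x hx
    have : (x, y) ∉ tsupport u := fun h => hx ⟨(x, y), h, rfl⟩
    simp [image_eq_zero_of_notMem_tsupport this, Real.zero_rpow hp0.ne']
  have hg1 : ContDiff ℝ 1 (fun x => |u (x, y)| ^ p) := hu1.norm_rpow (by linarith)
  have hline : ∀ x, lineDeriv ℝ (fun x => |u (x, y)| ^ p) x (-ν) =
      -(p * |u (x, y)| ^ (p - 2) * u (x, y) * inner ℝ (xGrad u (x, y)) ν) := by
    intro x
    have h1 := (hasDerivAt_abs_rpow (u (x, y)) (p := p) (by linarith)).comp_hasFDerivAt x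
      (hasFDerivAt_xGrad hu.differentiable x y)
    have h2 := (h1.hasLineDerivAt (-ν)).lineDeriv
    rw [Function.comp_def] at h2
    rw [h2]
    simp
  obtain ⟨D, hD⟩ := ContDiff.lipschitzWith_of_hasCompactSupport hcs hg1 (by simp)
  have hkey := hχ.integral_lineDeriv_mul_eq (μ := volume) hD hcs ν
  simp only [hline] at hkey
  have hux : Continuous (fun x => u (x, y)) := hu1.continuous
  have hi1 : Integrable (fun x => lineDeriv ℝ χ x ν * |u (x, y)| ^ p) := by
    refine Integrable.bdd_mul (c := K * ‖ν‖) (hg1.continuous.integrable_of_hasCompactSupport hcs)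
      (measurable_lineDeriv hχ.continuous).aestronglyMeasurable
      (Filter.Eventually.of_forall fun x => norm_lineDeriv_le_of_lipschitz ℝ hχ)
  have hi2 : Integrable (fun x => χ x *
      (p * |u (x, y)| ^ (p - 2) * u (x, y) * inner ℝ (xGrad u (x, y)) ν)) := by
    refine Continuous.integrable_of_hasCompactSupport ?_ ?_
    · have h2 : Continuous fun x => |u (x, y)| ^ (p - 2) :=
        hux.abs.rpow_const fun _ => Or.inr (by linarith)
      have h3 : Continuous fun x => xGrad u (x, y) := hxc.comp (by fun_prop)
      exact hχ.continuous.mul (((continuous_const.mul h2).mul hux).mul (h3.inner continuous_const))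
    · refine HasCompactSupport.intro (hu.hasCompactSupport.isCompact.image continuous_fst) ?_
      intro x hx
      have : (x, y) ∉ tsupport u := fun h => hx ⟨(x, y), h, rfl⟩
      simp [image_eq_zero_of_notMem_tsupport this]
  rw [integral_add hi1 hi2, hkey, ← integral_add ?_ hi2]
  · refine integral_eq_zero_of_ae (Filter.Eventually.of_forall fun x => ?_)
    simp only [Pi.zero_apply]
    ring
  · refine hi2.neg.congr (Filter.Eventually.of_forall fun x => ?_)
    simp only [Pi.neg_apply]
    ring

omit hu in
/-- Horizontal part of the weighted Hardy inequality; this is where the regularity of the boundary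
is used. -/
theorem UniformlyLipschitz.exists_integral_wY_le (hLip : UniformlyLipschitz Ω) {p : ℝ}
    (hp : 2 ≤ p) :
    ∃ C : ℝ, 0 < C ∧ ∀ u : Rn n × ℝ → ℝ, IsTestFunction (Ω ×ˢ (univ : Set ℝ)) u →
      ∫ z, wY Ω z * |u z| ^ p ∂(cylMeasure Ω) ≤
        C * ((∫ z, |u z| ^ (p - 1) * √(groundEnergy Ω u z) ∂(cylMeasure Ω)) +
          ∫ z, |u z| ^ p ∂(cylMeasure Ω)) := by
  classical
  obtain ⟨c, ρ, K, M, U, ν, χ, hc, hρ, hlf, hM, hν, hχ, hχ0, hχ1, hχU, hχcov, hdir⟩ :=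
    hLip.exists_cutoffs hΩ hne
  have hp0 : 0 < p := by linarith
  have hp1 : 1 < p := by linarith
  -- The four summands pay, in order, for replacing 1 by the sum of the cutoffs, for the derivatives
  -- of the cutoffs, for the loss `8d/ρ` in the directional bound, and for the ground energy term.
  refine ⟨(p * c * (2 / ρ) + M * K + p * (8 / ρ) * M + p * M) / (p * c) , by positivity,
    fun u hu => ?_⟩
  have hcomp : IsCompact (Prod.fst '' tsupport u) :=
    hu.hasCompactSupport.isCompact.image continuous_fst
  -- Local finiteness leaves finitely many indices. The set depends on `u`, but it enters the
  -- estimates only through the overlap bound `M`.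
  set s := (hlf.finite_nonempty_inter_compact hcomp).toFinset
  let B : ℕ → Rn n × ℝ → ℝ := fun i z => lineDeriv ℝ (χ i) z.1 (ν i) * |u z| ^ p +
      χ i z.1 * (p * |u z| ^ (p - 2) * u z * inner ℝ (xGrad u z) (ν i))
  have hB := fun i => integral_horizontal_eq_zero (Ω := Ω) hu hp (hχ i) (ν i)
  have hBsum : ∫ z, ∑ i ∈ s, B i z ∂(cylMeasure Ω) = 0 := by
    rw [integral_finsetSum _ fun i _ => (hB i).1]
    exact Finset.sum_eq_zero fun i _ => (hB i).2
  have hBint : Integrable (fun z => ∑ i ∈ s, B i z) (cylMeasure Ω) :=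
    integrable_finsetSum _ fun i _ => (hB i).1
  have hw := integrable_wY_mul_rpow hΩ hne hu hp0
  have hE := integrable_rpow_mul_sqrt hΩ hne hu hp1
  have hN := integrable_rpow (Ω := Ω) hu hp0
  have hsumχ : ∀ x, ∑ i ∈ s, χ i x ≤ M := fun x => by
    simpa using Finset.sum_le_mul_of_encard_le (hM x) s zero_le_one (fun i => hχ1 i x)
      fun i hi => by
        by_contra h
        exact hi (hχU i x (by intro h0; exact h h0.le) (Metric.mem_ball_self hρ))
  have hsumD : ∀ x, ∑ i ∈ s, |lineDeriv ℝ (χ i) x (ν i)| ≤ M * K := fun x => by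
    refine Finset.sum_le_mul_of_encard_le (hM x) s K.2 (fun i => ?_) fun i hi => ?_
    · have := norm_lineDeriv_le_of_lipschitz ℝ (hχ i) (x₀ := x) (v := ν i)
      rwa [hν i, mul_one] at this
    · have hev : χ i =ᶠ[nhds x] fun _ => 0 := by
        filter_upwards [Metric.ball_mem_nhds x hρ] with x' hx'
        by_contra h
        exact hi (hχU i x' h (Metric.mem_ball_comm.1 hx'))
      rw [hev.lineDeriv_eq]
      simp [lineDeriv]
  have hpt : ∀ᵐ z ∂(cylMeasure Ω), p * c * (wY Ω z * |u z| ^ p) ≤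
      ∑ i ∈ s, B i z + ((p * c * (2 / ρ) + M * K + p * (8 / ρ) * M) * |u z| ^ p +
        p * M * (|u z| ^ (p - 1) * √(groundEnergy Ω u z))) := by
    filter_upwards [ae_cylMeasure hΩ] with z hz
    obtain ⟨hx, hy, hdiff⟩ := hz
    by_cases hzu : z ∉ tsupport u
    · have h0 := image_eq_zero_of_notMem_tsupport hzu
      simp [B, h0, Real.zero_rpow hp0.ne', groundEnergy_eq_zero hu hzu]
    rw [not_not] at hzu
    have hd := bdryDist_pos hΩ hne hx
    have hw0 : 0 ≤ wY Ω z := angleRatioY_nonneg _ hy.le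
    have hw1 : wY Ω z * bdryDist Ω z.1 ≤ 1 := angleRatioY_mul_le hd _
    set d := bdryDist Ω z.1
    set v := |u z| ^ p
    set E := |u z| ^ (p - 1) * √(groundEnergy Ω u z)
    have hv0 : 0 ≤ v := by positivity
    have hE0 : 0 ≤ E := by positivity
    have hterm : ∀ i, p * c * (wY Ω z * v) * χ i z.1 ≤ B i z +
        (|lineDeriv ℝ (χ i) z.1 (ν i)| * v + χ i z.1 * (p * E) + χ i z.1 * (p * (8 / ρ) * v)) := by
      intro i
      rcases eq_or_ne (χ i z.1) 0 with h0 | h0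
      · simp only [B, h0, mul_zero, zero_mul, add_zero]
        have := neg_abs_le (lineDeriv ℝ (χ i) z.1 (ν i))
        nlinarith
      have hin := hdir i z.1 hx (hχU i _ h0) hdiff
      -- This exposes `wY |u|^p` multiplied by `⟪∇d, ν⟫ ≥ c - 8d/ρ`; since `wY d ≤ 1`, the loss is
      -- only a multiple of `|u|^p`.
      have hXG : inner ℝ (xGrad u z) (ν i) = inner ℝ (groundX Ω u z) (ν i) +
          u z * wY Ω z * inner ℝ (gradient (bdryDist Ω) z.1) (ν i) := by
        rw [groundX, inner_sub_left, inner_smul_left]; simp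
      have e1 := abs_rpow_sub_two_mul_sq hp1 (u z)
      have e2 : -E ≤ |u z| ^ (p - 2) * u z * inner ℝ (groundX Ω u z) (ν i) := by
        refine neg_le_of_abs_le ?_
        rw [abs_mul, abs_mul, abs_of_nonneg (by positivity : 0 ≤ |u z| ^ (p - 2)),
          abs_rpow_sub_two_mul hp1]
        refine mul_le_mul_of_nonneg_left ?_ (by positivity)
        refine (abs_real_inner_le_norm _ _).trans ?_
        rw [hν i, mul_one]
        exact norm_groundX_le z
      have e3 : p * |u z| ^ (p - 2) * u z * inner ℝ (xGrad u z) (ν i) =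
          p * (|u z| ^ (p - 2) * u z * inner ℝ (groundX Ω u z) (ν i)) +
          p * (wY Ω z * v) * inner ℝ (gradient (bdryDist Ω) z.1) (ν i) := by
        simp only [v]; rw [← e1, hXG]; ring
      have e4 : p * (wY Ω z * v) * (c - 8 / ρ * d) ≤
          p * (wY Ω z * v) * inner ℝ (gradient (bdryDist Ω) z.1) (ν i) := by gcongr
      have e5 : p * (8 / ρ) * v * (wY Ω z * d) ≤ p * (8 / ρ) * v * 1 := by gcongr
      have e6 : p * c * (wY Ω z * v) ≤ p * |u z| ^ (p - 2) * u z * inner ℝ (xGrad u z) (ν i) +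
          (p * E + p * (8 / ρ) * v) := by
        rw [e3]; nlinarith
      have e7 := mul_le_mul_of_nonneg_left e6 (hχ0 i z.1)
      have e8 : -(|lineDeriv ℝ (χ i) z.1 (ν i)| * v) ≤ lineDeriv ℝ (χ i) z.1 (ν i) * v := by
        have := neg_abs_le (lineDeriv ℝ (χ i) z.1 (ν i))
        nlinarith
      simp only [B]
      linarith
    have hsum := Finset.sum_le_sum fun i (_ : i ∈ s) => hterm i
    have hsplit : ∑ i ∈ s, (B i z + (|lineDeriv ℝ (χ i) z.1 (ν i)| * v + χ i z.1 * (p * E) +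
        χ i z.1 * (p * (8 / ρ) * v))) = ∑ i ∈ s, B i z +
        ((∑ i ∈ s, |lineDeriv ℝ (χ i) z.1 (ν i)|) * v + (∑ i ∈ s, χ i z.1) * (p * E) +
          (∑ i ∈ s, χ i z.1) * (p * (8 / ρ) * v)) := by
      rw [Finset.sum_mul, Finset.sum_mul, Finset.sum_mul, ← Finset.sum_add_distrib,
        ← Finset.sum_add_distrib, ← Finset.sum_add_distrib]
    rw [← Finset.mul_sum, hsplit] at hsum
    -- Some cutoff equals 1 where `d < ρ/2`, and elsewhere the left side is not positive.
    have f1 : 1 - 2 / ρ * d ≤ ∑ i ∈ s, χ i z.1 := by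
      by_cases hdρ : d < ρ / 2
      · obtain ⟨i, hi⟩ := hχcov z.1 hdρ
        have his : i ∈ s := by
          rw [Set.Finite.mem_toFinset]
          exact ⟨z.1, hχU i _ (by rw [hi]; exact one_ne_zero) (Metric.mem_ball_self hρ),
            z, hzu, rfl⟩
        have h1 : χ i z.1 ≤ ∑ i ∈ s, χ i z.1 :=
          Finset.single_le_sum (fun j _ => hχ0 j z.1) his
        have h2 : 0 ≤ 2 / ρ * d := by positivity
        linarith
      · have h1 : 0 ≤ ∑ i ∈ s, χ i z.1 := Finset.sum_nonneg fun j _ => hχ0 j z.1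
        have h2 : 1 ≤ 2 / ρ * d := by
          rw [div_mul_eq_mul_div, le_div_iff₀ hρ]; linarith
        linarith
    have f2 : p * c * (wY Ω z * v) * (1 - 2 / ρ * d) ≤
        p * c * (wY Ω z * v) * ∑ i ∈ s, χ i z.1 := by gcongr
    have f3 : p * c * (2 / ρ) * v * (wY Ω z * d) ≤ p * c * (2 / ρ) * v * 1 := by gcongr
    have f4 : (∑ i ∈ s, |lineDeriv ℝ (χ i) z.1 (ν i)|) * v ≤ M * K * v :=
      mul_le_mul_of_nonneg_right (hsumD z.1) hv0
    have f5 : (∑ i ∈ s, χ i z.1) * (p * E) ≤ M * (p * E) :=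
      mul_le_mul_of_nonneg_right (hsumχ z.1) (by positivity)
    have f6 : (∑ i ∈ s, χ i z.1) * (p * (8 / ρ) * v) ≤ M * (p * (8 / ρ) * v) :=
      mul_le_mul_of_nonneg_right (hsumχ z.1) (by positivity)
    linarith
  have hmono := integral_mono_ae (hw.const_mul (p * c))
    (hBint.add ((hN.const_mul _).add (hE.const_mul _))) hpt
  have e1 : ∫ z, ((fun z => ∑ i ∈ s, B i z) +
      ((fun z => (p * c * (2 / ρ) + M * K + p * (8 / ρ) * M) * |u z| ^ p) +
        fun z => p * M * (|u z| ^ (p - 1) * √(groundEnergy Ω u z)))) z ∂(cylMeasure Ω) = _ :=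
    integral_add hBint ((hN.const_mul _).add (hE.const_mul _))
  have e2 : ∫ z, ((fun z => (p * c * (2 / ρ) + M * K + p * (8 / ρ) * M) * |u z| ^ p) +
        fun z => p * M * (|u z| ^ (p - 1) * √(groundEnergy Ω u z))) z ∂(cylMeasure Ω) = _ :=
    integral_add (hN.const_mul _) (hE.const_mul _)
  rw [e1, e2, hBsum, zero_add, integral_const_mul, integral_const_mul, integral_const_mul] at hmono
  have hN0 : 0 ≤ ∫ z, |u z| ^ p ∂(cylMeasure Ω) := integral_nonneg fun z => by positivity
  have hE0 : 0 ≤ ∫ z, |u z| ^ (p - 1) * √(groundEnergy Ω u z) ∂(cylMeasure Ω) :=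
    integral_nonneg fun z => by positivity
  rw [div_mul_eq_mul_div, le_div_iff₀ (by positivity)]
  have g1 : 0 ≤ (p * c * (2 / ρ) + M * K + p * (8 / ρ) * M) *
      ∫ z, |u z| ^ (p - 1) * √(groundEnergy Ω u z) ∂(cylMeasure Ω) := by positivity
  have g2 : 0 ≤ p * M * ∫ z, |u z| ^ p ∂(cylMeasure Ω) := by positivity
  linarith

end Hardy

/-! ### The full Hardy weight and the `L²` bound. -/

section HardyConsequences

variable {n : ℕ} {Ω : Set (Rn n)} {u : Rn n × ℝ → ℝ}

variable (Ω) in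
/-- The Hardy weight `1 / (r θ)`. -/
noncomputable def hardyWeight (z : Rn n × ℝ) : ℝ :=
  1 / (√(bdryDist Ω z.1 ^ 2 + z.2 ^ 2) * angle Ω z)

@[fun_prop] theorem measurable_hardyWeight : Measurable (hardyWeight Ω) := by
  unfold hardyWeight; fun_prop

theorem hardyWeight_nonneg (z : Rn n × ℝ) : 0 ≤ hardyWeight Ω z := by
  have := polarAngle_pos (bdryDist Ω z.1) z.2
  unfold hardyWeight angle; positivity

theorem wY_le_hardyWeight (z : Rn n × ℝ) (hd : 0 < bdryDist Ω z.1) : wY Ω z ≤ hardyWeight Ω z := by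
  have hθ := polarAngle_pos (bdryDist Ω z.1) z.2
  have h0 : 0 < bdryDist Ω z.1 ^ 2 + z.2 ^ 2 := by positivity
  have hr : √(bdryDist Ω z.1 ^ 2 + z.2 ^ 2) ^ 2 = _ := Real.sq_sqrt h0.le
  have hr0 := Real.sqrt_pos.2 h0
  have hy : z.2 ≤ √(bdryDist Ω z.1 ^ 2 + z.2 ^ 2) :=
    Real.le_sqrt_of_sq_le (by nlinarith)
  rw [wY, hardyWeight, angle, angleRatioY, ← hr, Real.sqrt_sq hr0.le,
    div_le_div_iff₀ (by positivity) (by positivity), one_mul,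
    sq (√(bdryDist Ω z.1 ^ 2 + z.2 ^ 2)), ← mul_assoc]
  have : z.2 * √(bdryDist Ω z.1 ^ 2 + z.2 ^ 2) ≤
    √(bdryDist Ω z.1 ^ 2 + z.2 ^ 2) * √(bdryDist Ω z.1 ^ 2 + z.2 ^ 2) := by gcongr
  exact mul_le_mul_of_nonneg_right this hθ.le

theorem wS_le_hardyWeight (z : Rn n × ℝ) (hd : 0 < bdryDist Ω z.1) : wS Ω z ≤ hardyWeight Ω z := by
  have hθ := polarAngle_pos (bdryDist Ω z.1) z.2
  have h0 : 0 < bdryDist Ω z.1 ^ 2 + z.2 ^ 2 := by positivity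
  have hr : √(bdryDist Ω z.1 ^ 2 + z.2 ^ 2) ^ 2 = _ := Real.sq_sqrt h0.le
  have hr0 := Real.sqrt_pos.2 h0
  have hy : bdryDist Ω z.1 ≤ √(bdryDist Ω z.1 ^ 2 + z.2 ^ 2) :=
    Real.le_sqrt_of_sq_le (by nlinarith [sq_nonneg z.2])
  rw [wS, hardyWeight, angle, angleRatioS, ← hr, Real.sqrt_sq hr0.le,
    div_le_div_iff₀ (by positivity) (by positivity), one_mul,
    sq (√(bdryDist Ω z.1 ^ 2 + z.2 ^ 2)), ← mul_assoc]
  have : bdryDist Ω z.1 * √(bdryDist Ω z.1 ^ 2 + z.2 ^ 2) ≤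
    √(bdryDist Ω z.1 ^ 2 + z.2 ^ 2) * √(bdryDist Ω z.1 ^ 2 + z.2 ^ 2) := by gcongr
  exact mul_le_mul_of_nonneg_right this hθ.le

variable (hΩ : IsOpen Ω) (hne : (frontier Ω).Nonempty)

include hΩ hne

theorem tame_hardyWeight (hu : IsTestFunction (Ω ×ˢ (univ : Set ℝ)) u) :
    Tame u (hardyWeight Ω) := by
  refine (tame_inv_bdryDist hΩ hne hu).of_abs_le (by fun_prop) fun z hz hy => ?_
  have hd := bdryDist_pos hΩ hne (hu.mem_of_tsupport hz)
  rw [abs_of_nonneg (hardyWeight_nonneg z), abs_of_nonneg (by positivity), hardyWeight]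
  exact one_div_le_one_div_of_le hd (le_sqrt_mul_polarAngle hd _)

theorem integrable_hardyWeight_mul (hu : IsTestFunction (Ω ×ˢ (univ : Set ℝ)) u) {p : ℝ}
    (hp : 0 < p) : Integrable (fun z => hardyWeight Ω z * |u z| ^ p) (cylMeasure Ω) :=
  ((tame_hardyWeight hΩ hne hu).mul (hu.tame.rpow hp.le)).integrable hu.hasCompactSupport
    fun z hz => by
      rw [image_eq_zero_of_notMem_tsupport hz, abs_zero, Real.zero_rpow hp.ne', mul_zero]

/-- The weighted Hardy inequality relative to the ground state. -/
theorem UniformlyLipschitz.exists_integral_hardyWeight_le (hLip : UniformlyLipschitz Ω) {p : ℝ}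
    (hp : 2 ≤ p) :
    ∃ C : ℝ, 0 < C ∧ ∀ u : Rn n × ℝ → ℝ, IsTestFunction (Ω ×ˢ (univ : Set ℝ)) u →
      ∫ z, hardyWeight Ω z * |u z| ^ p ∂(cylMeasure Ω) ≤
        C * ((∫ z, |u z| ^ (p - 1) * √(groundEnergy Ω u z) ∂(cylMeasure Ω)) +
          ∫ z, |u z| ^ p ∂(cylMeasure Ω)) := by
  obtain ⟨C, hC, h⟩ := hLip.exists_integral_wY_le hΩ hne hp
  have hp0 : 0 < p := by linarith
  refine ⟨2 * ((p + 1) * C + p), by positivity, fun u hu => ?_⟩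
  have hw := integrable_wY_mul_rpow hΩ hne hu hp0
  obtain ⟨hr, hrle⟩ := integral_radial_le hΩ hne hu hp
  have hmono := integral_mono_ae (integrable_hardyWeight_mul hΩ hne hu hp0)
    ((hr.add hw).const_mul 2) (by
      filter_upwards [ae_cylMeasure hΩ] with z hz
      have h1 := hardyWeight_le (bdryDist_pos hΩ hne hz.1) hz.2.1.le
      simp only [Pi.add_apply, ← add_mul, ← mul_assoc]
      exact mul_le_mul_of_nonneg_right h1 (by positivity))
  have e1 := integral_add hr hw
  rw [integral_const_mul] at hmono
  have hN0 : 0 ≤ ∫ z, |u z| ^ p ∂(cylMeasure Ω) := integral_nonneg fun z => by positivity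
  have h2 := h u hu
  have h3 : (p + 1) * (∫ z, wY Ω z * |u z| ^ p ∂(cylMeasure Ω)) ≤ (p + 1) * _ :=
    mul_le_mul_of_nonneg_left h2 (by linarith)
  have h4 : 0 ≤ p * ∫ z, |u z| ^ p ∂(cylMeasure Ω) := by positivity
  refine hmono.trans ?_
  rw [show ∫ z, ((fun z => bdryDist Ω z.1 ^ 2 / √(bdryDist Ω z.1 ^ 2 + z.2 ^ 2) ^ 3 * |u z| ^ p) +
    fun z => wY Ω z * |u z| ^ p) z ∂(cylMeasure Ω) = _ from e1]
  linarith

omit hΩ hne in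
-- `θ ≤ d/y ≤ R/y`, and for `y > h` the weight `y/(R+y)³` is bounded below by a multiple of `y⁻²`.
-- So away from `{y = 0}` the remainder controls `u²`.
theorem angle_decay {h R : ℝ} (hh : 0 < h) {z : Rn n × ℝ} (hd : 0 < bdryDist Ω z.1)
    (hR : bdryDist Ω z.1 ≤ R) (hy : h < z.2) (v : ℝ) :
    v ^ 2 ≤ R ^ 2 * ((R + h) / h) ^ 3 * (z.2 / (R + z.2) ^ 3 * (v / angle Ω z) ^ 2) := by
  have hθ := polarAngle_pos (bdryDist Ω z.1) z.2
  have hy0 : 0 < z.2 := hh.trans hy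
  have h1 := polarAngle_le_div hd hy0
  rw [← angle] at h1 hθ
  have hR0 : 0 < R := hd.trans_le hR
  have h2 : angle Ω z ≤ R / z.2 := h1.trans (by gcongr)
  have h3 : v ^ 2 = angle Ω z ^ 2 * (v / angle Ω z) ^ 2 := by field_simp
  have h4 : angle Ω z ^ 2 ≤ R ^ 2 * ((R + h) / h) ^ 3 * (z.2 / (R + z.2) ^ 3) := by
    have h5 : (R + z.2) / z.2 ≤ (R + h) / h := by
      rw [div_le_div_iff₀ hy0 hh]; nlinarith
    calc angle Ω z ^ 2 ≤ (R / z.2) ^ 2 := by gcongr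
      _ = R ^ 2 * ((R + z.2) / z.2) ^ 3 * (z.2 / (R + z.2) ^ 3) := by field_simp
      _ ≤ _ := by gcongr
  rw [h3, ← mul_assoc]
  exact mul_le_mul_of_nonneg_right (by rw [mul_assoc] at h4 ⊢; exact h4) (sq_nonneg _)

/-- The ground state energy together with its remainder controls the `L²` norm. -/
theorem UniformlyLipschitz.exists_integral_sq_le (hLip : UniformlyLipschitz Ω) {R : ℝ}
    (hR0 : 0 < R) (hR : ∀ x ∈ Ω, bdryDist Ω x ≤ R) :
    ∃ C : ℝ, 0 < C ∧ ∀ u : Rn n × ℝ → ℝ, IsTestFunction (Ω ×ˢ (univ : Set ℝ)) u →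
      ∫ z, u z ^ 2 ∂(cylMeasure Ω) ≤
        C * (1 / 2 * (∫ z, groundEnergy Ω u z ∂(cylMeasure Ω)) +
          1 / 8 * ∫ z, z.2 / (R + z.2) ^ 3 * (u z / angle Ω z) ^ 2 ∂(cylMeasure Ω)) := by
  classical
  obtain ⟨C, hC, hH⟩ := hLip.exists_integral_hardyWeight_le hΩ hne (le_refl (2 : ℝ))
  -- The length scale is chosen so that `34hC = 1/2`; the Hardy term then returns only half of `∫
  -- u²`, which is absorbed.
  set h : ℝ := 1 / (68 * C)
  have hh : 0 < h := by positivity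
  have hhC : 34 * h * C = 1 / 2 := by simp only [h]; field_simp; norm_num
  set k : ℝ := R ^ 2 * ((R + h) / h) ^ 3
  have hk : 0 < k := by positivity
  refine ⟨2 * (32 * h + 1) ^ 2 + 64 * k, by positivity, fun u hu => ?_⟩
  have hN : Integrable (fun z => u z ^ 2) (cylMeasure Ω) :=
    (hu.tame.pow 2).integrable hu.hasCompactSupport fun z hz => by
      simp [image_eq_zero_of_notMem_tsupport hz]
  have hJ : Integrable (fun z => |u z| * √(groundEnergy Ω u z)) (cylMeasure Ω) :=
    (hu.tame.abs.mul (tame_groundEnergy hΩ hne hu).sqrt).integrable hu.hasCompactSupport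
      fun z hz => by simp [image_eq_zero_of_notMem_tsupport hz]
  have hA : Integrable (groundEnergy Ω u) (cylMeasure Ω) :=
    (tame_groundEnergy hΩ hne hu).integrable hu.hasCompactSupport
      fun z hz => groundEnergy_eq_zero hu hz
  have hD := integrable_decayWeight hΩ hne hu hR0
  have hT : Integrable (fun z => hardyWeight Ω z * u z ^ 2) (cylMeasure Ω) :=
    ((tame_hardyWeight hΩ hne hu).mul (hu.tame.pow 2)).integrable hu.hasCompactSupport
      fun z hz => by simp [image_eq_zero_of_notMem_tsupport hz]
  have hH2 := hH u hu
  norm_num only [Real.rpow_two, Real.rpow_one, sq_abs] at hH2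
  -- This multiplier may jump because only vertical derivatives are taken.
  set κ : Rn n → ℝ := fun x => if 16 * h ≤ bdryDist Ω x then 1 else 0
  have hκm : Measurable κ :=
    Measurable.ite (measurableSet_le measurable_const measurable_bdryDist) measurable_const
      measurable_const
  have hκ01 : ∀ x, 0 ≤ κ x ∧ κ x ≤ 1 := by
    intro x; simp only [κ]; split_ifs <;> norm_num
  -- `hy/(h+y)` vanishes at `y = 0`, is at most `h`, and has derivative at least `1/4` for `y ≤ h`.
  set b : Rn n × ℝ → ℝ := fun z => κ z.1 * (h * z.2 / (h + z.2))
  set b' : Rn n × ℝ → ℝ := fun z => κ z.1 * (h ^ 2 / (h + z.2) ^ 2)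
  have hb1 : ∀ y : ℝ, 0 < y → 0 ≤ h * y / (h + y) ∧ h * y / (h + y) ≤ h := by
    intro y hy
    refine ⟨by positivity, ?_⟩
    rw [div_le_iff₀ (by positivity)]; nlinarith
  have hb2 : ∀ y : ℝ, 0 < y → 0 ≤ h ^ 2 / (h + y) ^ 2 ∧ h ^ 2 / (h + y) ^ 2 ≤ 1 := by
    intro y hy
    refine ⟨by positivity, ?_⟩
    rw [div_le_one (by positivity)]; nlinarith
  have htb : Tame u b := by
    refine (Tame.const h).of_abs_le (by fun_prop) fun z hz hy => ?_
    obtain ⟨h1, h2⟩ := hb1 z.2 hy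
    obtain ⟨h3, h4⟩ := hκ01 z.1
    rw [abs_of_nonneg (by positivity), abs_of_nonneg hh.le]
    exact (mul_le_of_le_one_left h1 h4).trans h2
  have htb' : Tame u b' := by
    refine (Tame.const 1).of_abs_le (by fun_prop) fun z hz hy => ?_
    obtain ⟨h1, h2⟩ := hb2 z.2 hy
    obtain ⟨h3, h4⟩ := hκ01 z.1
    rw [abs_of_nonneg (by positivity), abs_one]
    exact (mul_le_of_le_one_left h1 h4).trans h2
  have hbd : ∀ x ∈ Ω, ∀ y ∈ Ici (0 : ℝ), HasDerivAt (fun y => b (x, y)) (b' (x, y)) y := by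
    intro x _ y hy
    have hy0 : h + y ≠ 0 := by have : 0 ≤ y := hy; positivity
    have h1 := (((hasDerivAt_id y).const_mul h).div ((hasDerivAt_id y).const_add h) hy0).const_mul
      (κ x)
    refine h1.congr_deriv ?_
    simp only [b', id]
    congr 2
    ring
  have hbc : ∀ x ∈ Ω, ContinuousOn (fun y => b' (x, y)) (Ici 0) := by
    intro x _
    have h1 : ContinuousOn (fun y : ℝ => (h + y) ^ 2) (Ici 0) := by fun_prop
    have h2 := (continuousOn_const (c := h ^ 2) (s := Ici (0 : ℝ))).div h1
      fun y (hy : 0 ≤ y) => by positivity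
    exact (continuousOn_const (c := κ x) (s := Ici (0 : ℝ))).mul h2
  obtain ⟨hFint, hF0⟩ := integral_vertical_eq_zero hu (le_refl (2 : ℝ)) hbd hbc
    (fun x _ => by simp [b]) htb htb'
  norm_num only [Real.rpow_two, Real.rpow_zero, sq_abs, mul_one] at hFint hF0
  set F : Rn n × ℝ → ℝ := fun z => b' z * u z ^ 2 + b z * (2 * u z * yDeriv u z)
  -- Three mechanisms cover the cylinder. If `y > h`, the remainder controls `u²`. If `y ≤ h` and `d
  -- < 16h`, then `rθ ≤ 34h` and the Hardy weight does. If `y ≤ h` and `d ≥ 16h`, the integration by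
  -- parts behind `F` does: `b wS ≤ 1/16` leaves `1/4 - 1/8` of `u²`, whence the factor 8. The 2 in
  -- `2k` compensates for the possible `-u²` in `8F` when `y > h`.
  have hpt : ∀ᵐ z ∂(cylMeasure Ω), u z ^ 2 ≤ 8 * F z + (16 * h * (|u z| * √(groundEnergy Ω u z)) +
      (2 * k * (z.2 / (R + z.2) ^ 3 * (u z / angle Ω z) ^ 2) +
        34 * h * (hardyWeight Ω z * u z ^ 2))) := by
    filter_upwards [ae_cylMeasure hΩ] with z hz
    obtain ⟨hx, hy, -⟩ := hz
    have hd := bdryDist_pos hΩ hne hx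
    have hv0 := sq_nonneg (u z)
    have t1 : 0 ≤ 16 * h * (|u z| * √(groundEnergy Ω u z)) := by positivity
    have t2 : 0 ≤ 2 * k * (z.2 / (R + z.2) ^ 3 * (u z / angle Ω z) ^ 2) := by positivity
    have t3 : 0 ≤ 34 * h * (hardyWeight Ω z * u z ^ 2) := by
      have := hardyWeight_nonneg (Ω := Ω) z
      positivity
    have hdec : h < z.2 → u z ^ 2 ≤ k * (z.2 / (R + z.2) ^ 3 * (u z / angle Ω z) ^ 2) :=
      fun hlt => angle_decay hh hd (hR _ hx) hlt (u z)
    by_cases hcase : 16 * h ≤ bdryDist Ω z.1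
    · have hκ : κ z.1 = 1 := if_pos hcase
      obtain ⟨c1, c2⟩ := hb1 z.2 hy
      obtain ⟨c3, c4⟩ := hb2 z.2 hy
      have hY : yDeriv u z = groundY Ω u z - u z * wS Ω z := by simp [groundY]
      have hF : F z = h ^ 2 / (h + z.2) ^ 2 * u z ^ 2 -
          2 * (h * z.2 / (h + z.2) * wS Ω z) * u z ^ 2 +
          2 * (h * z.2 / (h + z.2) * (u z * groundY Ω u z)) := by
        simp only [F, b, b', hκ, hY]; ring
      have hS0 : 0 ≤ wS Ω z := angleRatioS_nonneg hd.le _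
      have hS1 : wS Ω z ≤ 1 / (16 * h) :=
        (angleRatioS_le hd _).trans (one_div_le_one_div_of_le (by positivity) hcase)
      have e1 : h * z.2 / (h + z.2) * wS Ω z ≤ 1 / 16 := by
        calc h * z.2 / (h + z.2) * wS Ω z ≤ h * (1 / (16 * h)) := by gcongr
          _ = 1 / 16 := by field_simp
      have e2 : -(h * (|u z| * √(groundEnergy Ω u z))) ≤
          h * z.2 / (h + z.2) * (u z * groundY Ω u z) := by
        refine neg_le_of_abs_le ?_
        rw [abs_mul, abs_mul, abs_of_nonneg c1]
        gcongr
        exact abs_groundY_le z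
      have e3 : 2 * (h * z.2 / (h + z.2) * wS Ω z) * u z ^ 2 ≤ 1 / 8 * u z ^ 2 :=
        mul_le_mul_of_nonneg_right (by linarith) hv0
      by_cases hyh : z.2 ≤ h
      · have e4 : 1 / 4 ≤ h ^ 2 / (h + z.2) ^ 2 := by
          rw [div_le_div_iff₀ (by norm_num) (by positivity)]
          nlinarith
        have e5 : 1 / 4 * u z ^ 2 ≤ h ^ 2 / (h + z.2) ^ 2 * u z ^ 2 :=
          mul_le_mul_of_nonneg_right e4 hv0
        rw [hF]; linarith
      · have e5 := mul_nonneg c3 hv0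
        have := hdec (not_le.1 hyh)
        rw [hF]; linarith
    · have hκ : κ z.1 = 0 := if_neg hcase
      have hF : F z = 0 := by simp only [F, b, b', hκ]; ring
      rw [hF]
      by_cases hyh : z.2 ≤ h
      · have hθ := polarAngle_pos (bdryDist Ω z.1) z.2
        have hθ2 := polarAngle_le_two hd hy.le
        rw [← angle] at hθ hθ2
        have hr0 : 0 < √(bdryDist Ω z.1 ^ 2 + z.2 ^ 2) := Real.sqrt_pos.2 (by positivity)
        have hr : √(bdryDist Ω z.1 ^ 2 + z.2 ^ 2) ≤ 17 * h :=
          (Real.sqrt_le_left (by positivity)).2 (by nlinarith)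
        have e1 : 1 ≤ 34 * h * hardyWeight Ω z := by
          rw [hardyWeight, mul_one_div, one_le_div (by positivity)]
          calc _ ≤ 17 * h * 2 := by gcongr
            _ = 34 * h := by ring
        have e2 := mul_le_mul_of_nonneg_right e1 hv0
        linarith
      · have := hdec (not_le.1 hyh)
        linarith
  have hmono := integral_mono_ae hN ((hFint.const_mul 8).add ((hJ.const_mul (16 * h)).add
    ((hD.const_mul (2 * k)).add (hT.const_mul (34 * h))))) hpt
  rw [integral_add' (hFint.const_mul 8) ((hJ.const_mul (16 * h)).add
    ((hD.const_mul (2 * k)).add (hT.const_mul (34 * h)))), integral_add' (hJ.const_mul (16 * h))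
    ((hD.const_mul (2 * k)).add (hT.const_mul (34 * h))), integral_add' (hD.const_mul (2 * k))
    (hT.const_mul (34 * h)), integral_const_mul, integral_const_mul, integral_const_mul,
    integral_const_mul, hF0] at hmono
  -- Young's inequality; `32h + 1 = 2(16h + 1/2)` is the coefficient of this integral once half of
  -- `∫ u²` has been absorbed.
  have hJle : (32 * h + 1) * (∫ z, |u z| * √(groundEnergy Ω u z) ∂(cylMeasure Ω)) ≤
      1 / 2 * (∫ z, u z ^ 2 ∂(cylMeasure Ω)) +
        (32 * h + 1) ^ 2 / 2 * ∫ z, groundEnergy Ω u z ∂(cylMeasure Ω) := by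
    rw [← integral_const_mul, ← integral_const_mul, ← integral_const_mul,
      ← integral_add (hN.const_mul _) (hA.const_mul _)]
    refine integral_mono (hJ.const_mul _) ((hN.const_mul _).add (hA.const_mul _)) fun z => ?_
    have e1 := Real.sq_sqrt (groundEnergy_nonneg (Ω := Ω) (u := u) z)
    have e2 := sq_abs (u z)
    beta_reduce
    nlinarith [sq_nonneg (|u z| - (32 * h + 1) * √(groundEnergy Ω u z))]
  have hJ0 : 0 ≤ ∫ z, |u z| * √(groundEnergy Ω u z) ∂(cylMeasure Ω) :=
    integral_nonneg fun z => by positivity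
  have hA0 : 0 ≤ ∫ z, groundEnergy Ω u z ∂(cylMeasure Ω) :=
    integral_nonneg fun z => groundEnergy_nonneg z
  have hD0 : 0 ≤ ∫ z, z.2 / (R + z.2) ^ 3 * (u z / angle Ω z) ^ 2 ∂(cylMeasure Ω) :=
    integral_nonneg_of_ae (by
      filter_upwards [ae_cylMeasure hΩ] with z hz
      have := hz.2.1
      simp only [Pi.zero_apply]
      positivity)
  have hT2 := mul_le_mul_of_nonneg_left hH2 (by positivity : 0 ≤ 34 * h)
  rw [← mul_assoc, hhC] at hT2
  have g1 : 0 ≤ (32 * h + 1) ^ 2 * ∫ z, z.2 / (R + z.2) ^ 3 * (u z / angle Ω z) ^ 2 ∂(cylMeasure Ω) := by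
    positivity
  have g2 : 0 ≤ k * ∫ z, groundEnergy Ω u z ∂(cylMeasure Ω) := by positivity
  linarith

end HardyConsequences

/-! ### The `L¹` Sobolev inequality on a half-space. -/

section Sobolev

open Filter Topology

variable {n : ℕ}

/-- Smooth approximation of the even reflection in the last variable. -/
noncomputable def smoothFold (n : ℕ) (κ : ℝ) (z : Rn n × ℝ) : Rn n × ℝ := (z.1, √(z.2 ^ 2 + κ ^ 2))

theorem le_sqrt_sq_add_sq (y κ : ℝ) : |y| ≤ √(y ^ 2 + κ ^ 2) :=
  Real.abs_le_sqrt (by linarith [sq_nonneg κ])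

theorem continuous_smoothFold (κ : ℝ) : Continuous (smoothFold n κ) := by
  unfold smoothFold; fun_prop

theorem contDiff_smoothFold {κ : ℝ} (hκ : κ ≠ 0) : ContDiff ℝ 1 (smoothFold n κ) := by
  refine contDiff_fst.prodMk (ContDiff.sqrt (by fun_prop) fun z => ?_)
  positivity

/-- Both components are 1-Lipschitz and the product carries the sup norm, so folding does not
increase gradients, uniformly in `κ`. -/
theorem norm_fderiv_smoothFold_le {κ : ℝ} (hκ : κ ≠ 0) (z : Rn n × ℝ) :
    ‖fderiv ℝ (smoothFold n κ) z‖ ≤ 1 := by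
  have hlip : LipschitzWith 1 (smoothFold n κ) := by
    have h1 : LipschitzWith 1 (fun y : ℝ => √(y ^ 2 + κ ^ 2)) := by
      refine lipschitzWith_of_nnnorm_deriv_le ?_ fun y => ?_
      · intro y
        exact (DifferentiableAt.sqrt (by fun_prop) (by positivity))
      · have hpos : 0 < y ^ 2 + κ ^ 2 := by positivity
        have h2 : HasDerivAt (fun y : ℝ => √(y ^ 2 + κ ^ 2)) (2 * y / (2 * √(y ^ 2 + κ ^ 2))) y := by
          have : HasDerivAt (fun y : ℝ => y ^ 2 + κ ^ 2) (2 * y) y := by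
            simpa using (hasDerivAt_pow 2 y).add_const (κ ^ 2)
          exact this.sqrt hpos.ne'
        rw [h2.deriv, ← NNReal.coe_le_coe, coe_nnnorm, NNReal.coe_one, Real.norm_eq_abs,
          mul_div_mul_left _ _ two_ne_zero, abs_div, abs_of_pos (Real.sqrt_pos.2 hpos),
          div_le_one (Real.sqrt_pos.2 hpos)]
        exact le_sqrt_sq_add_sq y κ
    have : LipschitzWith (max 1 (1 * 1)) (smoothFold n κ) := LipschitzWith.prodMk (LipschitzWith.prod_fst (α := Rn n) (β := ℝ))
      (h1.comp (LipschitzWith.prod_snd (α := Rn n) (β := ℝ)))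
    simpa using this
  simpa using norm_fderiv_le_of_lipschitz ℝ hlip (x₀ := z)

/-- Since `|y| ≤ √(y² + κ²)`, one compact set serves every `κ`; this provides the domination as `κ →
0`. -/
theorem hasCompactSupport_comp_smoothFold {G : Rn n × ℝ → ℝ} (hG : HasCompactSupport G) :
    ∃ S : Set (Rn n × ℝ), IsCompact S ∧ ∀ κ, ∀ z ∉ S, G (smoothFold n κ z) = 0 := by
  have hK : IsCompact (tsupport G) := hG
  obtain ⟨Y, hY⟩ := hK.exists_bound_of_continuousOn (continuous_snd (X := Rn n) (Y := ℝ)).continuousOn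
  refine ⟨(Prod.fst '' tsupport G) ×ˢ Icc (-Y) Y, (hK.image continuous_fst).prod isCompact_Icc,
    fun κ z hz => ?_⟩
  by_contra h
  have hmem := subset_tsupport _ h
  have h1 := hY _ hmem
  refine hz ⟨⟨_, hmem, rfl⟩, ?_⟩
  rw [Set.mem_Icc, ← abs_le]
  exact (le_sqrt_sq_add_sq z.2 κ).trans ((le_abs_self _).trans h1)

/-- The fold tends to `(x, |y|)`, and an even function integrates to twice its half-space integral.
-/
theorem tendsto_integral_comp_smoothFold {G : Rn n × ℝ → ℝ} (hGc : Continuous G)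
    (hG : HasCompactSupport G) :
    Tendsto (fun k : ℕ => ∫ z, G (smoothFold n (1 / ((k : ℝ) + 1)) z)) atTop
      (𝓝 (2 * ∫ z in univ ×ˢ Ioi (0 : ℝ), G z)) := by
  obtain ⟨S, hS, hS0⟩ := hasCompactSupport_comp_smoothFold hG
  obtain ⟨C, hC⟩ := hGc.bounded_above_of_compact_support hG
  have hlim : Tendsto (fun k : ℕ => ∫ z, G (smoothFold n (1 / ((k : ℝ) + 1)) z)) atTop
      (𝓝 (∫ z : Rn n × ℝ, G (z.1, |z.2|))) := by
    refine tendsto_integral_of_dominated_convergence (S.indicator fun _ => C) ?_ ?_ ?_ ?_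
    · exact fun k => (hGc.comp (continuous_smoothFold _)).aestronglyMeasurable
    · exact (integrable_indicator_iff hS.measurableSet).2 (integrableOn_const hS.measure_lt_top.ne)
    · refine fun k => Eventually.of_forall fun z => ?_
      by_cases hz : z ∈ S
      · simpa [hz] using hC _
      · simp [hz, hS0 _ z hz]
    · refine Eventually.of_forall fun z => ?_
      refine (hGc.tendsto (z.1, |z.2|)).comp ?_
      refine tendsto_const_nhds.prodMk_nhds ?_
      have h1 : Tendsto (fun k : ℕ => 1 / ((k : ℝ) + 1)) atTop (𝓝 0) :=
        tendsto_one_div_add_atTop_nhds_zero_nat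
      have h2 : Continuous fun κ : ℝ => √(z.2 ^ 2 + κ ^ 2) := by fun_prop
      have h3 := (h2.tendsto 0).comp h1
      rwa [zero_pow two_ne_zero, add_zero, Real.sqrt_sq_eq_abs] at h3
  convert hlim using 2
  have hint : Integrable (fun z : Rn n × ℝ => G (z.1, |z.2|)) := by
    refine Continuous.integrable_of_hasCompactSupport (by fun_prop) ?_
    refine HasCompactSupport.intro hS fun z hz => ?_
    have := hS0 0 z hz
    simpa [smoothFold, Real.sqrt_sq_eq_abs] using this
  have hGi : IntegrableOn G (univ ×ˢ Ioi (0 : ℝ)) (volume.prod volume) :=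
    (hGc.integrable_of_hasCompactSupport hG).integrableOn
  rw [Measure.volume_eq_prod, integral_prod _ hint, setIntegral_prod _ hGi, setIntegral_univ,
    ← integral_const_mul]
  refine integral_congr_ae (Eventually.of_forall fun x => ?_)
  exact (integral_comp_abs (f := fun y => G (x, y))).symm

instance : (volume : Measure (Rn n × ℝ)).IsAddHaarMeasure :=
  inferInstanceAs ((volume : Measure (Rn n)).prod (volume : Measure ℝ)).IsAddHaarMeasure

/-- The Gagliardo–Nirenberg–Sobolev inequality on a half-space, for functions that need not vanish
on the boundary hyperplane. -/
theorem exists_halfSpace_sobolev {r : ℝ} (hr : Real.HolderConjugate (n + 1) r) :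
    ∃ C : ℝ, 0 < C ∧ ∀ F : Rn n × ℝ → ℝ, ContDiff ℝ 1 F → HasCompactSupport F →
      (∫ z in univ ×ˢ Ioi (0 : ℝ), |F z| ^ r) ≤
        C * (∫ z in univ ×ˢ Ioi (0 : ℝ), ‖fderiv ℝ F z‖) ^ r := by
  have hfin : Module.finrank ℝ (Rn n × ℝ) = n + 1 := by simp
  have hr0 : 0 < r := hr.symm.pos
  set C₀ := lintegralPowLePowLIntegralFDerivConst (volume : Measure (Rn n × ℝ)) r
  -- Adding 1 makes the constant positive; `2 ^ r` comes from doubling the gradient integral by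
  -- reflection.
  refine ⟨(C₀ + 1) * 2 ^ r, by positivity, fun F hF hc => ?_⟩
  have hFr : Continuous fun z => |F z| ^ r := hF.continuous.abs.rpow_const fun _ => Or.inr hr0.le
  have hFrc : HasCompactSupport fun z => |F z| ^ r :=
    hc.comp_left (g := fun t => |t| ^ r) (by simp [Real.zero_rpow hr0.ne'])
  have hD : Continuous fun z => ‖fderiv ℝ F z‖ := (hF.continuous_fderiv (by simp)).norm
  have hDc : HasCompactSupport fun z => ‖fderiv ℝ F z‖ := (hc.fderiv ℝ).norm
  -- The exact reflection has a kink on the hyperplane. For `κ ≠ 0` the folded function is `C¹` and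
  -- the whole-space inequality applies, with a constant independent of `κ`.
  have hk : ∀ k : ℕ, ∫ z, |F (smoothFold n (1 / ((k : ℝ) + 1)) z)| ^ r ≤
      C₀ * (∫ z, ‖fderiv ℝ F (smoothFold n (1 / ((k : ℝ) + 1)) z)‖) ^ r := by
    intro k
    set κ : ℝ := 1 / ((k : ℝ) + 1)
    have hκ : κ ≠ 0 := by positivity
    have hcd : ContDiff ℝ 1 (fun z => F (smoothFold n κ z)) := hF.comp (contDiff_smoothFold hκ)
    obtain ⟨S, hS, hS0⟩ := hasCompactSupport_comp_smoothFold hc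
    have hcs : HasCompactSupport (fun z => F (smoothFold n κ z)) :=
      HasCompactSupport.intro hS (hS0 κ)
    obtain ⟨S', hS', hS0'⟩ := hasCompactSupport_comp_smoothFold hDc
    have hgns := lintegral_pow_le_pow_lintegral_fderiv (volume : Measure (Rn n × ℝ)) hcd hcs
      (p := r) (by rw [hfin]; exact_mod_cast hr)
    have hI1 : Integrable (fun z => |F (smoothFold n κ z)| ^ r) :=
      Continuous.integrable_of_hasCompactSupport (hFr.comp (continuous_smoothFold κ))
        (HasCompactSupport.intro hS fun z hz => by simp [hS0 κ z hz, Real.zero_rpow hr0.ne'])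
    have hI2 : Integrable (fun z => ‖fderiv ℝ F (smoothFold n κ z)‖) :=
      Continuous.integrable_of_hasCompactSupport (hD.comp (continuous_smoothFold κ))
        (HasCompactSupport.intro hS' (hS0' κ))
    have h1 : ∫⁻ z, ‖F (smoothFold n κ z)‖ₑ ^ r = ENNReal.ofReal (∫ z, |F (smoothFold n κ z)| ^ r) := by
      rw [ofReal_integral_eq_lintegral_ofReal hI1 (Eventually.of_forall fun z => by positivity)]
      refine lintegral_congr fun z => ?_
      rw [← ENNReal.ofReal_rpow_of_nonneg (abs_nonneg _) hr0.le, ← Real.enorm_eq_ofReal_abs]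
    have h2 : ∫⁻ z, ‖fderiv ℝ (fun z => F (smoothFold n κ z)) z‖ₑ ≤
        ENNReal.ofReal (∫ z, ‖fderiv ℝ F (smoothFold n κ z)‖) := by
      rw [ofReal_integral_eq_lintegral_ofReal hI2 (Eventually.of_forall fun z => by positivity)]
      refine lintegral_mono fun z => ?_
      rw [← ofReal_norm]
      refine ENNReal.ofReal_le_ofReal ?_
      have : fderiv ℝ (fun z => F (smoothFold n κ z)) z =
          (fderiv ℝ F (smoothFold n κ z)).comp (fderiv ℝ (smoothFold n κ) z) :=
        fderiv_comp z (hF.differentiable (by simp) _)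
          ((contDiff_smoothFold hκ).differentiable (by simp) _)
      rw [this]
      exact (ContinuousLinearMap.opNorm_comp_le _ _).trans
        (mul_le_of_le_one_right (norm_nonneg _) (norm_fderiv_smoothFold_le hκ z))
    rw [h1] at hgns
    have h3 : ENNReal.ofReal (∫ z, |F (smoothFold n κ z)| ^ r) ≤
        ENNReal.ofReal (C₀ * (∫ z, ‖fderiv ℝ F (smoothFold n κ z)‖) ^ r) := by
      refine hgns.trans ?_
      rw [ENNReal.ofReal_mul C₀.coe_nonneg, ← ENNReal.ofReal_rpow_of_nonneg (by positivity) hr0.le,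
        ENNReal.ofReal_coe_nnreal]
      gcongr
    exact (ENNReal.ofReal_le_ofReal_iff (by positivity)).1 h3
  have hl := tendsto_integral_comp_smoothFold hFr hFrc
  have hl2 := (((tendsto_integral_comp_smoothFold hD hDc).rpow_const
    (Or.inr hr0.le) : Tendsto _ _ (𝓝 (_ ^ r)))).const_mul (C₀ : ℝ)
  have hle := le_of_tendsto_of_tendsto' hl hl2 hk
  have hI0 : 0 ≤ ∫ z in univ ×ˢ Ioi (0 : ℝ), ‖fderiv ℝ F z‖ := integral_nonneg fun z => norm_nonneg _
  have hI1 : 0 ≤ ∫ z in univ ×ˢ Ioi (0 : ℝ), |F z| ^ r := integral_nonneg fun z => by positivity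
  rw [Real.mul_rpow two_pos.le hI0] at hle
  have h0 : 0 ≤ (2 : ℝ) ^ r * (∫ z in univ ×ˢ Ioi (0 : ℝ), ‖fderiv ℝ F z‖) ^ r := by positivity
  nlinarith

end Sobolev

/-! ### Combining the Hardy and Sobolev inequalities. -/

section HardySobolev

variable {n : ℕ} {Ω : Set (Rn n)} {u : Rn n × ℝ → ℝ}

theorem norm_fderiv_le_xGrad_add_yDeriv (hu : Differentiable ℝ u) (z : Rn n × ℝ) :
    ‖fderiv ℝ u z‖ ≤ ‖xGrad u z‖ + |yDeriv u z| := by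
  refine ContinuousLinearMap.opNorm_le_bound _ (by positivity) fun w => ?_
  have h1 : fderiv ℝ u z w = inner ℝ (xGrad u z) w.1 + w.2 * yDeriv u z := by
    rw [xGrad_eq hu, yDeriv_eq hu, InnerProductSpace.toDual_symm_apply, ← smul_eq_mul, ← map_smul,
      ContinuousLinearMap.comp_apply, ContinuousLinearMap.inl_apply, ← map_add]
    simp
  rw [h1, Real.norm_eq_abs]
  calc |inner ℝ (xGrad u z) w.1 + w.2 * yDeriv u z|
      ≤ |inner ℝ (xGrad u z) w.1| + |w.2 * yDeriv u z| := abs_add_le _ _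
    _ ≤ ‖xGrad u z‖ * ‖w.1‖ + |w.2| * |yDeriv u z| := by
      rw [abs_mul]; gcongr; exact abs_real_inner_le_norm _ _
    _ ≤ ‖xGrad u z‖ * ‖w‖ + ‖w‖ * |yDeriv u z| := by
      gcongr
      · exact norm_fst_le w
      · exact norm_snd_le w
    _ = (‖xGrad u z‖ + |yDeriv u z|) * ‖w‖ := by ring

/-- With `v = u/θ`, `∇u = θ∇v + u ∇θ/θ`, and each component of `∇θ/θ` is bounded by the Hardy weight
`1/(rθ)`. -/
theorem norm_fderiv_le_groundEnergy (hu : Differentiable ℝ u) {z : Rn n × ℝ}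
    (hd : 0 < bdryDist Ω z.1) (hy : 0 < z.2) :
    ‖fderiv ℝ u z‖ ≤ 2 * √(groundEnergy Ω u z) + 2 * (|u z| * hardyWeight Ω z) := by
  have hG : ‖gradient (bdryDist Ω) z.1‖ ≤ 1 := by
    simpa using (bdryDist_lipschitz Ω).norm_gradient_le z.1
  have hY0 : 0 ≤ wY Ω z := angleRatioY_nonneg _ hy.le
  have hS0 : 0 ≤ wS Ω z := angleRatioS_nonneg hd.le _
  have hx : ‖xGrad u z‖ ≤ √(groundEnergy Ω u z) + |u z| * hardyWeight Ω z := by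
    have e : xGrad u z = groundX Ω u z + (u z * wY Ω z) • gradient (bdryDist Ω) z.1 := by
      simp [groundX]
    rw [e]
    refine (norm_add_le _ _).trans (add_le_add (norm_groundX_le z) ?_)
    rw [norm_smul, norm_mul, Real.norm_eq_abs, Real.norm_eq_abs, abs_of_nonneg hY0]
    calc |u z| * wY Ω z * ‖gradient (bdryDist Ω) z.1‖ ≤ |u z| * hardyWeight Ω z * 1 := by
          gcongr
          · exact mul_nonneg (abs_nonneg _) (hardyWeight_nonneg z)
          · exact wY_le_hardyWeight z hd
      _ = _ := mul_one _
  have hyd : |yDeriv u z| ≤ √(groundEnergy Ω u z) + |u z| * hardyWeight Ω z := by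
    have e : yDeriv u z = groundY Ω u z - u z * wS Ω z := by simp [groundY]
    rw [e]
    refine (abs_sub _ _).trans (add_le_add (abs_groundY_le z) ?_)
    rw [abs_mul, abs_of_nonneg hS0]
    gcongr
    exact wS_le_hardyWeight z hd
  linarith [norm_fderiv_le_xGrad_add_yDeriv hu z]

theorem setIntegral_halfSpace_eq {f : Rn n × ℝ → ℝ} (hf : ∀ z, z.1 ∉ Ω → f z = 0) :
    ∫ z in univ ×ˢ Ioi (0 : ℝ), f z = ∫ z, f z ∂(cylMeasure Ω) := by
  rw [cylMeasure_eq]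
  refine setIntegral_eq_of_subset_of_forall_sdiff_eq_zero
    (MeasurableSet.univ.prod measurableSet_Ioi) (prod_mono_left (subset_univ _)) fun z hz => ?_
  exact hf z fun h => hz.2 ⟨h, hz.1.2⟩

theorem sq_integral_mul_le {α : Type*} [MeasurableSpace α] {μ : Measure α} {f g : α → ℝ}
    (hf : Integrable (fun a => f a ^ 2) μ) (hg : Integrable (fun a => g a ^ 2) μ)
    (hfg : Integrable (fun a => f a * g a) μ) :
    (∫ a, f a * g a ∂μ) ^ 2 ≤ (∫ a, f a ^ 2 ∂μ) * ∫ a, g a ^ 2 ∂μ := by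
  have h : ∀ t : ℝ, 0 ≤ (∫ a, f a ^ 2 ∂μ) * (t * t) + 2 * (∫ a, f a * g a ∂μ) * t +
      ∫ a, g a ^ 2 ∂μ := by
    intro t
    have h0 : 0 ≤ ∫ a, (t * f a + g a) ^ 2 ∂μ := integral_nonneg fun a => sq_nonneg _
    have e : ∀ a, (t * f a + g a) ^ 2 = t * t * f a ^ 2 + 2 * t * (f a * g a) + g a ^ 2 :=
      fun a => by ring
    simp_rw [e] at h0
    have hs : Integrable (fun a => t * t * f a ^ 2 + 2 * t * (f a * g a)) μ :=
      (hf.const_mul _).add (hfg.const_mul _)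
    rw [integral_add hs hg,
      integral_add (hf.const_mul _) (hfg.const_mul _), integral_const_mul, integral_const_mul] at h0
    linarith
  have := discrim_le_zero h
  rw [discrim] at this
  nlinarith

variable (hΩ : IsOpen Ω) (hne : (frontier Ω).Nonempty)

include hΩ hne

/-- The Sobolev inequality on `Ω × (0, ∞)` with the gradient replaced by the ground state energy. -/
theorem UniformlyLipschitz.exists_integral_rpow_le (hLip : UniformlyLipschitz Ω) {p r : ℝ}
    (hp : 2 ≤ p) (hr : Real.HolderConjugate (n + 1) r) :
    ∃ C : ℝ, 0 < C ∧ ∀ u : Rn n × ℝ → ℝ, IsTestFunction (Ω ×ˢ (univ : Set ℝ)) u →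
      ∫ z, |u z| ^ (p * r) ∂(cylMeasure Ω) ≤
        C * ((∫ z, |u z| ^ (p - 1) * √(groundEnergy Ω u z) ∂(cylMeasure Ω)) +
          ∫ z, |u z| ^ p ∂(cylMeasure Ω)) ^ r := by
  obtain ⟨C₁, hC₁, hS⟩ := exists_halfSpace_sobolev (n := n) hr
  obtain ⟨C₂, hC₂, hH⟩ := hLip.exists_integral_hardyWeight_le hΩ hne hp
  have hp1 : 1 < p := by linarith
  have hp0 : 0 < p := by linarith
  have hr0 : 0 < r := hr.symm.pos
  refine ⟨C₁ * (p * (2 + 2 * C₂)) ^ r, by positivity, fun u hu => ?_⟩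
  have hzero : ∀ z : Rn n × ℝ, z.1 ∉ Ω → z ∉ tsupport u := fun z hz h => hz (hu.mem_of_tsupport h)
  have hF : ContDiff ℝ 1 fun z => |u z| ^ p := (hu.smooth.of_le (by simp)).norm_rpow hp1
  have hFc : HasCompactSupport fun z => |u z| ^ p :=
    hu.hasCompactSupport.comp_left (g := fun t => |t| ^ p) (by simp [Real.zero_rpow hp0.ne'])
  have hsupp : tsupport (fun z => |u z| ^ p) ⊆ tsupport u :=
    closure_mono fun z hz h => hz (by simp [h, Real.zero_rpow hp0.ne'])
  have hD0 : ∀ z ∉ tsupport u, fderiv ℝ (fun z => |u z| ^ p) z = 0 := fun z hz =>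
    image_eq_zero_of_notMem_tsupport fun h => hz (hsupp (tsupport_fderiv_subset ℝ h))
  have key := hS _ hF hFc
  have e : ∀ z, |(|u z| ^ p)| ^ r = |u z| ^ (p * r) := fun z => by
    rw [abs_of_nonneg (by positivity), ← Real.rpow_mul (abs_nonneg _)]
  simp_rw [e] at key
  rw [setIntegral_halfSpace_eq fun z hz => by
      simp [image_eq_zero_of_notMem_tsupport (hzero z hz), Real.zero_rpow (mul_pos hp0 hr0).ne'],
    setIntegral_halfSpace_eq fun z hz => by rw [hD0 z (hzero z hz), norm_zero]] at key
  set J := ∫ z, |u z| ^ (p - 1) * √(groundEnergy Ω u z) ∂(cylMeasure Ω)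
  set N := ∫ z, |u z| ^ p ∂(cylMeasure Ω)
  have hJ := integrable_rpow_mul_sqrt hΩ hne hu hp1
  have hT := integrable_hardyWeight_mul hΩ hne hu hp0
  have hD : Integrable (fun z => ‖fderiv ℝ (fun z => |u z| ^ p) z‖) (cylMeasure Ω) :=
    (Tame.of_continuous hu.hasCompactSupport
      (hF.continuous_fderiv (by simp)).norm).integrable hu.hasCompactSupport
      fun z hz => by rw [hD0 z hz, norm_zero]
  have hmono := integral_mono_ae hD ((hJ.const_mul (2 * p)).add (hT.const_mul (2 * p))) (by
    filter_upwards [ae_cylMeasure hΩ] with z hz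
    have h1 := norm_fderiv_norm_rpow_le hu.differentiable (x := z) hp1
    have h2 := norm_fderiv_le_groundEnergy hu.differentiable (bdryDist_pos hΩ hne hz.1) hz.2.1
    have h3 : |u z| ^ (p - 1) * |u z| = |u z| ^ p := by
      rw [← Real.rpow_add_one' (abs_nonneg _) (by linarith), sub_add_cancel]
    refine h1.trans ((mul_le_mul_of_nonneg_left h2 (by positivity)).trans (le_of_eq ?_))
    rw [Pi.add_apply, ← h3, Real.norm_eq_abs]
    ring)
  rw [integral_add' (hJ.const_mul (2 * p)) (hT.const_mul (2 * p)), integral_const_mul,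
    integral_const_mul] at hmono
  have hJ0 : 0 ≤ J := integral_nonneg fun z => by positivity
  have hN0 : 0 ≤ N := integral_nonneg fun z => by positivity
  have h4 := mul_le_mul_of_nonneg_left (hH u hu) (by positivity : 0 ≤ 2 * p)
  have h5 : ∫ z, ‖fderiv ℝ (fun z => |u z| ^ p) z‖ ∂(cylMeasure Ω) ≤
      p * (2 + 2 * C₂) * (J + N) := by
    have := mul_nonneg hp0.le hN0
    linarith
  refine key.trans ?_
  rw [mul_assoc, ← Real.mul_rpow (by positivity) (by positivity)]
  gcongr

/-- The ground state energy together with its remainder controls the critical Lebesgue norm. -/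
theorem UniformlyLipschitz.exists_rpow_integral_le (hLip : UniformlyLipschitz Ω) (hn : 2 ≤ n) {R : ℝ}
    (hR0 : 0 < R) (hR : ∀ x ∈ Ω, bdryDist Ω x ≤ R) :
    ∃ C : ℝ, 0 < C ∧ ∀ u : Rn n × ℝ → ℝ, IsTestFunction (Ω ×ˢ (univ : Set ℝ)) u →
      (∫ z, |u z| ^ (2 * ((n : ℝ) + 1) / ((n : ℝ) - 1)) ∂(cylMeasure Ω)) ^
          (((n : ℝ) - 1) / ((n : ℝ) + 1)) ≤
        C * (1 / 2 * (∫ z, groundEnergy Ω u z ∂(cylMeasure Ω)) +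
          1 / 8 * ∫ z, z.2 / (R + z.2) ^ 3 * (u z / angle Ω z) ^ 2 ∂(cylMeasure Ω)) := by
  have hn' : (2 : ℝ) ≤ n := by exact_mod_cast hn
  have hn0 : (0 : ℝ) < n := by linarith
  have hn1 : (0 : ℝ) < (n : ℝ) - 1 := by linarith
  have hn2 : (0 : ℝ) < (n : ℝ) + 1 := by linarith
  set q : ℝ := 2 * ((n : ℝ) + 1) / ((n : ℝ) - 1) with hq
  -- This exponent satisfies both `pr = q` and `2(p-1) = q`: the Sobolev inequality produces the
  -- integral `X`, and both Cauchy–Schwarz estimates return the same `X`. As `2/r = 1 + s`,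
  -- cancelling one power leaves `X^s`.
  set p : ℝ := 2 * n / ((n : ℝ) - 1) with hp
  set r : ℝ := ((n : ℝ) + 1) / n with hr
  set s : ℝ := ((n : ℝ) - 1) / ((n : ℝ) + 1) with hs
  have hp2 : 2 ≤ p := by rw [hp, le_div_iff₀ hn1]; linarith
  have hconj : Real.HolderConjugate (n + 1) r := by
    rw [Real.holderConjugate_iff, hr]
    refine ⟨by linarith, ?_⟩
    field_simp
    ring
  have hr0 : 0 < r := by positivity
  have hs0 : 0 < s := by positivity
  have hpr : p * r = q := by rw [hp, hr, hq]; field_simp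
  have hpq : (p - 1) * 2 = q := by rw [hp, hq]; field_simp; ring
  have hrs : 2 / r = 1 + s := by rw [hr, hs]; field_simp; ring
  obtain ⟨C₁, hC₁, hS⟩ := hLip.exists_integral_rpow_le hΩ hne hp2 hconj
  obtain ⟨C₂, hC₂, hL⟩ := hLip.exists_integral_sq_le hΩ hne hR0 hR
  refine ⟨C₁ ^ (2 / r) * (4 + 2 * C₂), by positivity, fun u hu => ?_⟩
  have h1 := hS u hu
  have h2 := hL u hu
  rw [hpr] at h1
  set X := ∫ z, |u z| ^ q ∂(cylMeasure Ω)
  set J := ∫ z, |u z| ^ (p - 1) * √(groundEnergy Ω u z) ∂(cylMeasure Ω) with hJ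
  set N := ∫ z, |u z| ^ p ∂(cylMeasure Ω) with hN
  set A := ∫ z, groundEnergy Ω u z ∂(cylMeasure Ω)
  set D := ∫ z, z.2 / (R + z.2) ^ 3 * (u z / angle Ω z) ^ 2 ∂(cylMeasure Ω)
  set E := 1 / 2 * A + 1 / 8 * D
  have hX0 : 0 ≤ X := integral_nonneg fun z => by positivity
  have hJ0 : 0 ≤ J := integral_nonneg fun z => by positivity
  have hN0 : 0 ≤ N := integral_nonneg fun z => by positivity
  have hD0 : 0 ≤ D := integral_nonneg_of_ae (by
    filter_upwards [ae_cylMeasure hΩ] with z hz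
    have := hz.2.1
    simp only [Pi.zero_apply]
    positivity)
  have hA0 : 0 ≤ A := integral_nonneg groundEnergy_nonneg
  have hE0 : 0 ≤ E := by positivity
  have hAE : A ≤ 2 * E := by simp only [E]; linarith
  have hq0 : 0 < q := by positivity
  have hsq : ∀ z, (|u z| ^ (p - 1)) ^ 2 = |u z| ^ q := fun z => by
    rw [← Real.rpow_two, ← Real.rpow_mul (abs_nonneg _), hpq]
  have hf : Integrable (fun z => (|u z| ^ (p - 1)) ^ 2) (cylMeasure Ω) := by
    simp_rw [hsq]; exact integrable_rpow hu hq0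
  have hJ2 : J ^ 2 ≤ X * A := by
    have e : ∀ z, √(groundEnergy Ω u z) ^ 2 = groundEnergy Ω u z :=
      fun z => Real.sq_sqrt (groundEnergy_nonneg z)
    have h := sq_integral_mul_le hf (g := fun z => √(groundEnergy Ω u z)) (by
      simp_rw [e]
      exact (tame_groundEnergy hΩ hne hu).integrable hu.hasCompactSupport
        fun z hz => groundEnergy_eq_zero hu hz)
      (integrable_rpow_mul_sqrt hΩ hne hu (by linarith))
    simp_rw [hsq, e] at h
    exact h
  have hN2 : N ^ 2 ≤ X * ∫ z, u z ^ 2 ∂(cylMeasure Ω) := by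
    have e : ∀ z, |u z| ^ (p - 1) * |u z| = |u z| ^ p := fun z => by
      rw [← Real.rpow_add_one' (abs_nonneg _) (by linarith), sub_add_cancel]
    have h := sq_integral_mul_le hf (g := fun z => |u z|) (by
      simp_rw [sq_abs]
      exact (hu.tame.pow 2).integrable hu.hasCompactSupport fun z hz => by
        simp [image_eq_zero_of_notMem_tsupport hz])
      (by simp_rw [e]; exact integrable_rpow hu (by linarith))
    simp_rw [hsq, e, sq_abs] at h
    exact h
  have h3 : (J + N) ^ 2 ≤ X * ((4 + 2 * C₂) * E) := by
    have h4 := mul_le_mul_of_nonneg_left hAE hX0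
    have h5 := mul_le_mul_of_nonneg_left h2 hX0
    nlinarith [sq_nonneg (J - N)]
  -- Cancelling a factor `X` needs `X > 0`; for `X = 0` the left side vanishes because `s > 0`.
  rcases hX0.eq_or_lt with h0 | hX
  · rw [← h0, Real.zero_rpow hs0.ne']
    positivity
  have h6 : X ^ (1 + s) ≤ C₁ ^ (2 / r) * (X * ((4 + 2 * C₂) * E)) := by
    calc X ^ (1 + s) = X ^ (2 / r) := by rw [hrs]
      _ ≤ (C₁ * (J + N) ^ r) ^ (2 / r) := by gcongr
      _ = C₁ ^ (2 / r) * (J + N) ^ 2 := by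
        rw [Real.mul_rpow hC₁.le (by positivity), ← Real.rpow_mul (by positivity),
          mul_div_cancel₀ _ hr0.ne', Real.rpow_two]
      _ ≤ _ := by gcongr
  rw [Real.rpow_add hX, Real.rpow_one] at h6
  refine le_of_mul_le_mul_left (h6.trans (le_of_eq ?_)) hX
  ring

end HardySobolev

/-! ### Conclusion. -/

theorem theorem3p1 (n : ℕ) (hn : 2 ≤ n) (Ω : Set (Rn n)) (hΩ : IsDomainSet Ω)
    (hΩne : Ω ≠ Set.univ) (hLip : UniformlyLipschitz Ω) (hRin : FiniteInnerRadius Ω)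
    (hconv : WeaklyMeanConvex Ω) :
    ∃ c : ℝ, 0 < c ∧ ∀ u : Rn n × ℝ → ℝ, IsTestFunction (Ω ×ˢ (Set.univ : Set ℝ)) u →
      (2 / Real.pi) * (∫ x in Ω, (u (x, 0)) ^ 2 / bdryDist Ω x) +
        c * (∫ y in Set.Ioi (0 : ℝ), ∫ x in Ω,
              |u (x, y)| ^ (2 * ((n : ℝ) + 1) / ((n : ℝ) - 1))) ^ (((n : ℝ) - 1) / ((n : ℝ) + 1))
      ≤ ∫ y in Set.Ioi (0 : ℝ), ∫ x in Ω, gradSq u x y := by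
  have hne := hΩ.frontier_nonempty hΩne
  obtain ⟨B, hB⟩ := hRin
  -- Any positive upper bound for `d` can serve as `R`.
  have hR0 : 0 < max B 1 := lt_max_of_lt_right one_pos
  have hR : ∀ x ∈ Ω, bdryDist Ω x ≤ max B 1 := fun x hx =>
    (hB (mem_image_of_mem _ hx)).trans (le_max_left _ _)
  obtain ⟨C, hC, h⟩ := hLip.exists_rpow_integral_le hΩ.isOpen hne hn hR0 hR
  refine ⟨1 / C, by positivity, fun u hu => ?_⟩
  have hn' : (2 : ℝ) ≤ n := by exact_mod_cast hn
  have hq : 0 < 2 * ((n : ℝ) + 1) / ((n : ℝ) - 1) := div_pos (by linarith) (by linarith)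
  have hint := integrable_rpow (Ω := Ω) hu hq
  have e := integral_prod_symm _ hint
  have h1 := h u hu
  rw [cylMeasure, e, ← cylMeasure] at h1
  have h2 := groundState_le hΩ.isOpen hne hu hconv hR0 hR
  rw [← div_le_iff₀' hC] at h1
  refine le_trans ?_ h2
  rw [one_div_mul_eq_div]
  gcongr
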